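/- **Problem (MSKC).** An instance $I$ of the multi-choice stochastic knapsack problem with costs consists of $n$ items with $m$ choices each. Item $i$ has a value $v_i$; choice $j$ of item $i$ has a cost $p_i^j\ge 0$ and a distribution $F_i^j$ of a nonnegative size, with finite support, given explicitly as a list of sizes with their probabilities. All numbers are rational. The knapsack has budget $1$. A policy selects item-choice pairs one after another, each item at most once. When $(i,j)$ is selected, the cost $p_i^j$ is paid and the size $s$ is drawn from $F_i^j$, independently of the past. If $s$ is at most the remaining budget, the value $v_i$ is gained, the budget decreases by $s$, and the policy may go on; otherwise nothing is gained and the process ends. The process also ends when the policy outputs $\perp$. The profit is the total value gained minus the total cost paid. An *adaptive policy* decides on the next pair (or $\perp$) from the set of items not yet selected and the remaining budget; $\mathrm{ADAPT}(I)$ is the optimal expected profit of an adaptive policy. A *non-adaptive policy* is a fixed sequence $\pi:[n]\to([n]\times[m])\cup\{\perp\}$ in which no item occurs twice; its selections are made in this order until the process ends. Let $w_{ij}=v_i\Pr_{s\sim F_i^j}[s\le 1]-p_i^j$. The inverse-ROI parameter is $\alpha(I)=\max\{p_i^j/w_{ij} : w_{ij}>0\}$, with $\alpha(I)=0$ if no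 pair has $w_{ij}>0$. **Theorem.** There is a deterministic polynomial-time algorithm (polynomial in the number of bits of the input, on a random access machine with logarithmic cost) that computes, for every instance $I$ of MSKC, a non-adaptive policy $\pi_I$ such that $$\mathrm{ADAPT}(I)\;\le\; 8\,(1+\alpha(I))\cdot \mathbb{E}[\mathrm{profit}(\pi_I)].$$ -/

import Mathlib

/-! ### Finitely supported probability distributions, given explicitly -/

/-- A probability distribution with finite support and rational weights, given as an explicit list
of pairs (outcome, probability). -/
structure FinDist (A : Type) where
  atoms : List (A × ℚ)
  nonneg : ∀ a ∈ atoms, 0 ≤ a.2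
  sum_one : (atoms.map Prod.snd).sum = 1

namespace FinDist

variable {A B : Type}

/-- The expectation of `f` under `d`. -/
def expect (d : FinDist A) (f : A → ℚ) : ℚ :=
  (d.atoms.map fun a => a.2 * f a.1).sum

/-- The probability of the event `E` under `d`. -/
def prob (d : FinDist A) (E : A → Prop) [DecidablePred E] : ℚ :=
  d.expect fun a => if E a then 1 else 0

/-- The distribution of a constant. -/
def pure (a : A) : FinDist A where
  atoms := [(a, 1)]
  nonneg := by simp
  sum_one := by simp

/-- The atoms of the two-stage experiment: draw `a` from the first list, then draw from `f a`. -/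
def bindAtoms (l : List (A × ℚ)) (f : A → FinDist B) : List (B × ℚ) :=
  l.flatMap fun a => (f a.1).atoms.map fun b => (b.1, a.2 * b.2)

theorem bindAtoms_sum (l : List (A × ℚ)) (f : A → FinDist B) :
    ((bindAtoms l f).map Prod.snd).sum = (l.map Prod.snd).sum := by
  induction l with
  | nil => rfl
  | cons a l ih =>
    have h : (((f a.1).atoms.map fun b => (b.1, a.2 * b.2)).map Prod.snd).sum = a.2 := by
      rw [List.map_map]
      have : (Prod.snd ∘ fun b : B × ℚ => (b.1, a.2 * b.2)) = fun b => a.2 * b.2 := rfl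
      rw [this, List.sum_map_mul_left]
      have h1 : ((f a.1).atoms.map fun b => b.2).sum = 1 := (f a.1).sum_one
      rw [h1, mul_one]
    simp only [bindAtoms, List.flatMap_cons, List.map_append, List.sum_append, List.map_cons,
      List.sum_cons] at ih ⊢
    rw [ih, h]

/-- Two-stage experiment: draw `a` from `d`, then draw (independently of everything else) from
`f a`. -/
def bind (d : FinDist A) (f : A → FinDist B) : FinDist B where
  atoms := bindAtoms d.atoms f
  nonneg := by
    intro b hb
    simp only [bindAtoms, List.mem_flatMap, List.mem_map] at hb
    obtain ⟨a, ha, c, hc, rfl⟩ := hb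
    exact mul_nonneg (d.nonneg a ha) ((f a.1).nonneg c hc)
  sum_one := by rw [bindAtoms_sum]; exact d.sum_one

/-- The law of `g X`, where `X` has law `d`. -/
def map (g : A → B) (d : FinDist A) : FinDist B :=
  d.bind fun a => pure (g a)

theorem expect_le (d : FinDist A) (f : A → ℚ) (M : ℚ) (h : ∀ a ∈ d.atoms, f a.1 ≤ M) :
    d.expect f ≤ M := by
  have key : d.expect f ≤ (d.atoms.map fun a => a.2 * M).sum :=
    List.sum_le_sum fun a ha => mul_le_mul_of_nonneg_left (h a ha) (d.nonneg a ha)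
  have h2 : (d.atoms.map fun a => a.2 * M).sum = M := by
    rw [List.sum_map_mul_right]
    have h1 : (d.atoms.map fun b => b.2).sum = 1 := d.sum_one
    rw [h1, one_mul]
  exact key.trans h2.le

end FinDist

/-! ### The multi-choice stochastic knapsack problem with costs -/

/-- An instance: `n` items with `m` choices each; item `i` has value `v i`; choice `j` of item `i`
has the cost `p i j ≥ 0` and the distribution `F i j` of its nonnegative size.  The budget is `1`.
All numbers are rational, since an instance is the input of an algorithm. -/
structure MSKC where
  n : ℕ
  m : ℕ
  v : Fin n → ℚ
  p : Fin n → Fin m → ℚ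
  F : Fin n → Fin m → FinDist ℚ
  p_nonneg : ∀ i j, 0 ≤ p i j
  size_nonneg : ∀ i j, ∀ a ∈ (F i j).atoms, 0 ≤ a.1

namespace MSKC

/-- The expected profit `v i * Pr[s ≤ 1] - p i j` of running choice `j` of item `i` alone. -/
def netProfit (I : MSKC) (i : Fin I.n) (j : Fin I.m) : ℚ :=
  I.v i * (I.F i j).prob (fun s => s ≤ 1) - I.p i j

/-- The inverse `p / (v * Pr[s ≤ 1] - p)` of the return on investment of the pair `(i, j)`. -/
def inverseROI (I : MSKC) (i : Fin I.n) (j : Fin I.m) : ℚ :=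
  I.p i j / I.netProfit i j

/-- The parameter `α`: the largest inverse return on investment.  The maximum is over the pairs with
positive net profit (the pairs for which the return on investment is positive, so that its inverse
is a finite nonnegative number); it is `0` if there is no such pair. -/
noncomputable def alpha (I : MSKC) : ℝ :=
  ⨆ x : {x : Fin I.n × Fin I.m // 0 < I.netProfit x.1 x.2}, (I.inverseROI x.1.1 x.1.2 : ℝ)

/-- The law of the profit when choice `j` of item `i` is selected at remaining budget `b`: the cost
is paid, the size `s` is drawn from `F i j`; if `s ≤ b` then the value is gained and the process
goes on with remaining budget `b - s` and a further profit of law `next (b - s)`; otherwise the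
process ends. -/
def selectLaw (I : MSKC) (i : Fin I.n) (j : Fin I.m) (b : ℚ) (next : ℚ → FinDist ℚ) : FinDist ℚ :=
  (I.F i j).bind fun s =>
    if s ≤ b then (next (b - s)).map fun x => I.v i - I.p i j + x
    else FinDist.pure (-I.p i j)

/-- A (fully) adaptive policy: from the set of items that have not been selected yet and the
remaining budget, it decides which of these items to select next and with which choice, or to stop
(`none`). -/
structure AdaptivePolicy (I : MSKC) where
  choose : Finset (Fin I.n) → ℚ → Option (Fin I.n × Fin I.m)
  valid : ∀ J b i j, choose J b = some (i, j) → i ∈ J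

instance (I : MSKC) : Inhabited (AdaptivePolicy I) :=
  ⟨⟨fun _ _ => none, by intro J b i j h; cases h⟩⟩

/-- The law of the profit of an adaptive policy from a state on, with at most `k` selections. -/
def AdaptivePolicy.profitLawFrom {I : MSKC} (φ : AdaptivePolicy I) :
    ℕ → Finset (Fin I.n) → ℚ → FinDist ℚ
  | 0, _, _ => FinDist.pure 0
  | k + 1, J, b =>
    match φ.choose J b with
    | none => FinDist.pure 0
    | some (i, j) => I.selectLaw i j b fun b' => φ.profitLawFrom k (J.erase i) b'

/-- The law of the profit of an adaptive policy (each selection uses up an item, so there are never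
more than `n` selections). -/
def AdaptivePolicy.profitLaw {I : MSKC} (φ : AdaptivePolicy I) : FinDist ℚ :=
  φ.profitLawFrom I.n Finset.univ 1

/-- The expected profit of an adaptive policy. -/
def AdaptivePolicy.expectedProfit {I : MSKC} (φ : AdaptivePolicy I) : ℚ :=
  φ.profitLaw.expect fun x => x

/-- The optimal expected profit of an adaptive policy. -/
noncomputable def ADAPT (I : MSKC) : ℝ :=
  ⨆ φ : AdaptivePolicy I, (φ.expectedProfit : ℝ)

/-- A non-adaptive policy `π : [n] → [n] × [m] ∪ {⊥}`: the `k`-th selection is `sel k`, no item is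
selected twice, and `none` means to stop. -/
structure NonAdaptivePolicy (I : MSKC) where
  sel : Fin I.n → Option (Fin I.n × Fin I.m)
  distinct : ∀ k l i j j', sel k = some (i, j) → sel l = some (i, j') → k = l

/-- The law of the profit when the listed selections are made in order, at remaining budget `b`. -/
def sequenceLaw (I : MSKC) : List (Option (Fin I.n × Fin I.m)) → ℚ → FinDist ℚ
  | [], _ => FinDist.pure 0
  | none :: _, _ => FinDist.pure 0
  | some (i, j) :: l, b => I.selectLaw i j b fun b' => sequenceLaw I l b'

/-- The law of the profit of a non-adaptive policy. -/
def NonAdaptivePolicy.profitLaw {I : MSKC} (π : NonAdaptivePolicy I) : FinDist ℚ :=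
  I.sequenceLaw (List.ofFn π.sel) 1

/-- The expected profit of a non-adaptive policy. -/
def NonAdaptivePolicy.expectedProfit {I : MSKC} (π : NonAdaptivePolicy I) : ℚ :=
  π.profitLaw.expect fun x => x

/-! The supremum in `ADAPT` is over a set that is bounded above. -/

theorem selectLaw_le (I : MSKC) (i : Fin I.n) (j : Fin I.m) (b : ℚ) (next : ℚ → FinDist ℚ) (K : ℚ)
    (hK : 0 ≤ K) (h : ∀ b', ∀ a ∈ (next b').atoms, a.1 ≤ K) :
    ∀ a ∈ (I.selectLaw i j b next).atoms, a.1 ≤ (∑ i, |I.v i|) + K := by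
  intro a ha
  have hv : I.v i ≤ ∑ i, |I.v i| :=
    (le_abs_self _).trans
      (Finset.single_le_sum (f := fun i => |I.v i|) (fun _ _ => abs_nonneg _) (Finset.mem_univ i))
  have h0 : 0 ≤ ∑ i, |I.v i| := Finset.sum_nonneg fun _ _ => abs_nonneg _
  have hp := I.p_nonneg i j
  simp only [selectLaw, FinDist.bind, FinDist.bindAtoms, List.mem_flatMap, List.mem_map] at ha
  obtain ⟨s, _, c, hc, rfl⟩ := ha
  split_ifs at hc with hs
  · simp only [FinDist.map, FinDist.bind, FinDist.bindAtoms, FinDist.pure, List.mem_flatMap,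
      List.mem_map, List.mem_singleton] at hc
    obtain ⟨y, hy, z, rfl, rfl⟩ := hc
    have := h _ y hy
    simp only
    linarith
  · simp only [FinDist.pure, List.mem_singleton] at hc
    subst hc
    simp only
    linarith

theorem AdaptivePolicy.profitLawFrom_le {I : MSKC} (φ : AdaptivePolicy I) (k : ℕ) :
    ∀ J b, ∀ a ∈ (φ.profitLawFrom k J b).atoms, a.1 ≤ k * ∑ i, |I.v i| := by
  have h0 : 0 ≤ ∑ i, |I.v i| := Finset.sum_nonneg fun _ _ => abs_nonneg _
  induction k with
  | zero =>
    intro J b a ha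
    simp only [profitLawFrom, FinDist.pure, List.mem_singleton] at ha
    subst ha
    simp
  | succ k ih =>
    intro J b a ha
    simp only [profitLawFrom] at ha
    split at ha
    · simp only [FinDist.pure, List.mem_singleton] at ha
      subst ha
      positivity
    · have := selectLaw_le I _ _ b _ (k * ∑ i, |I.v i|) (by positivity) (fun b' => ih _ b') a ha
      push_cast
      linarith

theorem bddAbove_expectedProfit (I : MSKC) :
    BddAbove (Set.range fun φ : AdaptivePolicy I => (φ.expectedProfit : ℝ)) := by
  refine ⟨((I.n * ∑ i, |I.v i| : ℚ) : ℝ), ?_⟩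
  rintro _ ⟨φ, rfl⟩
  have h : φ.expectedProfit ≤ I.n * ∑ i, |I.v i| :=
    FinDist.expect_le φ.profitLaw (fun x => x) _ (φ.profitLawFrom_le I.n Finset.univ 1)
  exact Rat.cast_le.mpr h

end MSKC

/-! ### Random access machines with the logarithmic cost criterion

Structured programs over integer registers with indirect addressing.  The registers are organised in
arrays (finitely many of them occur in a program), each indexed by the integers.  Every operation is
charged the bit lengths of the numbers that it handles. -/

namespace RAM

/-- The content of the memory: `σ a k` is entry `k` of array `a`. -/
abbrev Store := ℕ → ℤ → ℤ

/-- The bit length of an integer. -/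
def bitLen (z : ℤ) : ℕ := z.natAbs.size + 1

/-- Arithmetic expressions: constants, array entries, addition, subtraction, multiplication, and
integer division. -/
inductive Expr where
  | const (c : ℤ)
  | read (a : ℕ) (k : Expr)
  | add (e f : Expr)
  | sub (e f : Expr)
  | mul (e f : Expr)
  | div (e f : Expr)

/-- The value of an expression. -/
def Expr.eval (σ : Store) : Expr → ℤ
  | const c => c
  | read a k => σ a (k.eval σ)
  | add e f => e.eval σ + f.eval σ
  | sub e f => e.eval σ - f.eval σ
  | mul e f => e.eval σ * f.eval σ
  | div e f => e.eval σ / f.eval σ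

/-- The cost of evaluating an expression: the bit lengths of all operands, addresses and results. -/
def Expr.cost (σ : Store) : Expr → ℕ
  | const c => bitLen c
  | read a k => k.cost σ + bitLen (σ a (k.eval σ))
  | add e f => e.cost σ + f.cost σ + bitLen (e.eval σ + f.eval σ)
  | sub e f => e.cost σ + f.cost σ + bitLen (e.eval σ - f.eval σ)
  | mul e f => e.cost σ + f.cost σ + bitLen (e.eval σ * f.eval σ)
  | div e f => e.cost σ + f.cost σ + bitLen (e.eval σ / f.eval σ)

/-- Programs.  `write a k e` stores the value of `e` in entry `k` of array `a`; the tests of `ite`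
and `loop` ask whether the value of the expression is positive. -/
inductive Program where
  | skip
  | write (a : ℕ) (k e : Expr)
  | seq (c d : Program)
  | ite (e : Expr) (c d : Program)
  | loop (e : Expr) (c : Program)

/-- The store after writing `z` to entry `k` of array `a`. -/
def Store.set (σ : Store) (a : ℕ) (k z : ℤ) : Store :=
  fun a' k' => if a' = a ∧ k' = k then z else σ a' k'

/-- `Exec c σ σ' t`: started in the store `σ`, the program `c` halts in the store `σ'` after `t`
steps (at logarithmic cost). -/
inductive Exec : Program → Store → Store → ℕ → Prop where
  | skip (σ : Store) : Exec .skip σ σ 1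
  | write (σ : Store) (a : ℕ) (k e : Expr) :
      Exec (.write a k e) σ (σ.set a (k.eval σ) (e.eval σ)) (k.cost σ + e.cost σ + 1)
  | seq {c d : Program} {σ σ' σ'' : Store} {s t : ℕ} :
      Exec c σ σ' s → Exec d σ' σ'' t → Exec (.seq c d) σ σ'' (s + t)
  | ite_pos {e : Expr} {c d : Program} {σ σ' : Store} {t : ℕ} :
      0 < e.eval σ → Exec c σ σ' t → Exec (.ite e c d) σ σ' (e.cost σ + t + 1)
  | ite_neg {e : Expr} {c d : Program} {σ σ' : Store} {t : ℕ} :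
      ¬ 0 < e.eval σ → Exec d σ σ' t → Exec (.ite e c d) σ σ' (e.cost σ + t + 1)
  | loop_stop {e : Expr} {c : Program} {σ : Store} :
      ¬ 0 < e.eval σ → Exec (.loop e c) σ σ (e.cost σ + 1)
  | loop_step {e : Expr} {c : Program} {σ σ' σ'' : Store} {s t : ℕ} :
      0 < e.eval σ → Exec c σ σ' s → Exec (.loop e c) σ' σ'' t →
        Exec (.loop e c) σ σ'' (e.cost σ + s + t + 1)

/-- The initial store: the input words are the entries `0, 1, 2, …` of array `0`; all other entries
of all arrays are `0`. -/
def initStore (x : List ℤ) : Store :=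
  fun a k => if a = 0 ∧ 0 ≤ k then x.getD k.toNat 0 else 0

/-- On the input words `x` the program `c` halts after at most `T` steps, with the output words `y`
in the entries `0, 1, 2, …` of array `1`. -/
def HaltsWith (c : Program) (x y : List ℤ) (T : ℕ) : Prop :=
  ∃ σ t, Exec c (initStore x) σ t ∧ t ≤ T ∧
    ∀ (k : ℕ) (hk : k < y.length), σ 1 k = y[k]

/-- The total bit length of a list of words. -/
def totalBits (x : List ℤ) : ℕ := (x.map bitLen).sum

end RAM

/-! ### Encoding of instances and policies by words -/

namespace MSKC

/-- A rational number is given by its numerator and its denominator. -/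
def encodeRat (q : ℚ) : List ℤ := [q.num, q.den]

/-- A distribution is given by the number of its atoms and the list of the atoms. -/
def encodeDist (d : FinDist ℚ) : List ℤ :=
  (d.atoms.length : ℤ) :: d.atoms.flatMap fun a => encodeRat a.1 ++ encodeRat a.2

/-- An instance is given by `n`, `m` and, for each item, its value and, for each choice, the cost
and the distribution. -/
def encode (I : MSKC) : List ℤ :=
  [(I.n : ℤ), (I.m : ℤ)] ++ (List.finRange I.n).flatMap fun i =>
    encodeRat (I.v i) ++ (List.finRange I.m).flatMap fun j =>
      encodeRat (I.p i j) ++ encodeDist (I.F i j)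

/-- The input length of an instance: the number of bits of its encoding. -/
def inputLength (I : MSKC) : ℕ := RAM.totalBits I.encode

/-- A selection is given by the numbers of the item and the choice, counted from `1`; the
symbol `⊥` is given by `0, 0`. -/
def encodeSelection {n m : ℕ} : Option (Fin n × Fin m) → List ℤ
  | none => [0, 0]
  | some (i, j) => [(i : ℤ) + 1, (j : ℤ) + 1]

/-- A non-adaptive policy is given by the list of its `n` selections. -/
def NonAdaptivePolicy.encode {I : MSKC} (π : NonAdaptivePolicy I) : List ℤ :=
  (List.ofFn π.sel).flatMap encodeSelection

end MSKC

/-! For a pair let w be its net profit and u the mean of min(s, 1). Put A = 1 + α, so that w + p ≤ A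
w whenever w > 0. Both sides of the inequality are compared with a knapsack problem in which each
item gets at most one choice and the sizes are the means u.

Upper bound. From remaining budget b, the selected sizes, truncated at 1, add up to at most b + 1,
because only the last item can overflow. Charging a price λ ≥ 0 per unit of truncated size gives, by
weak duality, ADAPT ≤ 2λ + Σ h_i whenever h_i ≥ 0 and h_i ≥ w_ij − λ u_ij (`ADAPT_le`).

Lower bound. In a fixed sequence, Markov's inequality bounds the probability that a pair fails by
the mean sizes of the pairs before it plus its own, and a pair of net profit w loses at most A w
times this sum (`le_expect_sequenceLaw`). Let W, M and D be the sums of w, of u and of w u over the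
selected pairs. The cross terms of an order and of its reverse add up to W M − D
(`List.crossSum_add_crossSum_reverse`), so the better order has at most half of that. If A M ≤ 1, it
earns at least (W − best) / 2, where best is the largest net profit, or 0 if none is positive
(`IsGreedyEnd.le_expectedProfit`).

The link is a greedy algorithm for capacity 1 / A. Starting from the empty selection, it repeatedly
makes the improvement with the largest ratio of gained profit to added size. The selection stays
optimal at the multiplier given by that ratio (`IsBestUpgrade.isHull`, `IsHull.update`). The first
improvement that does not fit supplies λ, and ADAPT ≤ 2A (W + best) follows
(`IsGreedyEnd.ADAPT_le`). The better of the sequence and the best single pair is guaranteed max((W −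
best) / 2, best) ≥ (W + best) / 4, which yields the factor 8A (`IsGreedyEnd.approximation`).

Running time. Every improvement decreases `potential`, so n m rounds suffice. The program works with
integers over one common denominator, the product of the denominators of all pairs; its bit length
is polynomial (`params`). The relation `Tr` combines correctness, running time and size of numbers,
and `algorithm_spec` assembles the stages of the program. -/

namespace FinDist

/-! ### Rules for expectations and probabilities. -/

variable {A B : Type}

theorem expect_congr (d : FinDist A) {f g : A → ℚ} (h : ∀ a ∈ d.atoms, f a.1 = g a.1) :
    d.expect f = d.expect g := by
  unfold expect
  exact congrArg List.sum (List.map_congr_left fun a ha => by rw [h a ha])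

theorem expect_mono (d : FinDist A) {f g : A → ℚ} (h : ∀ a ∈ d.atoms, f a.1 ≤ g a.1) :
    d.expect f ≤ d.expect g :=
  List.sum_le_sum fun a ha => mul_le_mul_of_nonneg_left (h a ha) (d.nonneg a ha)

theorem expect_const (d : FinDist A) (M : ℚ) : (d.expect fun _ => M) = M := by
  unfold expect
  rw [List.sum_map_mul_right]
  have h1 : (d.atoms.map fun b => b.2).sum = 1 := d.sum_one
  rw [h1, one_mul]

theorem expect_add (d : FinDist A) (f g : A → ℚ) :
    (d.expect fun a => f a + g a) = d.expect f + d.expect g := by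
  simp only [expect, mul_add, List.sum_map_add]

theorem expect_const_mul (d : FinDist A) (c : ℚ) (f : A → ℚ) :
    (d.expect fun a => c * f a) = c * d.expect f := by
  simp only [expect, mul_left_comm _ c, List.sum_map_mul_left]

theorem expect_pure (a : A) (f : A → ℚ) : (pure a).expect f = f a := by
  simp [expect, pure]

theorem expect_bindAtoms (l : List (A × ℚ)) (f : A → FinDist B) (g : B → ℚ) :
    ((bindAtoms l f).map fun b => b.2 * g b.1).sum =
      (l.map fun a => a.2 * (f a.1).expect g).sum := by
  induction l with
  | nil => rfl
  | cons a l ih =>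
    simp only [bindAtoms, List.flatMap_cons, List.map_append, List.sum_append, List.map_cons,
      List.sum_cons] at ih ⊢
    rw [ih, List.map_map, expect, ← List.sum_map_mul_left]
    simp only [Function.comp_def, mul_assoc]

theorem expect_bind (d : FinDist A) (f : A → FinDist B) (g : B → ℚ) :
    (d.bind f).expect g = d.expect fun a => (f a).expect g :=
  expect_bindAtoms d.atoms f g

theorem expect_map (d : FinDist A) (f : A → B) (g : B → ℚ) :
    (d.map f).expect g = d.expect fun a => g (f a) := by
  simp only [map, expect_bind, expect_pure]

theorem prob_nonneg (d : FinDist A) (E : A → Prop) [DecidablePred E] : 0 ≤ d.prob E := by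
  have := d.expect_mono (f := fun _ => 0) (g := fun a => if E a then 1 else 0)
    fun a _ => by split_ifs <;> norm_num
  rwa [expect_const] at this

theorem prob_le_one (d : FinDist A) (E : A → Prop) [DecidablePred E] : d.prob E ≤ 1 :=
  d.expect_le _ _ fun a _ => by split_ifs <;> norm_num

theorem prob_mono (d : FinDist A) (E E' : A → Prop) [DecidablePred E] [DecidablePred E']
    (h : ∀ a, E a → E' a) : d.prob E ≤ d.prob E' :=
  d.expect_mono fun a _ => by
    by_cases h1 : E a.1
    · simp [h1, h _ h1]
    · simp only [h1, if_false]; split_ifs <;> norm_num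

end FinDist

/-! ### Truncated means and the dual bound on adaptive policies. -/

namespace MSKC

variable (I : MSKC)

/-- The mean of the size truncated at the budget. -/
def truncMean (i : Fin I.n) (j : Fin I.m) : ℚ := (I.F i j).expect fun s => min s 1

theorem truncMean_nonneg (i : Fin I.n) (j : Fin I.m) : 0 ≤ I.truncMean i j := by
  have := (I.F i j).expect_mono (f := fun _ => 0) (g := fun s => min s 1)
    fun a ha => le_min (I.size_nonneg i j a ha) zero_le_one
  rwa [FinDist.expect_const] at this

theorem expect_selectLaw (i : Fin I.n) (j : Fin I.m) (b : ℚ) (next : ℚ → FinDist ℚ) :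
    ((I.selectLaw i j b next).expect fun x => x) =
      I.v i * (I.F i j).prob (fun s => s ≤ b) - I.p i j +
        (I.F i j).expect fun s => if s ≤ b then (next (b - s)).expect fun x => x else 0 := by
  have h1 : ((I.selectLaw i j b next).expect fun x => x) =
      (I.F i j).expect fun s => (I.v i * (if s ≤ b then 1 else 0) + -I.p i j) +
        if s ≤ b then (next (b - s)).expect fun x => x else 0 := by
    rw [selectLaw, FinDist.expect_bind]
    refine FinDist.expect_congr _ fun a _ => ?_
    split_ifs with h
    · rw [FinDist.expect_map, FinDist.expect_add, FinDist.expect_const]; ring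
    · rw [FinDist.expect_pure]; ring
  rw [h1, FinDist.expect_add, FinDist.expect_add, FinDist.expect_const_mul, FinDist.expect_const,
    ← sub_eq_add_neg]
  rfl

/-- Markov's inequality: `b - min s 1` is at most the indicator of `s ≤ b`, because `0 ≤ s` and `b ≤
1`. The bound is written with `1 - b`, the budget already used, since this quantity accumulates
along a sequence. -/
theorem prob_gt_le (i : Fin I.n) (j : Fin I.m) {b : ℚ} (hb1 : b ≤ 1) :
    1 - (1 - b + I.truncMean i j) ≤ (I.F i j).prob fun s => s ≤ b := by
  have h1 : ((I.F i j).expect fun s => b + (-1) * min s 1) ≤ (I.F i j).prob fun s => s ≤ b := by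
    refine FinDist.expect_mono _ fun a ha => ?_
    have h0 := I.size_nonneg i j a ha
    split_ifs with h
    · rw [min_eq_left (h.trans hb1)]; linarith
    · have : b ≤ min a.1 1 := le_min (not_le.mp h).le hb1
      linarith
  rw [FinDist.expect_add, FinDist.expect_const, FinDist.expect_const_mul] at h1
  unfold truncMean
  linarith

/-- Weak duality: an upper bound on the profit of every adaptive policy. -/
theorem AdaptivePolicy.expect_profitLawFrom_le {I : MSKC} (φ : AdaptivePolicy I) {lam : ℚ}
    (hlam : 0 ≤ lam) {h : Fin I.n → ℚ} (h0 : ∀ i, 0 ≤ h i)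
    (hh : ∀ i j, I.netProfit i j - lam * I.truncMean i j ≤ h i) (k : ℕ) :
    ∀ (J : Finset (Fin I.n)) (b : ℚ), 0 ≤ b → b ≤ 1 →
      ((φ.profitLawFrom k J b).expect fun x => x) ≤ lam * (b + 1) + ∑ i ∈ J, h i := by
  have hz : ∀ (J : Finset (Fin I.n)) (b : ℚ), 0 ≤ b →
      0 ≤ lam * (b + 1) + ∑ i ∈ J, h i := fun J b hb =>
    add_nonneg (mul_nonneg hlam (by linarith)) (Finset.sum_nonneg fun i _ => h0 i)
  induction k with
  | zero =>
    intro J b hb _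
    rw [profitLawFrom, FinDist.expect_pure]
    exact hz J b hb
  | succ k ih =>
    intro J b hb hb1
    rw [profitLawFrom]
    split
    · rw [FinDist.expect_pure]
      exact hz J b hb
    · rename_i i j hc
      have hi := φ.valid J b i j hc
      rw [expect_selectLaw, ← Finset.add_sum_erase _ _ hi]
      -- The potential `lam * (b + 1)` pays `lam * min s 1` for each draw. If the item fits, this is
      -- exactly its decrease. If it overflows, the process ends, and `min s 1 ≤ 1 ≤ b + 1` keeps
      -- the potential nonnegative; this is what the extra unit is for.
      have h1 : ((I.F i j).expect fun s => if s ≤ b then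
          (φ.profitLawFrom k (J.erase i) (b - s)).expect fun x => x else 0) ≤
          (I.F i j).expect fun s => (lam * (b + 1) + ∑ i ∈ J.erase i, h i) +
            (-lam) * min s 1 := by
        refine FinDist.expect_mono _ fun a ha => ?_
        have hs := I.size_nonneg i j a ha
        split_ifs with hab
        · have := ih (J.erase i) (b - a.1) (by linarith) (by linarith)
          rw [min_eq_left (hab.trans hb1)]
          linarith
        · have h2 : min a.1 1 ≤ b + 1 := (min_le_right _ _).trans (by linarith)
          have h3 := mul_le_mul_of_nonneg_left h2 hlam
          have h4 : 0 ≤ ∑ i ∈ J.erase i, h i := Finset.sum_nonneg fun i _ => h0 i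
          linarith
      rw [FinDist.expect_add, FinDist.expect_const, FinDist.expect_const_mul] at h1
      have hu := I.truncMean_nonneg i j
      -- Raising the threshold from `b` to `1` helps only if the value is nonnegative. A negative
      -- value makes the left side nonpositive, and `0 ≤ h i` suffices.
      have h5 : I.v i * (I.F i j).prob (fun s => s ≤ b) - I.p i j - lam * I.truncMean i j ≤
          h i := by
        rcases le_total 0 (I.v i) with hv | hv
        · refine le_trans ?_ (hh i j)
          have := mul_le_mul_of_nonneg_left
            ((I.F i j).prob_mono (fun s => s ≤ b) (fun s => s ≤ 1) fun _ h => h.trans hb1) hv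
          unfold netProfit
          linarith
        · have h6 := mul_nonpos_of_nonpos_of_nonneg hv ((I.F i j).prob_nonneg fun s => s ≤ b)
          have := mul_nonneg hlam hu
          have := h0 i
          have := I.p_nonneg i j
          linarith
      have h7 : ((I.F i j).expect fun s => min s 1) = I.truncMean i j := rfl
      rw [h7] at h1
      linarith

/-- Here `lam` is the price of size and `h i` the dual variable of item `i`. The factor 2 is the
budget `1` plus the unit reserved for the overflowing item. -/
theorem ADAPT_le {lam : ℚ} (hlam : 0 ≤ lam) {h : Fin I.n → ℚ} (h0 : ∀ i, 0 ≤ h i)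
    (hh : ∀ i j, I.netProfit i j - lam * I.truncMean i j ≤ h i) :
    I.ADAPT ≤ ((2 * lam + ∑ i, h i : ℚ) : ℝ) := by
  refine ciSup_le fun φ => Rat.cast_le.mpr ?_
  have := φ.expect_profitLawFrom_le hlam h0 hh I.n Finset.univ 1 zero_le_one le_rfl
  rw [AdaptivePolicy.expectedProfit, AdaptivePolicy.profitLaw]
  linarith

end MSKC

/-! ### Cross sums of a list and of its reverse. -/

/-- The sum of `u x * w y` over the pairs of entries such that `x` stands before `y`. -/
def List.crossSum {ι : Type} (u w : ι → ℚ) : List ι → ℚ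
  | [] => 0
  | x :: l => u x * (l.map w).sum + crossSum u w l

namespace List

variable {ι : Type} (u w : ι → ℚ)

theorem crossSum_append (l l' : List ι) :
    (l ++ l').crossSum u w =
      l.crossSum u w + l'.crossSum u w + (l.map u).sum * (l'.map w).sum := by
  induction l with
  | nil => simp [crossSum]
  | cons x l ih =>
    simp only [cons_append, crossSum, ih, map_append, sum_append, map_cons, sum_cons]
    ring

/-- Each ordered pair of distinct positions is counted in exactly one of the two orders, and the
diagonal completes the product. Hence one of the two orders has at most half of the off-diagonal
part. -/
theorem crossSum_add_crossSum_reverse (l : List ι) :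
    l.crossSum u w + l.reverse.crossSum u w + (l.map fun x => w x * u x).sum =
      (l.map w).sum * (l.map u).sum := by
  induction l with
  | nil => simp [crossSum]
  | cons x l ih =>
    simp only [reverse_cons, crossSum_append, crossSum, map_cons, sum_cons, map_reverse,
      sum_reverse, map_nil, sum_nil]
    linarith

theorem crossSum_nonneg (l : List ι) (hu : ∀ x ∈ l, 0 ≤ u x) (hw : ∀ x ∈ l, 0 ≤ w x) :
    0 ≤ l.crossSum u w := by
  induction l with
  | nil => simp [crossSum]
  | cons x l ih =>
    simp only [mem_cons, forall_eq_or_imp] at hu hw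
    refine add_nonneg (mul_nonneg hu.1 (sum_nonneg ?_)) (ih hu.2 hw.2)
    simpa using hw.2

end List

/-! ### The expected profit of a fixed sequence. -/

namespace MSKC

variable (I : MSKC)

/-- The net profit as a function of the pair. -/
abbrev pairProfit (x : Fin I.n × Fin I.m) : ℚ := I.netProfit x.1 x.2

/-- The truncated mean size as a function of the pair. -/
abbrev pairSize (x : Fin I.n × Fin I.m) : ℚ := I.truncMean x.1 x.2

/-- Since `w + p = v * Pr[s ≤ 1] ≤ v`, Markov's inequality bounds the loss of a pair by `w + p`,
hence by `A * w`, times the sum of the budget used so far and its own mean size. The induction lets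
`1 - b` grow by the drawn size: in expectation this adds each size times all later profits, which is
the cross sum, while the last sum collects the pairs' own sizes. -/
theorem le_expect_sequenceLaw {A : ℚ} (hA : 1 ≤ A) (l : List (Fin I.n × Fin I.m)) (r : ℕ)
    (hw : ∀ x ∈ l, 0 < I.pairProfit x)
    (hp : ∀ x ∈ l, I.pairProfit x + I.p x.1 x.2 ≤ A * I.pairProfit x) :
    ∀ b : ℚ, 0 ≤ b → b ≤ 1 →
      (l.map I.pairProfit).sum - A * ((1 - b) * (l.map I.pairProfit).sum +
        l.crossSum I.pairSize I.pairProfit + (l.map fun x => I.pairProfit x * I.pairSize x).sum) ≤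
      (I.sequenceLaw (l.map some ++ List.replicate r none) b).expect fun x => x := by
  induction l with
  | nil =>
    intro b _ _
    cases r <;> simp [List.crossSum, sequenceLaw, FinDist.expect_pure, List.replicate_succ]
  | cons x l ih =>
    obtain ⟨i, j⟩ := x
    simp only [List.mem_cons, forall_eq_or_imp] at hw hp
    intro b hb hb1
    simp only [List.map_cons, List.cons_append, sequenceLaw, expect_selectLaw, List.sum_cons,
      List.crossSum]
    set S := (l.map I.pairProfit).sum with hS
    set X := l.crossSum I.pairSize I.pairProfit with hX
    set G := (l.map fun x => I.pairProfit x * I.pairSize x).sum with hG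
    have hu0 : ∀ x, 0 ≤ I.pairSize x := fun x => I.truncMean_nonneg x.1 x.2
    have hS0 : 0 ≤ S := List.sum_nonneg (by
      simp only [List.mem_map, forall_exists_index, and_imp, forall_apply_eq_imp_iff₂]
      exact fun x h => (hw.2 x h).le)
    have hX0 : 0 ≤ X := List.crossSum_nonneg _ _ _ (fun x _ => hu0 x) fun x h => (hw.2 x h).le
    have hG0 : 0 ≤ G := List.sum_nonneg (by
      simp only [List.mem_map, forall_exists_index, and_imp, forall_apply_eq_imp_iff₂]
      exact fun x h => mul_nonneg (hw.2 x h).le (hu0 x))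
    have h1 : ((I.F i j).expect fun s => (S - A * ((1 - b) * S + X + G)) + (-(A * S)) * min s 1) ≤
        (I.F i j).expect fun s => if s ≤ b then
          (I.sequenceLaw (l.map some ++ List.replicate r none) (b - s)).expect fun x => x
          else 0 := by
      refine FinDist.expect_mono _ fun a ha => ?_
      have hs := I.size_nonneg i j a ha
      split_ifs with hab
      · have := ih hw.2 hp.2 (b - a.1) (by linarith) (by linarith)
        rw [min_eq_left (hab.trans hb1)]
        linarith
      -- After an overflow the rest earns 0, so the claimed bound has to be nonpositive: the used
      -- budget `1 - b` plus `min s 1` is at least `1`, and `A ≥ 1` makes the charge exceed `S`.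
      · have h2 : b ≤ min a.1 1 := le_min (not_le.mp hab).le hb1
        have h3 : 0 ≤ A * S * (min a.1 1 - b) :=
          mul_nonneg (mul_nonneg (by linarith) hS0) (by linarith)
        have h4 : 0 ≤ A * (X + G) := mul_nonneg (by linarith) (by linarith)
        have h5 : 0 ≤ (A - 1) * S := mul_nonneg (by linarith) hS0
        linarith
    rw [FinDist.expect_add, FinDist.expect_const, FinDist.expect_const_mul] at h1
    have h7 : ((I.F i j).expect fun s => min s 1) = I.pairSize (i, j) := rfl
    rw [h7] at h1
    have hw1 : 0 < I.pairProfit (i, j) := hw.1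
    have hp1 := hp.1
    have hp0 : 0 ≤ I.p i j := I.p_nonneg i j
    have hv : I.pairProfit (i, j) + I.p i j ≤ I.v i := by
      have e : I.pairProfit (i, j) + I.p i j = I.v i * (I.F i j).prob (fun s => s ≤ 1) := by
        simp [pairProfit, netProfit]
      have h0 := (I.F i j).prob_nonneg fun s => s ≤ 1
      have h1 := (I.F i j).prob_le_one fun s => s ≤ 1
      rcases le_total (I.v i) 0 with hv | hv
      · linarith [mul_nonpos_of_nonpos_of_nonneg hv h0]
      · linarith [mul_le_mul_of_nonneg_left h1 hv]
    have h8 := I.prob_gt_le i j hb1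
    have h9 : (I.pairProfit (i, j) + I.p i j) * (1 - (1 - b + I.pairSize (i, j))) ≤
        I.v i * (I.F i j).prob fun s => s ≤ b :=
      (mul_le_mul_of_nonneg_left h8 (by linarith)).trans
        (mul_le_mul_of_nonneg_right hv (FinDist.prob_nonneg _ _))
    have h10 := mul_le_mul_of_nonneg_right hp1
      (add_nonneg (sub_nonneg.mpr hb1) (hu0 (i, j)))
    linarith

/-- The policy that makes the listed selections, in this order. -/
def NonAdaptivePolicy.ofList (l : List (Fin I.n × Fin I.m)) (hl : (l.map Prod.fst).Nodup) :
    NonAdaptivePolicy I where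
  sel k := l[(k : ℕ)]?
  distinct := by
    intro k k' i j j' h h'
    obtain ⟨hk, h⟩ := List.getElem?_eq_some_iff.mp h
    obtain ⟨hk', h'⟩ := List.getElem?_eq_some_iff.mp h'
    refine Fin.ext ((List.Nodup.getElem_inj_iff hl (hi := by simpa) (hj := by simpa)).mp ?_)
    simp [h, h']

theorem NonAdaptivePolicy.ofFn_ofList (l : List (Fin I.n × Fin I.m))
    (hl : (l.map Prod.fst).Nodup) :
    List.ofFn (ofList I l hl).sel = l.map some ++ List.replicate (I.n - l.length) none := by
  have hlen : l.length ≤ I.n := by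
    have := hl.length_le_card
    simpa using this
  refine List.ext_getElem (by simp; omega) fun k h1 h2 => ?_
  rw [List.getElem_ofFn]
  by_cases hk : k < l.length
  · rw [List.getElem_append_left (by simpa using hk)]
    simp [ofList, hk]
  · rw [List.getElem_append_right (by simpa using not_lt.mp hk)]
    simp [ofList, not_lt.mp hk]

theorem NonAdaptivePolicy.le_expectedProfit_ofList {A : ℚ} (hA : 1 ≤ A)
    (l : List (Fin I.n × Fin I.m)) (hl : (l.map Prod.fst).Nodup)
    (hw : ∀ x ∈ l, 0 < I.pairProfit x)
    (hp : ∀ x ∈ l, I.pairProfit x + I.p x.1 x.2 ≤ A * I.pairProfit x) :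
    (l.map I.pairProfit).sum - A * (l.crossSum I.pairSize I.pairProfit +
      (l.map fun x => I.pairProfit x * I.pairSize x).sum) ≤ (ofList I l hl).expectedProfit := by
  have := I.le_expect_sequenceLaw hA l (I.n - l.length) hw hp 1 zero_le_one le_rfl
  rw [← ofFn_ofList I l hl] at this
  rw [expectedProfit, profitLaw]
  linarith

theorem NonAdaptivePolicy.expectedProfit_ofList_singleton (x : Fin I.n × Fin I.m) :
    (ofList I [x] (by simp)).expectedProfit = I.pairProfit x := by
  obtain ⟨i, j⟩ := x
  rw [expectedProfit, profitLaw, ofFn_ofList]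
  simp only [List.map_cons, List.map_nil, List.cons_append, List.nil_append, sequenceLaw,
    expect_selectLaw]
  have : ∀ b, ((I.sequenceLaw (List.replicate (I.n - [(i, j)].length) none) b).expect
      fun x => x) = 0 := by
    intro b
    cases I.n - [(i, j)].length <;>
      simp [sequenceLaw, FinDist.expect_pure, List.replicate_succ]
  simp only [this, ite_self, FinDist.expect_const]
  simp [pairProfit, netProfit]

end MSKC

/-! ### The greedy selection and the approximation ratio. -/

namespace MSKC

variable (I : MSKC)

/-- The net profit of the choice selected for item `i`. -/
def selProfit (sel : Fin I.n → Option (Fin I.m)) (i : Fin I.n) : ℚ :=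
  (sel i).elim 0 (I.netProfit i)

/-- The truncated mean size of the choice selected for item `i`. -/
def selSize (sel : Fin I.n → Option (Fin I.m)) (i : Fin I.n) : ℚ :=
  (sel i).elim 0 (I.truncMean i)

/-- The selected pairs, in the order of the given list of items. -/
def selPairs (sel : Fin I.n → Option (Fin I.m)) (o : List (Fin I.n)) :
    List (Fin I.n × Fin I.m) :=
  o.filterMap fun i => (sel i).map fun j => (i, j)

/-- For the items, the selection is optimal at the Lagrange multiplier `a / b`. -/
def IsHull (sel : Fin I.n → Option (Fin I.m)) (a b : ℚ) : Prop :=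
  (∀ i j, b * (I.netProfit i j - I.selProfit sel i) ≤ a * (I.truncMean i j - I.selSize sel i)) ∧
    ∀ i, a * I.selSize sel i ≤ b * I.selProfit sel i

/-- The selection is a result of the greedy algorithm for the capacity `1 / A`: it fits, and either
nothing can be improved or the next improvement does not fit. -/
structure IsGreedyEnd (A : ℚ) (sel : Fin I.n → Option (Fin I.m)) : Prop where
  pos : ∀ i j, sel i = some j → 0 < I.netProfit i j
  fits : A * ∑ i, I.selSize sel i ≤ 1
  stuck : (∀ i j, I.netProfit i j ≤ I.selProfit sel i) ∨
    ∃ i j, I.selProfit sel i < I.netProfit i j ∧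
      I.IsHull sel (I.netProfit i j - I.selProfit sel i) (I.truncMean i j - I.selSize sel i) ∧
      1 < A * (∑ i, I.selSize sel i + (I.truncMean i j - I.selSize sel i))

variable {I} {A : ℚ} {sel : Fin I.n → Option (Fin I.m)}

theorem selSize_nonneg (i : Fin I.n) : 0 ≤ I.selSize sel i := by
  unfold selSize
  cases sel i
  · exact le_rfl
  · exact I.truncMean_nonneg _ _

theorem IsGreedyEnd.selProfit_nonneg (h : I.IsGreedyEnd A sel) (i : Fin I.n) :
    0 ≤ I.selProfit sel i := by
  unfold selProfit
  cases hs : sel i with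
  | none => exact le_rfl
  | some j => exact (h.pos i j hs).le

/-- The improvement that does not fit has gain `a` and load `b`, and its ratio `lam = a / b` is the
multiplier. The hull property makes `W - lam * M`, split over the items, dual feasible. The overflow
`1 < A * (M + b)` gives `lam ≤ A * (lam * M + a)`, where `lam * M ≤ W` and `a ≤ best`. If nothing
can be improved, the multiplier `0` works. -/
theorem IsGreedyEnd.ADAPT_le (h : I.IsGreedyEnd A sel) (hA : 1 ≤ A) {best : ℚ} (hb0 : 0 ≤ best)
    (hb : ∀ i j, I.netProfit i j ≤ best) :
    I.ADAPT ≤ ((2 * A * (∑ i, I.selProfit sel i + best) : ℚ) : ℝ) := by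
  have hW : 0 ≤ ∑ i, I.selProfit sel i := Finset.sum_nonneg fun i _ => h.selProfit_nonneg i
  have hM : 0 ≤ ∑ i, I.selSize sel i := Finset.sum_nonneg fun i _ => selSize_nonneg i
  rcases h.stuck with h1 | ⟨i, j, h1, h2, h3⟩
  · refine (I.ADAPT_le (lam := 0) le_rfl h.selProfit_nonneg (fun i j => by
      simpa using h1 i j)).trans (Rat.cast_le.mpr ?_)
    nlinarith
  · set a := I.netProfit i j - I.selProfit sel i with ha
    set b := I.truncMean i j - I.selSize sel i with hbd
    set W := ∑ i, I.selProfit sel i with hWd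
    set M := ∑ i, I.selSize sel i with hMd
    have ha0 : 0 < a := sub_pos.mpr h1
    -- An improvement with nonpositive load would fit, because the current selection does.
    have hbpos : 0 < b := by
      by_contra hneg
      have : A * b ≤ 0 := mul_nonpos_of_nonneg_of_nonpos (by linarith) (not_lt.mp hneg)
      linarith [h.fits]
    have hl : 0 < a / b := div_pos ha0 hbpos
    have hab : a / b * b = a := div_mul_cancel₀ a hbpos.ne'
    have hnull : ∀ i, a / b * I.selSize sel i ≤ I.selProfit sel i := fun i => by
      rw [div_mul_eq_mul_div, div_le_iff₀ hbpos, mul_comm _ b]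
      exact h2.2 i
    refine (I.ADAPT_le hl.le (h := fun i => I.selProfit sel i - a / b * I.selSize sel i)
      (fun i => sub_nonneg.mpr (hnull i)) (fun i' j' => ?_)).trans (Rat.cast_le.mpr ?_)
    · have := h2.1 i' j'
      have h4 : I.netProfit i' j' - I.selProfit sel i' ≤
          a / b * (I.truncMean i' j' - I.selSize sel i') := by
        rw [div_mul_eq_mul_div, le_div_iff₀ hbpos, mul_comm _ b]
        exact this
      linarith
    · rw [Finset.sum_sub_distrib, ← Finset.mul_sum, ← hWd, ← hMd]
      have h5 : a / b * M ≤ W := by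
        rw [hMd, hWd, Finset.mul_sum]
        exact Finset.sum_le_sum fun i _ => hnull i
      have h6 : a ≤ best := by linarith [hb i j, h.selProfit_nonneg i]
      have h7 : a / b * 1 ≤ a / b * (A * (M + b)) := mul_le_mul_of_nonneg_left h3.le hl.le
      have h8 : a / b * (A * (M + b)) = A * (a / b * M) + A * a := by
        have : a / b * (A * (M + b)) = A * (a / b * M) + A * (a / b * b) := by ring
        rw [this, hab]
      -- The dual value contains `2 * lam - lam * M`, and `2 * lam ≤ 2 * A * (lam * M + a)`; this
      -- leaves the coefficient `2 * A - 1` at `lam * M`.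
      have h9 : (2 * A - 1) * (a / b * M) ≤ (2 * A - 1) * W :=
        mul_le_mul_of_nonneg_left h5 (by linarith)
      have h10 : A * a ≤ A * best := mul_le_mul_of_nonneg_left h6 (by linarith)
      linarith

theorem mem_selPairs {o : List (Fin I.n)} {x : Fin I.n × Fin I.m} (hx : x ∈ I.selPairs sel o) :
    sel x.1 = some x.2 := by
  simp only [selPairs, List.mem_filterMap, Option.map_eq_some_iff] at hx
  obtain ⟨i, _, j, h, rfl⟩ := hx
  exact h

theorem nodup_selPairs {o : List (Fin I.n)} (ho : o.Nodup) :
    ((I.selPairs sel o).map Prod.fst).Nodup := by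
  have : (I.selPairs sel o).map Prod.fst = o.filter fun i => (sel i).isSome := by
    induction o with
    | nil => rfl
    | cons i o ih =>
      have ih := ih ho.of_cons
      simp only [selPairs] at ih ⊢
      cases h : sel i <;> simp [h, ih]
  rw [this]
  exact ho.filter _

theorem sum_selPairs (g : Fin I.n × Fin I.m → ℚ) (o : List (Fin I.n)) :
    ((I.selPairs sel o).map g).sum = (o.map fun i => (sel i).elim 0 fun j => g (i, j)).sum := by
  induction o with
  | nil => rfl
  | cons i o ih =>
    simp only [selPairs] at ih ⊢
    cases h : sel i <;> simp [h, ih]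

/-- Items without a choice have profit and size 0, so they may remain in the sums. This allows the
program to sum over all items. -/
theorem crossSum_selPairs (o : List (Fin I.n)) :
    (I.selPairs sel o).crossSum I.pairSize I.pairProfit =
      o.crossSum (I.selSize sel) (I.selProfit sel) := by
  induction o with
  | nil => rfl
  | cons i o ih =>
    have h2 := sum_selPairs (sel := sel) I.pairProfit o
    simp only [selPairs] at ih h2 ⊢
    cases h : sel i with
    | none => simp [h, ih, List.crossSum, selSize]
    | some j =>
      simp only [List.filterMap_cons, h, Option.map_some, List.crossSum, ih, h2]
      simp only [selSize, h, Option.elim_some]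
      rfl

/-- The hypothesis `hc` is what the better of the two orders satisfies. The loss is then at most `A
* (W * M + G) / 2`, with `G` the diagonal sum. Now `A * M ≤ 1` bounds the first term by `W / 2`, and
`G ≤ best * M` bounds the second by `best / 2`. -/
theorem IsGreedyEnd.le_expectedProfit (h : I.IsGreedyEnd A sel) (hA : 1 ≤ A) {best : ℚ}
    (hb : ∀ i j, I.netProfit i j ≤ best) (hb0 : 0 ≤ best)
    (hp : ∀ i j, 0 < I.netProfit i j → I.netProfit i j + I.p i j ≤ A * I.netProfit i j)
    {o : List (Fin I.n)} (ho : o.Perm (List.finRange I.n))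
    (hc : 2 * o.crossSum (I.selSize sel) (I.selProfit sel) ≤
      (∑ i, I.selProfit sel i) * (∑ i, I.selSize sel i) -
        ∑ i, I.selProfit sel i * I.selSize sel i)
    (hnd : ((I.selPairs sel o).map Prod.fst).Nodup) :
    (∑ i, I.selProfit sel i - best) / 2 ≤
      (NonAdaptivePolicy.ofList I (I.selPairs sel o) hnd).expectedProfit := by
  have hpos : ∀ x ∈ I.selPairs sel o, 0 < I.pairProfit x := fun x hx =>
    h.pos x.1 x.2 (mem_selPairs hx)
  have key := NonAdaptivePolicy.le_expectedProfit_ofList I hA (I.selPairs sel o) hnd hpos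
    fun x hx => hp x.1 x.2 (hpos x hx)
  have hsum : ∀ g : Fin I.n → ℚ, (o.map g).sum = ∑ i, g i := fun g => by
    rw [(ho.map g).sum_eq, ← List.sum_ofFn, List.ofFn_eq_map]
  rw [crossSum_selPairs, sum_selPairs, sum_selPairs] at key
  have e1 : (o.map fun i => (sel i).elim 0 fun j => I.pairProfit (i, j)).sum =
    ∑ i, I.selProfit sel i := hsum _
  have e2 : (o.map fun i => (sel i).elim 0 fun j => I.pairProfit (i, j) * I.pairSize (i, j)).sum =
      ∑ i, I.selProfit sel i * I.selSize sel i := by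
    rw [hsum]
    refine Finset.sum_congr rfl fun i _ => ?_
    unfold selProfit selSize
    cases sel i <;> simp
  rw [e1, e2] at key
  set W := ∑ i, I.selProfit sel i
  set M := ∑ i, I.selSize sel i
  set G := ∑ i, I.selProfit sel i * I.selSize sel i with hG
  have hW : 0 ≤ W := Finset.sum_nonneg fun i _ => h.selProfit_nonneg i
  have h1 : G ≤ best * M := by
    rw [Finset.mul_sum]
    refine Finset.sum_le_sum fun i _ => mul_le_mul_of_nonneg_right ?_ (selSize_nonneg i)
    unfold selProfit
    cases sel i
    · exact hb0
    · exact hb _ _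
  have h2 : A * G ≤ best := by
    have := mul_le_mul_of_nonneg_left h1 (by linarith : 0 ≤ A)
    have := mul_le_mul_of_nonneg_left h.fits hb0
    linarith
  have h3 : W * (A * M) ≤ W * 1 := mul_le_mul_of_nonneg_left h.fits hW
  have h4 := mul_le_mul_of_nonneg_left hc (by linarith : 0 ≤ A)
  linarith

/-- The inverse return on investment is at most `A - 1`. -/
theorem one_add_alpha_eq (hA : 1 ≤ A)
    (hp : ∀ i j, 0 < I.netProfit i j → I.netProfit i j + I.p i j ≤ A * I.netProfit i j)
    (hA' : A = 1 ∨ ∃ i j, 0 < I.netProfit i j ∧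
      I.netProfit i j + I.p i j = A * I.netProfit i j) :
    1 + I.alpha = (A : ℝ) := by
  have h1 : I.alpha = ((A - 1 : ℚ) : ℝ) := by
    have hle : ∀ x : {x : Fin I.n × Fin I.m // 0 < I.netProfit x.1 x.2},
        (I.inverseROI x.1.1 x.1.2 : ℝ) ≤ ((A - 1 : ℚ) : ℝ) := fun x => by
      refine Rat.cast_le.mpr ?_
      rw [inverseROI, div_le_iff₀ x.2]
      linarith [hp _ _ x.2]
    have hnn : ∀ x : {x : Fin I.n × Fin I.m // 0 < I.netProfit x.1 x.2},
        0 ≤ (I.inverseROI x.1.1 x.1.2 : ℝ) := fun x =>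
      Rat.cast_nonneg.mpr (div_nonneg (I.p_nonneg _ _) x.2.le)
    -- `Real.iSup_le` and `Real.iSup_nonneg` also cover the case without profitable pairs, where the
    -- real supremum over the empty type is `0`.
    refine le_antisymm (Real.iSup_le hle (Rat.cast_nonneg.mpr (by linarith))) ?_
    rcases hA' with rfl | ⟨i, j, h0, h⟩
    · rw [sub_self, Rat.cast_zero]
      exact Real.iSup_nonneg hnn
    · have h2 : A - 1 = I.inverseROI i j := by
        rw [inverseROI, eq_div_iff h0.ne']
        linarith
      rw [h2]
      exact le_ciSup (f := fun x : {x : Fin I.n × Fin I.m // 0 < I.netProfit x.1 x.2} =>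
        (I.inverseROI x.1.1 x.1.2 : ℝ)) ⟨_, Set.forall_mem_range.mpr hle⟩ ⟨(i, j), h0⟩
  rw [h1]
  push_cast
  ring

/-- The result of the greedy algorithm, in the better of the two orders, or the best single pair:
this is the policy of the theorem. -/
theorem IsGreedyEnd.approximation (h : I.IsGreedyEnd A sel) (hA : 1 ≤ A) {best : ℚ}
    (hb : ∀ i j, I.netProfit i j ≤ best) (hb0 : 0 ≤ best)
    (hp : ∀ i j, 0 < I.netProfit i j → I.netProfit i j + I.p i j ≤ A * I.netProfit i j)
    (hA' : A = 1 ∨ ∃ i j, 0 < I.netProfit i j ∧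
      I.netProfit i j + I.p i j = A * I.netProfit i j) (π : I.NonAdaptivePolicy)
    (hπ : (∑ i, I.selProfit sel i + best) / 4 ≤ π.expectedProfit) :
    I.ADAPT ≤ 8 * (1 + I.alpha) * (π.expectedProfit : ℝ) := by
  rw [one_add_alpha_eq hA hp hA']
  refine (h.ADAPT_le hA hb0 hb).trans ?_
  have : 2 * A * (∑ i, I.selProfit sel i + best) ≤ 8 * A * π.expectedProfit := by
    have := mul_le_mul_of_nonneg_left hπ (by linarith : 0 ≤ 8 * A)
    linarith
  exact_mod_cast this

end MSKC

/-! ### Bit lengths and the cost of expressions. -/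

namespace RAM

theorem bitLen_le_iff {z : ℤ} {b : ℕ} : bitLen z ≤ b + 1 ↔ |z| < 2 ^ b := by
  rw [bitLen, Nat.add_le_add_iff_right, Nat.size_le, Int.abs_eq_natAbs]
  exact_mod_cast Iff.rfl

theorem one_le_bitLen (z : ℤ) : 1 ≤ bitLen z := Nat.le_add_left _ _

theorem abs_lt_two_pow_bitLen (z : ℤ) : |z| < 2 ^ (bitLen z - 1) :=
  bitLen_le_iff.mp (Nat.sub_add_cancel (one_le_bitLen z)).ge

theorem bitLen_add_le (x y : ℤ) : bitLen (x + y) ≤ bitLen x + bitLen y := by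
  have hx := abs_lt_two_pow_bitLen x
  have hy := abs_lt_two_pow_bitLen y
  have h1 := one_le_bitLen x
  have h2 := one_le_bitLen y
  have h3 : bitLen x + bitLen y = (bitLen x + bitLen y - 1) + 1 := by omega
  rw [h3, bitLen_le_iff]
  have h4 : (2 : ℤ) ^ (bitLen x - 1) ≤ 2 ^ (bitLen x + bitLen y - 2) :=
    pow_le_pow_right₀ (by norm_num) (by omega)
  have h5 : (2 : ℤ) ^ (bitLen y - 1) ≤ 2 ^ (bitLen x + bitLen y - 2) :=
    pow_le_pow_right₀ (by norm_num) (by omega)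
  have h6 : bitLen x + bitLen y - 1 = (bitLen x + bitLen y - 2) + 1 := by omega
  rw [h6, pow_succ]
  linarith [abs_add_le x y]

theorem bitLen_neg (x : ℤ) : bitLen (-x) = bitLen x := by simp [bitLen]

theorem bitLen_sub_le (x y : ℤ) : bitLen (x - y) ≤ bitLen x + bitLen y := by
  rw [sub_eq_add_neg, ← bitLen_neg y]
  exact bitLen_add_le x (-y)

theorem bitLen_mul_le (x y : ℤ) : bitLen (x * y) ≤ bitLen x + bitLen y := by
  have hx := abs_lt_two_pow_bitLen x
  have hy := abs_lt_two_pow_bitLen y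
  have h1 := one_le_bitLen x
  have h2 := one_le_bitLen y
  have h3 : bitLen x + bitLen y = ((bitLen x - 1) + (bitLen y - 1) + 1) + 1 := by omega
  rw [h3, bitLen_le_iff, abs_mul]
  calc |x| * |y| < 2 ^ (bitLen x - 1) * 2 ^ (bitLen y - 1) :=
        mul_lt_mul'' hx hy (abs_nonneg _) (abs_nonneg _)
    _ ≤ _ := by
        rw [← pow_add]
        exact pow_le_pow_right₀ (by norm_num) (by omega)

theorem bitLen_div_le (x y : ℤ) : bitLen (x / y) ≤ bitLen x :=
  Nat.add_le_add_right (Nat.size_le_size (Int.natAbs_ediv_le_natAbs x y)) 1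

/-- All numbers in the memory are smaller than `2 ^ b` in absolute value. -/
def Bdd (b : ℕ) (σ : Store) : Prop := ∀ a k, |σ a k| < 2 ^ b

/-- A bound on the cost of an expression, relative to the bit length of the numbers in memory. -/
def Expr.weight : Expr → ℕ
  | const c => bitLen c
  | read _ k => k.weight + 1
  | add e f => 2 * (e.weight + f.weight)
  | sub e f => 2 * (e.weight + f.weight)
  | mul e f => 2 * (e.weight + f.weight)
  | div e f => 2 * (e.weight + f.weight)

theorem Expr.bitLen_eval_le {b : ℕ} {σ : Store} (hσ : Bdd b σ) (e : Expr) :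
    bitLen (e.eval σ) ≤ e.weight * (b + 1) := by
  induction e with
  | const c => exact Nat.le_mul_of_pos_right _ b.succ_pos
  | read a k _ =>
    exact (bitLen_le_iff.mpr (hσ a _)).trans (Nat.le_mul_of_pos_left _ (Nat.succ_pos _))
  | add e f he hf =>
    have := bitLen_add_le (e.eval σ) (f.eval σ)
    simp only [weight, eval] at *
    nlinarith
  | sub e f he hf =>
    have := bitLen_sub_le (e.eval σ) (f.eval σ)
    simp only [weight, eval] at *
    nlinarith
  | mul e f he hf =>
    have := bitLen_mul_le (e.eval σ) (f.eval σ)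
    simp only [weight, eval] at *
    nlinarith
  | div e f he hf =>
    have := bitLen_div_le (e.eval σ) (f.eval σ)
    simp only [weight, eval] at *
    nlinarith

/-- The factor 2 in the weight of a binary operation pays once for evaluating the operands and once
for the length of the result. -/
theorem Expr.cost_le {b : ℕ} {σ : Store} (hσ : Bdd b σ) (e : Expr) :
    e.cost σ ≤ e.weight * (b + 1) := by
  induction e with
  | const c => exact Nat.le_mul_of_pos_right _ b.succ_pos
  | read a k ih =>
    have := bitLen_le_iff.mpr (hσ a (k.eval σ))
    simp only [weight, cost]
    linarith
  | add e f he hf =>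
    have := bitLen_add_le (e.eval σ) (f.eval σ)
    have := e.bitLen_eval_le hσ
    have := f.bitLen_eval_le hσ
    simp only [weight, cost]
    linarith
  | sub e f he hf =>
    have := bitLen_sub_le (e.eval σ) (f.eval σ)
    have := e.bitLen_eval_le hσ
    have := f.bitLen_eval_le hσ
    simp only [weight, cost]
    linarith
  | mul e f he hf =>
    have := bitLen_mul_le (e.eval σ) (f.eval σ)
    have := e.bitLen_eval_le hσ
    have := f.bitLen_eval_le hσ
    simp only [weight, cost]
    linarith
  | div e f he hf =>
    have := bitLen_div_le (e.eval σ) (f.eval σ)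
    have := e.bitLen_eval_le hσ
    simp only [weight, cost]
    linarith [Nat.zero_le (f.weight * (b + 1))]

/-! ### A calculus of total correctness with bounds on time and on numbers. -/

/-- The number of steps of a program, relative to the bit length of the numbers in memory, as a
polynomial in the largest number of rounds of a loop. -/
noncomputable def Program.steps : Program → Polynomial ℕ
  | skip => 1
  | write _ k e => Polynomial.C (k.weight + e.weight + 1)
  | seq c d => c.steps + d.steps
  | ite e c d => Polynomial.C (e.weight + 1) + c.steps + d.steps
  | loop e c => (Polynomial.X + 1) * (Polynomial.C (e.weight + 1) + c.steps)

/-- The arrays to which a program writes. -/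
def Program.writes : Program → List ℕ
  | skip => []
  | write a _ _ => [a]
  | seq c d => c.writes ++ d.writes
  | ite _ c d => c.writes ++ d.writes
  | loop _ c => c.writes

/-- Total correctness with resources: started in `σ` with numbers below `2 ^ b`, the program halts
in a store with the property `Q`, in time polynomial in the bound `X` on the numbers of rounds of
its loops and linear in `b`; the numbers stay below `2 ^ b`, and only the arrays to which the
program writes are changed. -/
def Tr (X b : ℕ) (c : Program) (σ : Store) (Q : Store → Prop) : Prop :=
  Bdd b σ → ∃ σ' t, Exec c σ σ' t ∧ t ≤ c.steps.eval X * (b + 1) ∧ Bdd b σ' ∧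
    (∀ a ∉ c.writes, σ' a = σ a) ∧ Q σ'

theorem Bdd.set {b : ℕ} {σ : Store} (hσ : Bdd b σ) {a : ℕ} {k z : ℤ} (hz : |z| < 2 ^ b) :
    Bdd b (σ.set a k z) := by
  intro a' k'
  unfold Store.set
  split_ifs
  · exact hz
  · exact hσ a' k'

@[simp] theorem Store.set_of_ne {σ : Store} {a a' : ℕ} {k z : ℤ} (h : a' ≠ a) :
    σ.set a k z a' = σ a' := by
  funext k'
  simp [Store.set, h]

namespace Tr

variable {X b : ℕ} {c d : Program} {σ : Store} {Q : Store → Prop}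

theorem skip (h : Q σ) : Tr X b .skip σ Q := fun hσ =>
  ⟨σ, 1, .skip σ, by simp [Program.steps], hσ, fun _ _ => rfl, h⟩

theorem write {a : ℕ} {k e : Expr} (he : |e.eval σ| < 2 ^ b)
    (h : Q (σ.set a (k.eval σ) (e.eval σ))) : Tr X b (.write a k e) σ Q := fun hσ =>
  ⟨_, _, .write σ a k e, by
    have := k.cost_le hσ
    have := e.cost_le hσ
    simp only [Program.steps, Polynomial.eval_C]
    linarith, hσ.set he, fun a' ha => Store.set_of_ne (by simpa [Program.writes] using ha), h⟩

theorem seq (h : Tr X b c σ fun σ' => Tr X b d σ' Q) : Tr X b (.seq c d) σ Q := by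
  intro hσ
  obtain ⟨σ₁, s, h1, h2, h3, h4, h5⟩ := h hσ
  obtain ⟨σ₂, t, g1, g2, g3, g4, g5⟩ := h5 h3
  refine ⟨σ₂, s + t, .seq h1 g1, ?_, g3, fun a ha => ?_, g5⟩
  · simp only [Program.steps, Polynomial.eval_add]
    linarith
  · simp only [Program.writes, List.mem_append, not_or] at ha
    rw [g4 a ha.2, h4 a ha.1]

theorem ite {e : Expr} (hc : 0 < e.eval σ → Tr X b c σ Q) (hd : ¬ 0 < e.eval σ → Tr X b d σ Q) :
    Tr X b (.ite e c d) σ Q := by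
  intro hσ
  have hcost := e.cost_le hσ
  have hc0 := Nat.zero_le (c.steps.eval X * (b + 1))
  have hd0 := Nat.zero_le (d.steps.eval X * (b + 1))
  by_cases he : 0 < e.eval σ
  · obtain ⟨σ₁, s, h1, h2, h3, h4, h5⟩ := hc he hσ
    refine ⟨σ₁, _, .ite_pos he h1, ?_, h3, fun a ha => h4 a ?_, h5⟩
    · simp only [Program.steps, Polynomial.eval_add, Polynomial.eval_C]
      linarith
    · simp only [Program.writes, List.mem_append, not_or] at ha
      exact ha.1
  · obtain ⟨σ₁, s, h1, h2, h3, h4, h5⟩ := hd he hσ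
    refine ⟨σ₁, _, .ite_neg he h1, ?_, h3, fun a ha => h4 a ?_, h5⟩
    · simp only [Program.steps, Polynomial.eval_add, Polynomial.eval_C]
      linarith
    · simp only [Program.writes, List.mem_append, not_or] at ha
      exact ha.2

theorem mono {Q' : Store → Prop} (h : Tr X b c σ Q')
    (hQ : ∀ σ', Bdd b σ' → (∀ a ∉ c.writes, σ' a = σ a) → Q' σ' → Q σ') : Tr X b c σ Q := by
  intro hσ
  obtain ⟨σ₁, s, h1, h2, h3, h4, h5⟩ := h hσ
  exact ⟨σ₁, s, h1, h2, h3, h4, hQ σ₁ h3 h4 h5⟩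

theorem loop {e : Expr} (Inv : ℕ → Store → Prop) {N : ℕ} (hN : N ≤ X)
    (hpos : ∀ k < N, ∀ σ', Inv k σ' → 0 < e.eval σ')
    (hend : ∀ σ', Inv N σ' → ¬ 0 < e.eval σ')
    (hstep : ∀ k < N, ∀ σ', (∀ a ∉ c.writes, σ' a = σ a) → Inv k σ' →
      Tr X b c σ' (Inv (k + 1))) (h0 : Inv 0 σ) : Tr X b (.loop e c) σ (Inv N) := by
  intro hσ
  -- Induction on the number `r` of rounds still to come. The factor `r + 1` includes the last test,
  -- which fails.
  have key : ∀ r ≤ N, ∀ σ', Bdd b σ' → (∀ a ∉ c.writes, σ' a = σ a) → Inv (N - r) σ' →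
      ∃ σ'' t, Exec (.loop e c) σ' σ'' t ∧
        t ≤ (r + 1) * ((e.weight + 1 + c.steps.eval X) * (b + 1)) ∧ Bdd b σ'' ∧
        (∀ a ∉ c.writes, σ'' a = σ a) ∧ Inv N σ'' := by
    intro r
    induction r with
    | zero =>
      intro _ σ' hb hf hi
      rw [Nat.sub_zero] at hi
      refine ⟨σ', _, Exec.loop_stop (hend σ' hi), ?_, hb, hf, hi⟩
      have := e.cost_le hb
      have := Nat.zero_le (c.steps.eval X * (b + 1))
      linarith
    | succ r ih =>
      intro hr σ' hb hf hi
      have hlt : N - (r + 1) < N := by omega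
      obtain ⟨σ₁, s, h1, h2, h3, h4, h5⟩ := hstep _ hlt σ' hf hi hb
      have e1 : N - (r + 1) + 1 = N - r := by omega
      rw [e1] at h5
      obtain ⟨σ₂, t, g1, g2, g3, g4, g5⟩ :=
        ih (by omega) σ₁ h3 (fun a ha => (h4 a ha).trans (hf a ha)) h5
      refine ⟨σ₂, _, .loop_step (hpos _ hlt σ' hi) h1 g1, ?_, g3, g4, g5⟩
      have := e.cost_le hb
      linarith
  obtain ⟨σ₁, t, h1, h2, h3, h4, h5⟩ := key N le_rfl σ hσ (fun _ _ => rfl) (by simpa using h0)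
  refine ⟨σ₁, t, h1, h2.trans ?_, h3, h4, h5⟩
  simp only [Program.steps, Polynomial.eval_mul, Polynomial.eval_add, Polynomial.eval_X,
    Polynomial.eval_one, Polynomial.eval_C]
  rw [mul_assoc]
  exact Nat.mul_le_mul_right _ (by omega)

end Tr

/-- The content of a variable, which is entry `0` of its array. -/
abbrev Expr.var (a : ℕ) : Expr := .read a (.const 0)

/-- Assignment to a variable. -/
abbrev Program.assign (a : ℕ) (e : Expr) : Program := .write a (.const 0) e

/-- `for v = 0, …, e - 1 do c`. -/
def Program.for (v : ℕ) (e : Expr) (c : Program) : Program :=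
  .seq (.assign v (.const 0))
    (.loop (.sub e (.var v)) (.seq c (.assign v (.add (.var v) (.const 1)))))

/-- The body may not write the counter `v`, but the counter is incremented after the body. Therefore
`hstep` asks for an invariant that survives any change of array `v`. The bound `e` is evaluated anew
in each round, and `he` says that neither the body nor the counter affects it. -/
theorem Tr.for {X b : ℕ} {c : Program} {σ : Store} {Q : Store → Prop} {v : ℕ} {e : Expr}
    (Inv : ℕ → Store → Prop) {N : ℕ} (hN : N ≤ X) (hNb : (N : ℤ) < 2 ^ b) (hv : v ∉ c.writes)
    (he : ∀ σ', (∀ a ∉ c.writes, a ≠ v → σ' a = σ a) → e.eval σ' = N)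
    (h0 : ∀ σ', (∀ a ≠ v, σ' a = σ a) → Inv 0 σ')
    (hstep : ∀ k < N, ∀ σ', (∀ a ∉ c.writes, a ≠ v → σ' a = σ a) → σ' v 0 = (k : ℤ) → Inv k σ' →
      Tr X b c σ' fun τ => ∀ τ', (∀ a ≠ v, τ' a = τ a) → Inv (k + 1) τ')
    (hQ : ∀ σ', (∀ a ∉ c.writes, a ≠ v → σ' a = σ a) → Inv N σ' → Q σ') :
    Tr X b (.for v e c) σ Q := by
  refine .seq (.write (by simp [Expr.eval]) ?_)
  set σ₀ := σ.set v (Expr.eval σ (.const 0)) (Expr.eval σ (.const 0)) with hσ₀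
  have hne : ∀ a ≠ v, σ₀ a = σ a := fun a ha => Store.set_of_ne ha
  have hfr : ∀ σ' : Store, (∀ a ∉ (Program.seq c (.assign v (.add (.var v) (.const 1)))).writes,
      σ' a = σ₀ a) → ∀ a ∉ c.writes, a ≠ v → σ' a = σ a := fun σ' h a ha hav => by
    rw [h a (by simp [Program.writes, ha, hav]), hne a hav]
  refine (Tr.loop (fun k σ' => (∀ a ∉ c.writes, a ≠ v → σ' a = σ a) ∧ σ' v 0 = (k : ℤ) ∧ Inv k σ') hN
    ?_ ?_ ?_ ?_).mono fun σ' _ _ h => hQ σ' h.1 h.2.2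
  · intro k hk σ' ⟨h1, h2, _⟩
    simp only [Expr.eval, h2, he σ' h1]
    omega
  · intro σ' ⟨h1, h2, _⟩
    simp only [Expr.eval, h2, he σ' h1]
    omega
  · intro k hk σ' _ ⟨h1, h2, h3⟩
    refine .seq ((hstep k hk σ' h1 h2 h3).mono fun τ _ hτ h => ?_)
    have hvk : τ v 0 = k := by rw [hτ v hv, h2]
    refine .write ?_ ⟨fun a ha hav => ?_, ?_, h _ fun a ha => Store.set_of_ne ha⟩
    · simp only [Expr.eval, hvk]
      rw [abs_of_nonneg (by positivity)]
      omega
    · rw [Store.set_of_ne hav, hτ a ha, h1 a ha hav]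
    · simp [Store.set, Expr.eval, hvk]
  · exact ⟨fun a _ hav => hne a hav, by simp [hσ₀, Store.set, Expr.eval], h0 _ hne⟩

theorem initStore_bdd {x : List ℤ} {b : ℕ} (h : ∀ z ∈ x, |z| < 2 ^ b) : Bdd b (initStore x) := by
  intro a k
  unfold initStore
  split_ifs
  · rcases lt_or_ge k.toNat x.length with h1 | h1
    · rw [List.getD_eq_getElem _ _ h1]
      exact h _ (List.getElem_mem h1)
    · rw [List.getD_eq_default _ _ h1]
      simp
  · simp

end RAM

/-! ### Lists of words in memory. -/

/-- The entries `p, p + 1, …` of `f` are the members of `l`. -/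
def Holds (f : ℤ → ℤ) (p : ℤ) (l : List ℤ) : Prop :=
  ∀ (k : ℕ) (hk : k < l.length), f (p + k) = l[k]

theorem holds_nil (f : ℤ → ℤ) (p : ℤ) : Holds f p [] := fun _ hk => absurd hk (by simp)

theorem holds_cons {f : ℤ → ℤ} {p z : ℤ} {l : List ℤ} :
    Holds f p (z :: l) ↔ f p = z ∧ Holds f (p + 1) l := by
  constructor
  · intro h
    have h0 := h 0 (by simp)
    rw [Nat.cast_zero, add_zero] at h0
    refine ⟨h0, fun k hk => ?_⟩
    have := h (k + 1) (by simpa using hk)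
    rw [List.getElem_cons_succ] at this
    rw [← this]
    push_cast
    ring_nf
  · rintro ⟨h1, h2⟩ (_ | k) hk
    · simpa using h1
    · rw [List.getElem_cons_succ, ← h2 k (by simpa using hk)]
      push_cast
      ring_nf

theorem holds_append {f : ℤ → ℤ} {l l' : List ℤ} {p : ℤ} :
    Holds f p (l ++ l') ↔ Holds f p l ∧ Holds f (p + l.length) l' := by
  induction l generalizing p with
  | nil => simp [holds_nil]
  | cons z l ih =>
    simp only [List.cons_append, holds_cons, ih, List.length_cons, and_assoc]
    push_cast
    ring_nf

theorem Holds.flatMap_getElem {A : Type} {f : ℤ → ℤ} {g : A → List ℤ} {r : ℕ}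
    (hg : ∀ a, (g a).length = r) {l : List A} {p : ℤ} (h : Holds f p (l.flatMap g)) (k : ℕ)
    (hk : k < l.length) : Holds f (p + r * k) (g l[k]) := by
  induction l generalizing p k with
  | nil => simp at hk
  | cons a l ih =>
    rw [List.flatMap_cons, holds_append, hg] at h
    cases k with
    | zero => simpa using h.1
    | succ k =>
      have := ih h.2 k (by simpa using hk)
      rw [List.getElem_cons_succ]
      convert this using 1
      push_cast
      ring

theorem holds_initStore (x : List ℤ) : Holds (RAM.initStore x 0) 0 x := by
  intro k hk
  simp [RAM.initStore, hk]

/-! ### Parameters of the instance are bounded by the input length. -/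

namespace MSKC

variable (I : MSKC)

/-- The words for choice `j` of item `i`. -/
def encodePair (i : Fin I.n) (j : Fin I.m) : List ℤ :=
  encodeRat (I.p i j) ++ encodeDist (I.F i j)

/-- The words for item `i`. -/
def encodeItem (i : Fin I.n) : List ℤ :=
  encodeRat (I.v i) ++ (List.finRange I.m).flatMap (I.encodePair i)

theorem encode_eq :
    I.encode = [(I.n : ℤ), (I.m : ℤ)] ++ (List.finRange I.n).flatMap I.encodeItem := rfl

theorem length_le_totalBits (x : List ℤ) : x.length ≤ RAM.totalBits x := by
  induction x with
  | nil => simp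
  | cons z x ih =>
    have := RAM.one_le_bitLen z
    simp only [RAM.totalBits, List.map_cons, List.sum_cons, List.length_cons] at ih ⊢
    omega

theorem length_encode_le : I.encode.length ≤ I.inputLength := length_le_totalBits _

theorem length_encodePair (i : Fin I.n) (j : Fin I.m) :
    (I.encodePair i j).length = 3 + 4 * (I.F i j).atoms.length := by
  have : ∀ l : List (ℚ × ℚ),
      (l.flatMap fun a => encodeRat a.1 ++ encodeRat a.2).length = 4 * l.length := by
    intro l
    induction l with
    | nil => rfl
    | cons a l ih =>
      have h2 : ∀ q, (encodeRat q).length = 2 := fun _ => rfl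
      simp only [List.flatMap_cons, List.length_append, ih, List.length_cons, h2]
      ring
  have h2 : ∀ q, (encodeRat q).length = 2 := fun _ => rfl
  simp only [encodePair, encodeDist, List.length_append, List.length_cons, this, h2]
  ring

theorem length_flatMap_ge {A : Type} (g : A → List ℤ) (r : ℕ) (hg : ∀ a, r ≤ (g a).length)
    (l : List A) : l.length * r ≤ (l.flatMap g).length := by
  induction l with
  | nil => simp
  | cons a l ih =>
    have := hg a
    simp only [List.flatMap_cons, List.length_append, List.length_cons]
    linarith

theorem length_le_length_flatMap {A : Type} (g : A → List ℤ) {l : List A} {a : A} (ha : a ∈ l) :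
    (g a).length ≤ (l.flatMap g).length := by
  obtain ⟨s, t, rfl⟩ := List.append_of_mem ha
  simp only [List.flatMap_append, List.flatMap_cons, List.length_append]
  omega

theorem length_encodeItem_ge (i : Fin I.n) : 2 + I.m ≤ (I.encodeItem i).length := by
  have := length_flatMap_ge (I.encodePair i) 1 (fun j => by
    rw [length_encodePair]; omega) (List.finRange I.m)
  rw [List.length_finRange] at this
  simp only [encodeItem, List.length_append, encodeRat, List.length_cons, List.length_nil]
  omega

/-- Every item takes two words for its value and at least one for each choice. So the number of
pairs is bounded by the number of words, although `n` and `m` are themselves given in binary. -/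
theorem n_mul_le : I.n * (2 + I.m) ≤ I.inputLength := by
  refine le_trans ?_ I.length_encode_le
  have := length_flatMap_ge I.encodeItem _ I.length_encodeItem_ge (List.finRange I.n)
  rw [List.length_finRange] at this
  rw [encode_eq, List.length_append]
  omega

theorem n_le : I.n ≤ I.inputLength := by nlinarith [I.n_mul_le, Nat.zero_le (I.n * I.m)]

theorem nm_le : I.n * I.m ≤ I.inputLength := by nlinarith [I.n_mul_le]

/-- An item is needed: with `n = 0` no choices are listed, and `m` may be exponential in the input
length. -/
theorem m_le (i : Fin I.n) : I.m ≤ I.inputLength := by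
  have := i.pos
  nlinarith [I.n_mul_le]

theorem atoms_length_le (i : Fin I.n) (j : Fin I.m) :
    (I.F i j).atoms.length ≤ I.inputLength := by
  refine le_trans ?_ I.length_encode_le
  have h1 := length_le_length_flatMap I.encodeItem (List.mem_finRange i)
  have h2 := length_le_length_flatMap (I.encodePair i) (List.mem_finRange j)
  rw [length_encodePair] at h2
  rw [encode_eq, List.length_append]
  rw [encodeItem, List.length_append] at h1
  omega

theorem two_le_inputLength : 2 ≤ I.inputLength := by
  have := I.length_encode_le
  rw [encode_eq, List.length_append] at this
  simp only [List.length_cons, List.length_nil] at this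
  omega

/-- The words of the input, as the content of array `0`. -/
def words : ℤ → ℤ := RAM.initStore I.encode 0

theorem abs_lt_of_mem_encode {z : ℤ} (hz : z ∈ I.encode) : |z| < 2 ^ I.inputLength := by
  rw [← RAM.bitLen_le_iff]
  refine le_trans ?_ (Nat.le_succ _)
  exact List.single_le_sum (fun _ _ => Nat.zero_le _) _ (List.mem_map_of_mem hz)

theorem abs_words_le (k : ℤ) : |I.words k| ≤ 2 ^ I.inputLength :=
  (RAM.initStore_bdd (fun _ hz => I.abs_lt_of_mem_encode hz) 0 k).le

theorem words_zero : I.words 0 = I.n := (holds_cons.mp (holds_initStore I.encode)).1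

theorem words_one : I.words 1 = I.m := by
  have := (holds_cons.mp (holds_cons.mp (holds_initStore I.encode)).2).1
  rwa [zero_add] at this

theorem holds_words : Holds I.words 2 ((List.finRange I.n).flatMap I.encodeItem) := by
  have := (holds_cons.mp (holds_cons.mp (holds_initStore I.encode)).2).2
  rwa [zero_add, one_add_one_eq_two] at this

end MSKC

theorem List.drop_finRange {n k : ℕ} (hk : k < n) :
    (List.finRange n).drop k = ⟨k, hk⟩ :: (List.finRange n).drop (k + 1) := by
  rw [List.drop_eq_getElem_cons (by simpa using hk)]
  simp

theorem List.take_succ_finRange {n k : ℕ} (hk : k < n) :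
    (List.finRange n).take (k + 1) = (List.finRange n).take k ++ [⟨k, hk⟩] := by
  rw [List.take_succ_eq_append_getElem (by simpa using hk)]
  simp

/-! ### The program -/

/-! The variables and arrays of the program: loop counters, the position in the input, the numbers
computed from the input, and those of the greedy algorithm. -/

notation "rI" => (2 : ℕ)
notation "rJ" => (3 : ℕ)
notation "rT" => (4 : ℕ)
notation "rP" => (5 : ℕ)
notation "rV" => (6 : ℕ)
notation "rD" => (7 : ℕ)
notation "rA" => (8 : ℕ)
notation "rC" => (9 : ℕ)
notation "rWn" => (10 : ℕ)
notation "rUn" => (11 : ℕ)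
notation "rDn" => (12 : ℕ)
notation "rQ" => (13 : ℕ)
notation "rAN" => (14 : ℕ)
notation "rAW" => (15 : ℕ)
notation "rW" => (16 : ℕ)
notation "rU" => (17 : ℕ)
notation "rK" => (18 : ℕ)
notation "rBest" => (19 : ℕ)
notation "rBK" => (20 : ℕ)
notation "rR" => (21 : ℕ)
notation "rStop" => (22 : ℕ)
notation "rGa" => (23 : ℕ)
notation "rGb" => (24 : ℕ)
notation "rGk" => (25 : ℕ)
notation "rM" => (26 : ℕ)
notation "rCw" => (27 : ℕ)
notation "rCu" => (28 : ℕ)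
notation "rCh" => (29 : ℕ)
notation "rCross" => (30 : ℕ)
notation "rPm" => (31 : ℕ)
notation "rDiag" => (32 : ℕ)
notation "rWT" => (33 : ℕ)
notation "rO" => (34 : ℕ)
notation "rX" => (35 : ℕ)

namespace RAM

instance : Add Expr := ⟨Expr.add⟩
instance : Sub Expr := ⟨Expr.sub⟩
instance : Mul Expr := ⟨Expr.mul⟩
instance : Div Expr := ⟨Expr.div⟩
instance (k : ℕ) : OfNat Expr k := ⟨Expr.const k⟩

@[simp] theorem eval_add (σ : Store) (e f : Expr) : (e + f).eval σ = e.eval σ + f.eval σ := rfl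
@[simp] theorem eval_sub (σ : Store) (e f : Expr) : (e - f).eval σ = e.eval σ - f.eval σ := rfl
@[simp] theorem eval_mul (σ : Store) (e f : Expr) : (e * f).eval σ = e.eval σ * f.eval σ := rfl
@[simp] theorem eval_div (σ : Store) (e f : Expr) : (e / f).eval σ = e.eval σ / f.eval σ := rfl
@[simp] theorem eval_zero (σ : Store) : (0 : Expr).eval σ = 0 := rfl
@[simp] theorem eval_one (σ : Store) : (1 : Expr).eval σ = 1 := rfl
@[simp] theorem eval_two (σ : Store) : (2 : Expr).eval σ = 2 := rfl
@[simp] theorem eval_three (σ : Store) : (3 : Expr).eval σ = 3 := rfl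
@[simp] theorem eval_four (σ : Store) : (4 : Expr).eval σ = 4 := rfl
@[simp] theorem eval_read (σ : Store) (a : ℕ) (k : Expr) : (Expr.read a k).eval σ = σ a (k.eval σ) := rfl
@[simp] theorem eval_const (σ : Store) (c : ℤ) : (Expr.const c).eval σ = c := rfl

end RAM

namespace MSKC

open RAM RAM.Program RAM.Expr

/-- A number at a distance from the position in the input. -/
abbrev inputAt (d : Expr) : Expr := read 0 (var rP + d)

/-- The numbers of an atom: its size is `atomAt 0 / atomAt 1`, its probability `atomAt 2 / atomAt 3`. -/
abbrev atomAt (d : Expr) : Expr := read 0 (var rP + 3 + 4 * var rT + d)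

/-- Adds an atom to the probability `A / D` of a size of at most `1` and to the truncated mean
`C / D`. -/
def atomProg : Program :=
  seq (ite (atomAt 1 - atomAt 0 + 1)
      (seq (assign rA (var rA * (atomAt 1 * atomAt 3) + atomAt 2 * atomAt 1 * var rD))
        (assign rC (var rC * (atomAt 1 * atomAt 3) + atomAt 2 * atomAt 0 * var rD)))
      (seq (assign rA (var rA * (atomAt 1 * atomAt 3)))
        (assign rC (var rC * (atomAt 1 * atomAt 3) + atomAt 2 * atomAt 1 * var rD))))
    (assign rD (var rD * (atomAt 1 * atomAt 3)))

/-- Reads a distribution. -/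
def distProg : Program :=
  seq (assign rD 1) (seq (assign rA 0) (seq (assign rC 0) (.for rT (inputAt 2) atomProg)))

/-- The address of the current pair. -/
abbrev pairAddr : Expr := var rI * read 0 1 + var rJ

/-- The numerator of the value of the current item. -/
abbrev valueNum : Expr := read 0 (var rV)
/-- The denominator of the value of the current item. -/
abbrev valueDen : Expr := read 0 (var rV + 1)

/-- Stores net profit and truncated mean of a pair as fractions with a common denominator. -/
def storeProg : Program :=
  seq (write rWn pairAddr (valueNum * inputAt 1 * var rA - inputAt 0 * valueDen * var rD))
    (seq (write rUn pairAddr (var rC * (valueDen * inputAt 1)))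
      (write rDn pairAddr (var rD * (valueDen * inputAt 1))))

/-- Updates the largest `(w + p) / w`. -/
def alphaProg : Program :=
  ite (read rWn pairAddr)
    (ite (valueNum * inputAt 1 * var rA * var rAW - var rAN * read rWn pairAddr)
      (seq (assign rAN (valueNum * inputAt 1 * var rA)) (assign rAW (read rWn pairAddr))) skip) skip

/-- Reads a pair. -/
def pairProg : Program :=
  seq distProg (seq storeProg (seq alphaProg (seq (assign rQ (var rQ * read rDn pairAddr))
    (assign rP (var rP + 3 + 4 * inputAt 2)))))

/-- Reads an item. -/
def itemProg : Program :=
  seq (assign rV (var rP)) (seq (assign rP (var rP + 2)) (.for rJ (read 0 1) pairProg))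

/-- Reads the input. -/
def readProg : Program :=
  seq (assign rP 2) (seq (assign rQ 1) (seq (assign rAN 1) (seq (assign rAW 1)
    (.for rI (read 0 0) itemProg))))

/-- Passes to the common denominator `Q`, and finds the largest net profit. -/
def scaleProg : Program :=
  .for rK (read 0 0 * read 0 1)
    (seq (write rW (var rK) (read rWn (var rK) * (var rQ / read rDn (var rK))))
      (seq (write rU (var rK) (read rUn (var rK) * (var rQ / read rDn (var rK))))
        (ite (read rW (var rK) - var rBest)
          (seq (assign rBest (read rW (var rK))) (assign rBK (var rK))) skip)))

/-- The improvement by pair `K`. -/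
abbrev gain : Expr := read rW (var rK) - read rCw (var rK / read 0 1)
/-- The additional mean size for pair `K`. -/
abbrev load : Expr := read rU (var rK) - read rCu (var rK / read 0 1)

/-- Finds the improvement with the largest ratio `a / b` of gain and load. -/
def searchProg : Program :=
  seq (assign rGa 0) (seq (assign rGb 1) (.for rK (read 0 0 * read 0 1)
    (ite gain (ite (gain * var rGb - var rGa * load)
      (seq (assign rGa gain) (seq (assign rGb load) (assign rGk (var rK)))) skip) skip)))

/-- Makes the improvement that was found, if it fits. -/
def upgradeProg : Program :=
  ite (var rGa)
    (ite (var rQ * var rAW - (var rM + var rGb) * var rAN + 1)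
      (seq (assign rM (var rM + var rGb))
        (seq (write rCh (var rGk / read 0 1) (var rGk + 1))
          (seq (write rCw (var rGk / read 0 1) (read rW (var rGk)))
            (write rCu (var rGk / read 0 1) (read rU (var rGk))))))
      (assign rStop 1))
    skip

/-- The greedy algorithm. -/
def greedyProg : Program :=
  .for rR (read 0 0 * read 0 1) (ite (1 - var rStop) (seq searchProg upgradeProg) skip)

/-- Sums over the selected pairs. -/
def sumProg : Program :=
  .for rI (read 0 0)
    (seq (assign rCross (var rCross + var rPm * read rCw (var rI)))
      (seq (assign rDiag (var rDiag + read rCw (var rI) * read rCu (var rI)))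
        (seq (assign rWT (var rWT + read rCw (var rI)))
          (assign rPm (var rPm + read rCu (var rI))))))

/-- Writes the selected pairs to the output, in the better of the two orders. -/
def listProg : Program :=
  .for rI (read 0 0)
    (seq (ite (var rWT * var rPm - var rDiag - 2 * var rCross + 1)
        (assign rX (var rI)) (assign rX (read 0 0 - 1 - var rI)))
      (ite (read rCh (var rX))
        (seq (write 1 (var rO) (var rX + 1))
          (seq (write 1 (var rO + 1) (read rCh (var rX) - var rX * read 0 1))
            (assign rO (var rO + 2)))) skip))

/-- Writes the best single pair to the output. -/
def singleProg : Program :=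
  seq (write 1 0 (var rBK / read 0 1 + 1))
    (write 1 1 (var rBK - var rBK / read 0 1 * read 0 1 + 1))

/-- The algorithm. -/
def algorithm : Program :=
  seq readProg (seq scaleProg (seq greedyProg (seq sumProg
    (ite (var rWT - 3 * var rBest + 1) listProg singleProg))))

end MSKC

open RAM

@[simp] theorem RAM.Store.set_apply (σ : Store) (a a' : ℕ) (k k' z : ℤ) :
    σ.set a k z a' k' = if a' = a ∧ k' = k then z else σ a' k' := rfl

/-! ### Reading a distribution. -/

namespace MSKC

variable (I : MSKC)

/-- The probability of a size of at most `1`, from a list of atoms. -/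
def partProb (l : List (ℚ × ℚ)) : ℚ := (l.map fun a => a.2 * if a.1 ≤ 1 then 1 else 0).sum

/-- The truncated mean, from a list of atoms. -/
def partMean (l : List (ℚ × ℚ)) : ℚ := (l.map fun a => a.2 * min a.1 1).sum

/-- The terms are nonnegative, so partial sums stay below the expectation, which is at most 1. Thus
the numerators never exceed the running denominator while the atoms are read. -/
theorem partSum_mem (d : FinDist ℚ) (g : ℚ → ℚ) (hg : ∀ a ∈ d.atoms, 0 ≤ g a.1 ∧ g a.1 ≤ 1)
    (t : ℕ) : 0 ≤ ((d.atoms.take t).map fun a => a.2 * g a.1).sum ∧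
      ((d.atoms.take t).map fun a => a.2 * g a.1).sum ≤ 1 := by
  have hnn : ∀ l : List (ℚ × ℚ), l ⊆ d.atoms → 0 ≤ (l.map fun a => a.2 * g a.1).sum := by
    intro l hl
    refine List.sum_nonneg ?_
    simp only [List.mem_map, forall_exists_index, and_imp, forall_apply_eq_imp_iff₂]
    exact fun a ha => mul_nonneg (d.nonneg a (hl ha)) (hg a (hl ha)).1
  refine ⟨hnn _ (List.take_subset _ _), ?_⟩
  have h1 : d.expect g ≤ 1 := d.expect_le g 1 fun a ha => (hg a ha).2
  have h2 := hnn _ (List.drop_subset t d.atoms)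
  have h3 : d.expect g = ((d.atoms.take t).map fun a => a.2 * g a.1).sum +
      ((d.atoms.drop t).map fun a => a.2 * g a.1).sum := by
    rw [← List.sum_append, ← List.map_append, List.take_append_drop]
    rfl
  linarith

theorem partProb_mem (d : FinDist ℚ) (t : ℕ) :
    0 ≤ partProb (d.atoms.take t) ∧ partProb (d.atoms.take t) ≤ 1 :=
  partSum_mem d (fun s => if s ≤ 1 then 1 else 0)
    (fun a _ => by split_ifs <;> norm_num) t

theorem partMean_mem (d : FinDist ℚ) (h : ∀ a ∈ d.atoms, 0 ≤ a.1) (t : ℕ) :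
    0 ≤ partMean (d.atoms.take t) ∧ partMean (d.atoms.take t) ≤ 1 :=
  partSum_mem d (fun s => min s 1)
    (fun a ha => ⟨le_min (h a ha) zero_le_one, min_le_right _ _⟩) t

end MSKC

set_option linter.unusedSimpArgs false

namespace MSKC

variable (I : MSKC)

/-- For fractions with values in [0, 1] it is enough to control the denominator. -/
theorem eq_mul_of_mem {D A : ℤ} {P : ℚ} (hD : 0 < D) (h : (A : ℚ) = D * P) (hP : 0 ≤ P)
    (hP1 : P ≤ 1) : 0 ≤ A ∧ A ≤ D := by
  have hD' : (0 : ℚ) < D := by exact_mod_cast hD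
  constructor
  · have : (0 : ℚ) ≤ A := h ▸ mul_nonneg hD'.le hP
    exact_mod_cast this
  · have : (A : ℚ) ≤ D := h ▸ mul_le_of_le_one_right hD'.le hP1
    exact_mod_cast this

variable {I} {X b : ℕ} {Y : ℤ}

theorem atomProg_spec {σ : Store} {a : ℚ × ℚ} {P M : ℚ} {B : ℤ}
    (hw : Holds (σ 0) (σ rP 0 + 3 + 4 * σ rT 0) (encodeRat a.1 ++ encodeRat a.2))
    (hD : 0 < σ rD 0) (hA : (σ rA 0 : ℚ) = σ rD 0 * P) (hC : (σ rC 0 : ℚ) = σ rD 0 * M)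
    (hP : 0 ≤ P + a.2 * (if a.1 ≤ 1 then 1 else 0) ∧ P + a.2 * (if a.1 ≤ 1 then 1 else 0) ≤ 1)
    (hM : 0 ≤ M + a.2 * min a.1 1 ∧ M + a.2 * min a.1 1 ≤ 1)
    (hB : σ rD 0 * (a.1.den * a.2.den) ≤ B) (hb : B < 2 ^ b) :
    Tr X b atomProg σ fun τ => τ rD 0 = σ rD 0 * (a.1.den * a.2.den) ∧ 0 < τ rD 0 ∧
      (τ rA 0 : ℚ) = τ rD 0 * (P + a.2 * (if a.1 ≤ 1 then 1 else 0)) ∧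
      (τ rC 0 : ℚ) = τ rD 0 * (M + a.2 * min a.1 1) := by
  simp only [encodeRat, List.cons_append, List.nil_append, holds_cons] at hw
  obtain ⟨w0, w1, w2, w3, -⟩ := hw
  have e2 : σ rP 0 + 3 + 4 * σ rT 0 + 1 + 1 = σ rP 0 + 3 + 4 * σ rT 0 + 2 := by ring
  have e3 : σ rP 0 + 3 + 4 * σ rT 0 + 2 + 1 = σ rP 0 + 3 + 4 * σ rT 0 + 3 := by ring
  rw [e2] at w2 w3
  rw [e3] at w3
  have hh : (0 : ℤ) < a.1.den := by exact_mod_cast a.1.den_pos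
  have hf : (0 : ℤ) < a.2.den := by exact_mod_cast a.2.den_pos
  have hs : a.1 * a.1.den = a.1.num := Rat.mul_den_eq_num a.1
  have hr : a.2 * a.2.den = a.2.num := Rat.mul_den_eq_num a.2
  have hD' : 0 < σ rD 0 * (a.1.den * a.2.den) := by positivity
  -- The program tests whether `den - num + 1` is positive. For integers this means `num ≤ den`,
  -- that is, a size of at most `1`.
  have hle : a.1.num ≤ a.1.den ↔ a.1 ≤ 1 := by
    rw [← Int.cast_le (R := ℚ), ← hs, Int.cast_natCast]
    have h1 : (0 : ℚ) < a.1.den := by exact_mod_cast hh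
    constructor
    · intro h
      by_contra hn
      nlinarith
    · intro h
      nlinarith
  have bd : ∀ {z : ℤ} {q : ℚ}, (z : ℚ) = ((σ rD 0 * (a.1.den * a.2.den) : ℤ) : ℚ) * q →
      0 ≤ q → q ≤ 1 → |z| < 2 ^ b := fun hz h0 h1 => by
    obtain ⟨g1, g2⟩ := eq_mul_of_mem hD' hz h0 h1
    rw [abs_of_nonneg g1]
    linarith
  refine .seq (.ite (fun hc => ?_) (fun hc => ?_))
  · simp [w0, w1] at hc
    have hle1 : a.1 ≤ 1 := hle.mp (by omega)
    simp only [hle1, if_true, mul_one, min_eq_left] at hP hM ⊢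
    have hA' : ((σ rA 0 * (a.1.den * a.2.den) + a.2.num * a.1.den * σ rD 0 : ℤ) : ℚ) =
        ((σ rD 0 * (a.1.den * a.2.den) : ℤ) : ℚ) * (P + a.2) := by
      push_cast
      rw [hA, ← hr]
      ring
    have hC' : ((σ rC 0 * (a.1.den * a.2.den) + a.2.num * a.1.num * σ rD 0 : ℤ) : ℚ) =
        ((σ rD 0 * (a.1.den * a.2.den) : ℤ) : ℚ) * (M + a.2 * a.1) := by
      push_cast
      rw [hC, ← hr, ← hs]
      ring
    refine .seq (.write ?_ (.write ?_ (.write ?_ ?_)))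
    · simpa [w1, w2, w3] using bd hA' hP.1 hP.2
    · simpa [w0, w1, w2, w3] using bd hC' hM.1 hM.2
    · simpa [w1, w3, abs_of_pos hD, abs_mul] using hB.trans_lt hb
    · exact ⟨by simp [w1, w3], by simpa [w1, w3] using hD', by simpa [w1, w2, w3] using hA',
        by simpa [w0, w1, w2, w3] using hC'⟩
  · simp [w0, w1] at hc
    have hle1 : ¬ a.1 ≤ 1 := fun h => by have := hle.mpr h; omega
    simp only [hle1, if_false, mul_one, min_eq_right (not_le.mp hle1).le, mul_zero,
      add_zero] at hP hM ⊢
    have hA' : ((σ rA 0 * (a.1.den * a.2.den) : ℤ) : ℚ) =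
        ((σ rD 0 * (a.1.den * a.2.den) : ℤ) : ℚ) * P := by
      push_cast
      rw [hA]
      ring
    have hC' : ((σ rC 0 * (a.1.den * a.2.den) + a.2.num * a.1.den * σ rD 0 : ℤ) : ℚ) =
        ((σ rD 0 * (a.1.den * a.2.den) : ℤ) : ℚ) * (M + a.2) := by
      push_cast
      rw [hC, ← hr]
      ring
    refine .seq (.write ?_ (.write ?_ (.write ?_ ?_)))
    · simpa [w1, w2, w3] using bd hA' hP.1 hP.2
    · simpa [w0, w1, w2, w3] using bd hC' hM.1 hM.2
    · simpa [w1, w3, abs_of_pos hD, abs_mul] using hB.trans_lt hb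
    · exact ⟨by simp [w1, w3], by simpa [w1, w3] using hD', by simpa [w1, w2, w3] using hA',
        by simpa [w0, w1, w2, w3] using hC'⟩

/-- Fractions are never reduced: each atom multiplies the common denominator by two denominators of
the input, each at most `Y`. After `t` atoms it is at most `Y ^ (2 * t)`, so its bit length grows
only linearly in `t`. -/
theorem distProg_spec {σ : Store} {i : Fin I.n} {j : Fin I.m} (h0 : σ 0 = I.words)
    (hp : Holds I.words (σ rP 0) (I.encodePair i j)) (hY : ∀ z, |I.words z| ≤ Y) (hY1 : 1 ≤ Y)
    {s : ℕ} (hs : (I.F i j).atoms.length ≤ s) (hX : s ≤ X) (hXb : (s : ℤ) < 2 ^ b)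
    (hb : Y ^ (2 * s) < 2 ^ b) :
    Tr X b distProg σ fun τ => 0 < τ rD 0 ∧ τ rD 0 ≤ Y ^ (2 * s) ∧
      (τ rA 0 : ℚ) = τ rD 0 * (I.F i j).prob (fun s => s ≤ 1) ∧
      (τ rC 0 : ℚ) = τ rD 0 * I.truncMean i j := by
  set l := (I.F i j).atoms with hl
  simp only [encodePair, encodeRat, encodeDist, List.cons_append, List.nil_append,
    holds_cons] at hp
  obtain ⟨-, -, hlen, hat⟩ := hp
  have e2 : σ rP 0 + 1 + 1 = σ rP 0 + 2 := by ring
  have e3 : σ rP 0 + 2 + 1 = σ rP 0 + 3 := by ring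
  rw [e2] at hlen hat
  rw [e3] at hat
  have h1b : (1 : ℤ) < 2 ^ b := (one_le_pow₀ hY1).trans_lt hb
  refine .seq (.write (by simp [eval_one, h1b]) (.seq (.write (by simp [eval_zero])
    (.seq (.write (by simp [eval_zero]) ?_)))))
  refine Tr.for (fun t τ => τ rD 0 ≤ Y ^ (2 * t) ∧ 0 < τ rD 0 ∧
      (τ rA 0 : ℚ) = τ rD 0 * partProb (l.take t) ∧
      (τ rC 0 : ℚ) = τ rD 0 * partMean (l.take t)) (N := l.length) (hs.trans hX)
    (lt_of_le_of_lt (by exact_mod_cast hs) hXb) (by simp [atomProg, Program.writes]) ?_ ?_ ?_ ?_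
  · intro σ' hf
    have g0 := hf 0 (by simp [atomProg, Program.writes]) (by norm_num)
    have gP := hf rP (by simp [atomProg, Program.writes]) (by norm_num)
    simp only [eval_add, eval_read, eval_const, eval_two, g0, gP]
    simp [h0, hlen, ← hl]
  · intro σ' hf
    simp [hf rD, hf rA, hf rC, partProb, partMean]
  · intro t ht σ' hf hT ⟨i1, i2, i3, i4⟩
    have g0 := hf 0 (by simp [atomProg, Program.writes]) (by norm_num)
    have gP := hf rP (by simp [atomProg, Program.writes]) (by norm_num)
    have g0' : σ' 0 = I.words := by
      rw [g0, ← h0]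
      simp
    have gP' : σ' rP 0 = σ rP 0 := by
      rw [gP]
      simp [Store.set]
    have hw : Holds (σ' 0) (σ' rP 0 + 3 + 4 * σ' rT 0) (encodeRat l[t].1 ++ encodeRat l[t].2) := by
      rw [g0', gP', hT]
      have := hat.flatMap_getElem (r := 4) (fun _ => rfl) t ht
      exact_mod_cast this
    have tk : l.take (t + 1) = l.take t ++ [l[t]] := by
      rw [List.take_succ_eq_append_getElem ht]
    have eP : partProb (l.take (t + 1)) =
        partProb (l.take t) + l[t].2 * (if l[t].1 ≤ 1 then 1 else 0) := by
      simp only [partProb, tk, List.map_append, List.sum_append, List.map_cons, List.map_nil,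
        List.sum_singleton]
    have eM : partMean (l.take (t + 1)) = partMean (l.take t) + l[t].2 * min l[t].1 1 := by
      simp only [partMean, tk, List.map_append, List.sum_append, List.map_cons, List.map_nil,
        List.sum_singleton]
    have hw' := hw
    rw [g0'] at hw'
    simp only [encodeRat, List.cons_append, List.nil_append, holds_cons] at hw'
    obtain ⟨-, w1, -, w3, -⟩ := hw'
    have y1 := hY (σ' rP 0 + 3 + 4 * σ' rT 0 + 1)
    have y3 := hY (σ' rP 0 + 3 + 4 * σ' rT 0 + 1 + 1 + 1)
    rw [w1, Nat.abs_cast] at y1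
    rw [w3, Nat.abs_cast] at y3
    have hB : σ' rD 0 * (l[t].1.den * l[t].2.den) ≤ Y ^ (2 * (t + 1)) := by
      rw [mul_add, pow_add, mul_one, pow_two]
      exact mul_le_mul i1 (mul_le_mul y1 y3 (by positivity) (by linarith)) (by positivity)
        (pow_nonneg (by linarith) _)
    have hb' : Y ^ (2 * (t + 1)) < 2 ^ b :=
      (pow_le_pow_right₀ hY1 (by omega)).trans_lt hb
    refine (atomProg_spec hw i2 i3 i4 (eP ▸ partProb_mem _ _)
      (eM ▸ partMean_mem _ (I.size_nonneg i j) _) hB hb').mono fun τ _ _ ⟨j1, j2, j3, j4⟩ τ' hτ' => ?_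
    rw [hτ' rD (by norm_num), hτ' rA (by norm_num), hτ' rC (by norm_num), eP, eM]
    exact ⟨j1 ▸ hB, j2, j3, j4⟩
  · intro σ' _ ⟨i1, i2, i3, i4⟩
    rw [List.take_length] at i3 i4
    exact ⟨i2, i1.trans (pow_le_pow_right₀ hY1 (by omega)), i3, i4⟩

end MSKC

/-! ### Size parameters, addresses of pairs, and the data stored for one pair. -/

namespace MSKC

variable {I : MSKC} {X b : ℕ} {Y Z R : ℤ}

/-- Bounds on the numbers of rounds of the loops and on the sizes of the numbers that the algorithm
handles. -/
structure Params (I : MSKC) (X b : ℕ) (Y Z R : ℤ) : Prop where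
  words_le : ∀ z, |I.words z| ≤ Y
  two_le : 2 ≤ Y
  n_le : I.n ≤ X
  nm_le : I.n * I.m ≤ X
  length_le : I.encode.length ≤ X
  m_le : Fin I.n → I.m ≤ X
  len_le : ∀ i j, (I.F i j).atoms.length ≤ X
  X_pos : 1 ≤ X
  -- `Y` bounds the input words, `Z` the fractions of single pairs, and `R` the fractions over the
  -- common denominator of all pairs. The factor `X ^ 2 * R ^ 2` below is what the cross sum needs.
  le_Z : 2 * Y ^ 2 * Y ^ (2 * X) ≤ Z
  le_R : Z * Z ^ (I.n * I.m) ≤ R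
  R_lt : 4 * (X : ℤ) ^ 2 * R ^ 2 < 2 ^ b

/-- The address of a pair. -/
def idx (I : MSKC) (i : Fin I.n) (j : Fin I.m) : ℤ := i * I.m + j

theorem idx_nonneg (i : Fin I.n) (j : Fin I.m) : 0 ≤ I.idx i j := by unfold idx; positivity

theorem idx_lt (i : Fin I.n) (j : Fin I.m) : I.idx i j < I.n * I.m := by
  have h1 : (i : ℤ) + 1 ≤ I.n := by exact_mod_cast i.2
  have h2 : (j : ℤ) < I.m := by exact_mod_cast j.2
  unfold idx
  nlinarith

theorem idx_div (i : Fin I.n) (j : Fin I.m) : I.idx i j / I.m = i := by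
  have h2 : (j : ℤ) < I.m := by exact_mod_cast j.2
  have h0 : (0 : ℤ) ≤ j := by positivity
  rw [idx, add_comm, Int.add_mul_ediv_right _ _ (by omega), Int.ediv_eq_zero_of_lt h0 h2, zero_add]

theorem idx_inj {i i' : Fin I.n} {j j' : Fin I.m} (h : I.idx i j = I.idx i' j') :
    i = i' ∧ j = j' := by
  have h1 : (i : ℤ) = i' := by rw [← idx_div i j, h, idx_div]
  have h2 : (j : ℤ) = j' := by
    unfold idx at h
    rw [h1] at h
    linarith
  exact ⟨Fin.ext (by exact_mod_cast h1), Fin.ext (by exact_mod_cast h2)⟩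

theorem exists_idx_eq {k : ℕ} (hk : k < I.n * I.m) : ∃ i j, I.idx i j = k := by
  have hm : 0 < I.m := Nat.pos_of_ne_zero fun h => by simp [h] at hk
  refine ⟨⟨k / I.m, Nat.div_lt_of_lt_mul (by rwa [mul_comm])⟩, ⟨k % I.m, Nat.mod_lt _ hm⟩, ?_⟩
  simp only [idx]
  exact_mod_cast Nat.div_add_mod' k I.m

namespace Params

theorem one_le_Z (hP : Params I X b Y Z R) : 1 ≤ Z := by
  have h1 : 1 ≤ Y ^ 2 := one_le_pow₀ (by linarith [hP.two_le])
  have h2 : 1 ≤ Y ^ (2 * X) := one_le_pow₀ (by linarith [hP.two_le])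
  nlinarith [hP.le_Z]

theorem Z_le_R (hP : Params I X b Y Z R) : Z ≤ R := by
  have h := hP.one_le_Z
  have h1 : 1 ≤ Z ^ (I.n * I.m) := one_le_pow₀ h
  nlinarith [hP.le_R]

theorem pow_le_R (hP : Params I X b Y Z R) {c : ℕ} (hc : c ≤ I.n * I.m) : Z ^ c ≤ R := by
  have h := hP.one_le_Z
  have h1 : Z ^ c ≤ Z ^ (I.n * I.m) := pow_le_pow_right₀ h hc
  have h2 : 1 ≤ Z ^ (I.n * I.m) := one_le_pow₀ h
  nlinarith [hP.le_R]

theorem one_le_R (hP : Params I X b Y Z R) : 1 ≤ R := hP.one_le_Z.trans hP.Z_le_R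

theorem X_sq_mul_lt (hP : Params I X b Y Z R) : (X : ℤ) * R * (X * R) * 4 < 2 ^ b := by
  have := hP.R_lt
  linarith

theorem four_mul_R_lt (hP : Params I X b Y Z R) : 4 * (X * R) < 2 ^ b := by
  have h1 : (1 : ℤ) ≤ X := by exact_mod_cast hP.X_pos
  have h2 : 1 ≤ X * R := by nlinarith [hP.one_le_R]
  nlinarith [hP.X_sq_mul_lt]

theorem R_lt' (hP : Params I X b Y Z R) : 4 * R < 2 ^ b := by
  have h1 : (1 : ℤ) ≤ X := by exact_mod_cast hP.X_pos
  nlinarith [hP.four_mul_R_lt, hP.one_le_R]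

theorem X_lt (hP : Params I X b Y Z R) : 4 * (X : ℤ) < 2 ^ b := by
  have h1 : (1 : ℤ) ≤ X := by exact_mod_cast hP.X_pos
  nlinarith [hP.four_mul_R_lt, hP.one_le_R]

theorem pow_Y_lt (hP : Params I X b Y Z R) : Y ^ (2 * X) < 2 ^ b := by
  have h1 : 1 ≤ Y ^ 2 := one_le_pow₀ (by linarith [hP.two_le])
  have h2 : 1 ≤ Y ^ (2 * X) := one_le_pow₀ (by linarith [hP.two_le])
  nlinarith [hP.le_Z, hP.Z_le_R, hP.R_lt']

end Params

/-- The words `l` stand in the input from position `p` on. -/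
structure At (I : MSKC) (X : ℕ) (p : ℤ) (l : List ℤ) : Prop where
  holds : Holds I.words p l
  nonneg : 0 ≤ p
  le : p + l.length ≤ X

theorem At.left {p : ℤ} {l l' : List ℤ} (h : At I X p (l ++ l')) : At I X p l :=
  ⟨(holds_append.mp h.holds).1, h.nonneg, by
    have := h.le
    rw [List.length_append] at this
    push_cast at this
    omega⟩

theorem At.right {p : ℤ} {l l' : List ℤ} (h : At I X p (l ++ l')) :
    At I X (p + l.length) l' :=
  ⟨(holds_append.mp h.holds).2, by have := h.nonneg; positivity, by
    have := h.le
    rw [List.length_append] at this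
    push_cast at this
    omega⟩

theorem At.rat {p : ℤ} {q : ℚ} (h : At I X p (encodeRat q)) :
    I.words p = q.num ∧ I.words (p + 1) = q.den := by
  have := h.holds
  simp only [encodeRat, holds_cons] at this
  exact ⟨this.1, this.2.1⟩

/-- The numbers stored for a pair are correct. -/
structure PairOK (I : MSKC) (Z : ℤ) (σ : Store) (i : Fin I.n) (j : Fin I.m) : Prop where
  pos : 0 < σ rDn (I.idx i j)
  den_le : σ rDn (I.idx i j) ≤ Z
  num_le : |σ rWn (I.idx i j)| ≤ Z
  size_le : |σ rUn (I.idx i j)| ≤ Z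
  profit : (σ rWn (I.idx i j) : ℚ) = σ rDn (I.idx i j) * I.netProfit i j
  size : (σ rUn (I.idx i j) : ℚ) = σ rDn (I.idx i j) * I.truncMean i j

/-- The denominator `D * den v * den p` serves the net profit `w`, the size and `w + p` at once, so
the ratio of `w + p` and `w` is a ratio of numerators. The numerator of `w` is a difference of two
products; this explains the factor 2 in `le_Z`. -/
theorem storeProg_spec (hP : Params I X b Y Z R) {σ : Store} {i : Fin I.n} {j : Fin I.m}
    (h0 : σ 0 = I.words) (hI : σ rI 0 = i) (hJ : σ rJ 0 = j)
    (hV : At I X (σ rV 0) (encodeRat (I.v i))) (hp : At I X (σ rP 0) (encodeRat (I.p i j)))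
    (hD : 0 < σ rD 0) (hDY : σ rD 0 ≤ Y ^ (2 * X))
    (hA : (σ rA 0 : ℚ) = σ rD 0 * (I.F i j).prob (fun s => s ≤ 1))
    (hC : (σ rC 0 : ℚ) = σ rD 0 * I.truncMean i j) :
    Tr X b storeProg σ fun τ => PairOK I Z τ i j ∧
      (((I.v i).num * (I.p i j).den * σ rA 0 : ℤ) : ℚ) =
        τ rDn (I.idx i j) * (I.netProfit i j + I.p i j) ∧
      (I.v i).num * (I.p i j).den * σ rA 0 ≤ Z ∧
      ∀ k, k ≠ I.idx i j → τ rWn k = σ rWn k ∧ τ rUn k = σ rUn k ∧ τ rDn k = σ rDn k := by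
  obtain ⟨v0, v1⟩ := hV.rat
  obtain ⟨p0, p1⟩ := hp.rat
  have bv := hP.words_le (σ rV 0)
  have bv' := hP.words_le (σ rV 0 + 1)
  have bp := hP.words_le (σ rP 0)
  have bp' := hP.words_le (σ rP 0 + 1)
  rw [v0] at bv
  rw [v1, Nat.abs_cast] at bv'
  rw [p0] at bp
  rw [p1, Nat.abs_cast] at bp'
  have hvd : (0 : ℤ) < (I.v i).den := by exact_mod_cast (I.v i).den_pos
  have hpd : (0 : ℤ) < (I.p i j).den := by exact_mod_cast (I.p i j).den_pos
  have hpr := (I.F i j).prob_nonneg fun s => s ≤ 1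
  have hpr1 := (I.F i j).prob_le_one fun s => s ≤ 1
  have hu1 : I.truncMean i j ≤ 1 := (I.F i j).expect_le _ 1 fun a _ => min_le_right _ _
  obtain ⟨A0, A1⟩ := eq_mul_of_mem hD hA hpr hpr1
  obtain ⟨C0, C1⟩ := eq_mul_of_mem hD hC (I.truncMean_nonneg i j) hu1
  have hY0 : 0 ≤ Y := by linarith [hP.two_le]
  have prod_le : ∀ x y z : ℤ, |x| ≤ Y → |y| ≤ Y → |z| ≤ Y ^ (2 * X) →
      |x * y * z| * 2 ≤ Z := fun x y z hx hy hz => by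
    rw [abs_mul, abs_mul]
    have h1 : |x| * |y| ≤ Y * Y := mul_le_mul hx hy (abs_nonneg _) hY0
    have h2 : |x| * |y| * |z| ≤ Y * Y * Y ^ (2 * X) :=
      mul_le_mul h1 hz (abs_nonneg _) (mul_nonneg hY0 hY0)
    have := hP.le_Z
    nlinarith
  have aA : |σ rA 0| ≤ Y ^ (2 * X) := by rw [abs_of_nonneg A0]; linarith
  have aC : |σ rC 0| ≤ Y ^ (2 * X) := by rw [abs_of_nonneg C0]; linarith
  have aD : |σ rD 0| ≤ Y ^ (2 * X) := by rw [abs_of_pos hD]; linarith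
  have avd : |((I.v i).den : ℤ)| ≤ Y := by rw [Nat.abs_cast]; exact bv'
  have apd : |((I.p i j).den : ℤ)| ≤ Y := by rw [Nat.abs_cast]; exact bp'
  have b1 := prod_le _ _ _ bv apd aA
  have b2 := prod_le _ _ _ bp avd aD
  have b3 := prod_le _ _ _ avd apd aC
  have b4 := prod_le _ _ _ avd apd aD
  have hZR := hP.Z_le_R
  have hRb := hP.R_lt'
  have hR1 := hP.one_le_R
  have c1 : |(I.v i).num * (I.p i j).den * σ rA 0 - (I.p i j).num * (I.v i).den * σ rD 0| ≤ Z := by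
    refine (abs_sub _ _).trans ?_
    linarith
  have e3 : σ rC 0 * ((I.v i).den * (I.p i j).den) = (I.v i).den * (I.p i j).den * σ rC 0 := by
    ring
  have e4 : σ rD 0 * ((I.v i).den * (I.p i j).den) = (I.v i).den * (I.p i j).den * σ rD 0 := by
    ring
  have c3 : |σ rC 0 * ((I.v i).den * (I.p i j).den)| ≤ Z := by 
    rw [e3]
    linarith [abs_nonneg ((I.v i).den * (I.p i j).den * σ rC 0)]
  have c4 : |σ rD 0 * ((I.v i).den * (I.p i j).den)| ≤ Z := by 
    rw [e4]
    linarith [abs_nonneg ((I.v i).den * (I.p i j).den * σ rD 0)]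
  have hDp : 0 < σ rD 0 * ((I.v i).den * (I.p i j).den) := by positivity
  have hv : I.v i * (I.v i).den = (I.v i).num := Rat.mul_den_eq_num _
  have hq : I.p i j * (I.p i j).den = (I.p i j).num := Rat.mul_den_eq_num _
  have q1 : (((I.v i).num * (I.p i j).den * σ rA 0 - (I.p i j).num * (I.v i).den * σ rD 0 : ℤ) : ℚ)
      = ((σ rD 0 * ((I.v i).den * (I.p i j).den) : ℤ) : ℚ) * I.netProfit i j := by
    push_cast
    rw [hA, ← hv, ← hq, netProfit]
    ring
  have q2 : ((σ rC 0 * ((I.v i).den * (I.p i j).den) : ℤ) : ℚ)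
      = ((σ rD 0 * ((I.v i).den * (I.p i j).den) : ℤ) : ℚ) * I.truncMean i j := by
    push_cast
    rw [hC]
    ring
  have q3 : (((I.v i).num * (I.p i j).den * σ rA 0 : ℤ) : ℚ)
      = ((σ rD 0 * ((I.v i).den * (I.p i j).den) : ℤ) : ℚ) * (I.netProfit i j + I.p i j) := by
    push_cast
    rw [hA, ← hv, netProfit]
    ring
  have wm := I.words_one
  have hk : (i : ℤ) * I.m + j = I.idx i j := rfl
  refine .seq (.write ?_ (.seq (.write ?_ (.write ?_ ⟨⟨?_, ?_, ?_, ?_, ?_, ?_⟩, ?_, ?bound, ?_⟩))))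
  case bound =>
    linarith [le_abs_self ((I.v i).num * (I.p i j).den * σ rA 0),
      abs_nonneg ((I.v i).num * (I.p i j).den * σ rA 0)]
  all_goals simp only [eval_add, eval_sub, eval_mul, eval_read, eval_const, eval_zero, eval_one,
    Store.set_apply, h0, hI, hJ, v0, v1, p0, p1, wm, hk, add_zero, Nat.reduceEqDiff,
    OfNat.zero_ne_ofNat, false_and, if_false, and_self, if_true]
  · linarith
  · linarith
  · linarith
  · exact hDp
  · exact (le_abs_self _).trans c4
  · exact c1
  · exact c3
  · exact q1
  · exact q2
  · exact q3
  · intro k hk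
    simp [hk]

end MSKC

/-! ### Reading the input: fractions of all pairs, common denominator, and the parameter α. -/

namespace MSKC

variable {I : MSKC} {X b : ℕ} {Y Z R : ℤ}

/-- What holds after the pairs with an address below `c` have been read. -/
structure ReadInv (I : MSKC) (Z : ℤ) (c : ℕ) (σ : Store) : Prop where
  pair : ∀ i j, I.idx i j < c → PairOK I Z σ i j
  Q_pos : 0 < σ rQ 0
  Q_le : σ rQ 0 ≤ Z ^ c
  dvd : ∀ i j, I.idx i j < c → σ rDn (I.idx i j) ∣ σ rQ 0
  AW_pos : 0 < σ rAW 0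
  AW_le : σ rAW 0 ≤ σ rAN 0
  AN_le : σ rAN 0 ≤ Z
  alpha_le : ∀ i j, I.idx i j < c → 0 < I.netProfit i j →
    (I.netProfit i j + I.p i j) * σ rAW 0 ≤ σ rAN 0 * I.netProfit i j
  alpha_eq : σ rAN 0 = σ rAW 0 ∨ ∃ i j, 0 < I.netProfit i j ∧
    (I.netProfit i j + I.p i j) * σ rAW 0 = σ rAN 0 * I.netProfit i j

theorem ReadInv.congr {c : ℕ} {σ τ : Store} (h : ReadInv I Z c σ) (hWn : τ rWn = σ rWn)
    (hUn : τ rUn = σ rUn) (hDn : τ rDn = σ rDn) (hQ : τ rQ = σ rQ) (hAN : τ rAN = σ rAN)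
    (hAW : τ rAW = σ rAW) : ReadInv I Z c τ where
  pair i j hi := by
    obtain ⟨h1, h2, h3, h4, h5, h6⟩ := h.pair i j hi
    constructor <;> simp only [hWn, hUn, hDn] <;> assumption
  Q_pos := hQ ▸ h.Q_pos
  Q_le := hQ ▸ h.Q_le
  dvd i j hi := by rw [hQ, hDn]; exact h.dvd i j hi
  AW_pos := hAW ▸ h.AW_pos
  AW_le := by rw [hAW, hAN]; exact h.AW_le
  AN_le := hAN ▸ h.AN_le
  alpha_le := by rw [hAW, hAN]; exact h.alpha_le
  alpha_eq := by rw [hAW, hAN]; exact h.alpha_eq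

/-- `AN / AW` is the running maximum of `(w + p) / w`, compared by cross multiplication. The fourth
conclusion says that it does not decrease, so the bounds for earlier pairs persist; the last one
says that a changed value is attained by the current pair. -/
theorem alphaProg_spec (hP : Params I X b Y Z R) {σ : Store} {i : Fin I.n} {j : Fin I.m} {D N : ℤ}
    (h0 : σ 0 = I.words) (hI : σ rI 0 = i) (hJ : σ rJ 0 = j)
    (hN : I.words (σ rV 0) * I.words (σ rP 0 + 1) * σ rA 0 = N)
    (hD : 0 < D) (hWn : (σ rWn (I.idx i j) : ℚ) = D * I.netProfit i j)
    (hND : (N : ℚ) = D * (I.netProfit i j + I.p i j)) (hNZ : N ≤ Z)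
    (hAW : 0 < σ rAW 0) (hle : σ rAW 0 ≤ σ rAN 0) (hAN : σ rAN 0 ≤ Z) :
    Tr X b alphaProg σ fun τ => 0 < τ rAW 0 ∧ τ rAW 0 ≤ τ rAN 0 ∧ τ rAN 0 ≤ Z ∧
      σ rAN 0 * τ rAW 0 ≤ τ rAN 0 * σ rAW 0 ∧
      (0 < I.netProfit i j →
        (I.netProfit i j + I.p i j) * τ rAW 0 ≤ τ rAN 0 * I.netProfit i j) ∧
      ((τ rAN 0 = σ rAN 0 ∧ τ rAW 0 = σ rAW 0) ∨ 0 < I.netProfit i j ∧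
        (I.netProfit i j + I.p i j) * τ rAW 0 = τ rAN 0 * I.netProfit i j) := by
  have hD' : (0 : ℚ) < D := by exact_mod_cast hD
  have wm := I.words_one
  have hk : (i : ℤ) * I.m + j = I.idx i j := rfl
  have hp := I.p_nonneg i j
  have hZ := hP.one_le_Z
  have hZR := hP.Z_le_R
  have hRb := hP.R_lt'
  set W := σ rWn (I.idx i j) with hW
  have hWpos : 0 < W ↔ 0 < I.netProfit i j := by
    rw [← Int.cast_pos (R := ℚ), hWn, mul_pos_iff_of_pos_left hD']
  have hWN : W ≤ N := by
    have : (W : ℚ) ≤ N := by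
      rw [hWn, hND]
      exact mul_le_mul_of_nonneg_left (by linarith) hD'.le
    exact_mod_cast this
  have key : ∀ x y : ℤ, N * x ≤ y * W ↔
      (I.netProfit i j + I.p i j) * x ≤ y * I.netProfit i j := fun x y => by
    rw [← Int.cast_le (R := ℚ)]
    push_cast
    rw [hWn, hND, mul_assoc, mul_left_comm (y : ℚ), mul_le_mul_iff_right₀ hD']
  have ev : ∀ τ : Store, (valueNum * inputAt 1 * Expr.var rA).eval τ =
    τ 0 (τ rV 0) * τ 0 (τ rP 0 + 1) * τ rA 0 := fun τ => rfl
  have ev' : ∀ τ : Store, (Expr.read rWn pairAddr).eval τ =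
    τ rWn (τ rI 0 * τ 0 1 + τ rJ 0) := fun τ => rfl
  refine .ite (fun hc => .ite (fun hc2 => ?_) fun hc2 => ?_) fun hc => ?_
  · rw [ev', h0, wm, hI, hJ, hk] at hc
    have hc2' : 0 < N * σ rAW 0 - σ rAN 0 * W := by
      simpa [h0, wm, hI, hJ, hk, hN] using hc2
    have e1 : (I.netProfit i j + I.p i j) * W = N * I.netProfit i j := by
      rw [hWn, hND]
      ring
    refine .seq (.write ?_ (.write ?_ ?_))
    · rw [ev, h0, hN, abs_of_nonneg (by linarith)]
      linarith
    · simp only [ev', Store.set_apply, Nat.reduceEqDiff, OfNat.zero_ne_ofNat, false_and, if_false,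
        h0, wm, hI, hJ, hk]
      rw [abs_of_pos hc]
      linarith
    · simp only [ev, ev', Store.set_apply, Nat.reduceEqDiff, OfNat.zero_ne_ofNat, false_and,
        if_false, h0, wm, hI, hJ, hk, hN, eval_const, and_self, if_true]
      exact ⟨hc, hWN, hNZ, by linarith, fun _ => e1.le, Or.inr ⟨hWpos.mp hc, e1⟩⟩
  · have hc2' : ¬ 0 < N * σ rAW 0 - σ rAN 0 * W := by
      simpa [h0, wm, hI, hJ, hk, hN] using hc2
    exact .skip ⟨hAW, hle, hAN, le_rfl, fun _ => (key _ _).mp (by linarith), Or.inl ⟨rfl, rfl⟩⟩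
  · rw [ev', h0, wm, hI, hJ, hk] at hc
    exact .skip ⟨hAW, hle, hAN, le_rfl, fun h => absurd (hWpos.mpr h) hc, Or.inl ⟨rfl, rfl⟩⟩

theorem pairProg_spec (hP : Params I X b Y Z R) {σ : Store} {i : Fin I.n} {j : Fin I.m} {c : ℕ}
    (hc : I.idx i j = c) (h0 : σ 0 = I.words) (hI : σ rI 0 = i) (hJ : σ rJ 0 = j)
    (hV : At I X (σ rV 0) (encodeRat (I.v i))) (hp : At I X (σ rP 0) (I.encodePair i j))
    (hinv : ReadInv I Z c σ) :
    Tr X b pairProg σ fun τ => ReadInv I Z (c + 1) τ ∧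
      τ rP 0 = σ rP 0 + (I.encodePair i j).length := by
  have hcn : c + 1 ≤ I.n * I.m := by
    have := idx_lt i j
    rw [hc] at this
    exact_mod_cast this
  have hX4 := hP.X_lt
  have hY1 : 1 ≤ Y := by linarith [hP.two_le]
  have hlen := I.length_encodePair i j
  have hpP : At I X (σ rP 0) (encodeRat (I.p i j)) := by
    unfold encodePair at hp
    exact hp.left
  refine .seq ((distProg_spec h0 hp.holds hP.words_le hY1 (hP.len_le i j) le_rfl
    (by linarith) hP.pow_Y_lt).mono fun σ₁ _ f1 ⟨d1, d2, d3, d4⟩ => ?_)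
  have g1 : ∀ a, a ∉ distProg.writes → σ₁ a = σ a := f1
  simp only [distProg, atomProg, Program.for, Program.writes, List.cons_append, List.nil_append,
    List.mem_cons, List.not_mem_nil, or_false, not_or] at g1
  have k0 : σ₁ 0 = I.words := by rw [g1 0 (by norm_num), h0]
  have kI : σ₁ rI = σ rI := g1 _ (by norm_num)
  have kJ : σ₁ rJ = σ rJ := g1 _ (by norm_num)
  have kV : σ₁ rV = σ rV := g1 _ (by norm_num)
  have kP : σ₁ rP = σ rP := g1 _ (by norm_num)
  have inv1 : ReadInv I Z c σ₁ := hinv.congr (g1 _ (by norm_num)) (g1 _ (by norm_num))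
    (g1 _ (by norm_num)) (g1 _ (by norm_num)) (g1 _ (by norm_num)) (g1 _ (by norm_num))
  refine .seq ((storeProg_spec hP k0 (by rw [kI, hI]) (by rw [kJ, hJ]) (by rw [kV]; exact hV)
    (by rw [kP]; exact hpP) d1 d2 d3 d4).mono fun σ₂ _ f2 ⟨s1, s2, s3, s4⟩ => ?_)
  have g2 : ∀ a, a ∉ storeProg.writes → σ₂ a = σ₁ a := f2
  simp only [storeProg, Program.writes, List.cons_append, List.nil_append,
    List.mem_cons, List.not_mem_nil, or_false, not_or] at g2
  have l0 : σ₂ 0 = I.words := by rw [g2 0 (by norm_num), k0]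
  have lI : σ₂ rI = σ rI := by rw [g2 _ (by norm_num), kI]
  have lJ : σ₂ rJ = σ rJ := by rw [g2 _ (by norm_num), kJ]
  have lV : σ₂ rV = σ rV := by rw [g2 _ (by norm_num), kV]
  have lP : σ₂ rP = σ rP := by rw [g2 _ (by norm_num), kP]
  have lA : σ₂ rA = σ₁ rA := g2 _ (by norm_num)
  have lQ : σ₂ rQ = σ₁ rQ := g2 _ (by norm_num)
  have lAN : σ₂ rAN = σ₁ rAN := g2 _ (by norm_num)
  have lAW : σ₂ rAW = σ₁ rAW := g2 _ (by norm_num)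
  refine .seq ((alphaProg_spec hP (N := (I.v i).num * (I.p i j).den * σ₁ rA 0) l0 (by rw [lI, hI])
    (by rw [lJ, hJ]) (by rw [lV, lP, lA, hV.rat.1, hpP.rat.2]) s1.pos s1.profit s2 s3
    (by rw [lAW]; exact inv1.AW_pos) (by rw [lAW, lAN]; exact inv1.AW_le)
    (by rw [lAN]; exact inv1.AN_le)).mono fun σ₃ _ f3 ⟨a1, a2, a3, a4, a5, a6⟩ => ?_)
  have g3 : ∀ a, a ∉ alphaProg.writes → σ₃ a = σ₂ a := f3
  simp only [alphaProg, Program.writes, List.cons_append, List.nil_append,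
    List.mem_cons, List.not_mem_nil, or_false, not_or] at g3
  have m0 : σ₃ 0 = I.words := by rw [g3 0 (by norm_num), l0]
  have mI : σ₃ rI 0 = i := by rw [g3 _ (by norm_num), lI, hI]
  have mJ : σ₃ rJ 0 = j := by rw [g3 _ (by norm_num), lJ, hJ]
  have mP : σ₃ rP = σ rP := by rw [g3 _ (by norm_num), lP]
  have mQ : σ₃ rQ = σ₁ rQ := by rw [g3 _ (by norm_num), lQ]
  have mDn : σ₃ rDn = σ₂ rDn := g3 _ (by norm_num)
  have mUn : σ₃ rUn = σ₂ rUn := g3 _ (by norm_num)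
  have mWn : σ₃ rWn = σ₂ rWn := g3 _ (by norm_num)
  have wm := I.words_one
  have hk : (i : ℤ) * I.m + j = I.idx i j := rfl
  have hlenw : I.words (σ rP 0 + 2) = (I.F i j).atoms.length := by
    have := hp.holds
    simp only [encodePair, encodeRat, encodeDist, List.cons_append, List.nil_append,
      holds_cons] at this
    have e2 : σ rP 0 + 1 + 1 = σ rP 0 + 2 := by ring
    rw [e2] at this
    exact this.2.2.1
  -- The common denominator is the plain product of the denominators; each pair contributes a factor
  -- of at most `Z`.
  have hQ' : σ₁ rQ 0 * σ₂ rDn (I.idx i j) ≤ Z ^ (c + 1) := by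
    rw [pow_succ]
    exact mul_le_mul inv1.Q_le s1.den_le s1.pos.le (pow_nonneg (by linarith [hP.one_le_Z]) _)
  have hQp : 0 < σ₁ rQ 0 * σ₂ rDn (I.idx i j) := mul_pos inv1.Q_pos s1.pos
  have hPp : |σ rP 0 + 3 + 4 * I.words (σ rP 0 + 2)| < 2 ^ b := by
    have h1 := hp.le
    have h2 := hp.nonneg
    rw [hlen] at h1
    rw [hlenw, abs_of_nonneg (by positivity)]
    push_cast at h1
    linarith
  refine .seq (.write ?_ (.write ?_ ?_))
  · simp only [eval_mul, eval_read, eval_const, eval_add, m0, mI, mJ, wm, hk, mQ, mDn, eval_one]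
    rw [abs_of_pos hQp]
    linarith [hP.pow_le_R hcn, hP.R_lt', hP.one_le_R]
  · simp only [eval_mul, eval_read, eval_const, eval_add, Store.set_apply, Nat.reduceEqDiff,
      OfNat.zero_ne_ofNat, false_and, if_false, m0, mP, eval_two, eval_three, eval_four]
    exact hPp
  · have eQ : (Expr.var rQ * .read rDn pairAddr).eval σ₃ = σ₁ rQ 0 * σ₂ rDn (I.idx i j) := by
      simp only [eval_mul, eval_read, eval_const, eval_add, m0, mI, mJ, wm, hk, mQ, mDn, eval_one]
    rw [eQ]
    have split : ∀ i' j', I.idx i' j' < (c + 1 : ℕ) →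
        (I.idx i' j' < c ∧ I.idx i' j' ≠ I.idx i j) ∨ (i' = i ∧ j' = j) := by
      intro i' j' h
      push_cast at h
      rcases lt_or_eq_of_le (Int.lt_add_one_iff.mp h) with h | h
      · exact Or.inl ⟨h, by rw [hc]; exact h.ne⟩
      · exact Or.inr (idx_inj (h.trans hc.symm))
    refine ⟨⟨?_, ?_, ?_, ?_, ?_, ?_, ?_, ?_, ?_⟩, ?_⟩
    · intro i' j' h
      rcases split i' j' h with ⟨h, hne⟩ | ⟨rfl, rfl⟩
      · obtain ⟨t1, t2, t3⟩ := s4 _ hne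
        obtain ⟨h1, h2, h3, h4, h5, h6⟩ := inv1.pair i' j' h
        constructor <;> simp [mWn, mUn, mDn, t1, t2, t3] <;> assumption
      · obtain ⟨h1, h2, h3, h4, h5, h6⟩ := s1
        constructor <;> simp [mWn, mUn, mDn] <;> assumption
    · simpa using hQp
    · simpa using hQ'
    · intro i' j' h
      rcases split i' j' h with ⟨h, hne⟩ | ⟨rfl, rfl⟩
      · have := inv1.dvd i' j' h
        simp only [Store.set_apply, Nat.reduceEqDiff, false_and, if_false, eval_const, and_self,
          if_true, mDn, (s4 _ hne).2.2]
        exact Dvd.dvd.mul_right this _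
      · simp only [Store.set_apply, Nat.reduceEqDiff, false_and, if_false, eval_const, and_self,
          if_true, mDn]
        exact Dvd.intro_left _ rfl
    · simpa using a1
    · simpa using a2
    · simpa using a3
    · intro i' j' h hpos
      simp only [Store.set_apply, Nat.reduceEqDiff, false_and, if_false]
      rcases split i' j' h with ⟨h, hne⟩ | ⟨rfl, rfl⟩
      -- The bound for an earlier pair is passed on from the old maximum to the new one, after
      -- multiplication by the old `AW`.
      · have h1 := inv1.alpha_le i' j' h hpos
        have h2 : ((σ₁ rAN 0 : ℚ) * σ₃ rAW 0) ≤ σ₃ rAN 0 * σ₁ rAW 0 := by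
          rw [lAN, lAW] at a4
          exact_mod_cast a4
        have h3 : (0 : ℚ) < σ₁ rAW 0 := by exact_mod_cast inv1.AW_pos
        have h4 : (0 : ℚ) < σ₃ rAW 0 := by exact_mod_cast a1
        refine le_of_mul_le_mul_right ?_ h3
        have h5 := mul_le_mul_of_nonneg_right h1 h4.le
        have h6 := mul_le_mul_of_nonneg_left h2 hpos.le
        linarith
      · exact a5 hpos
    · simp only [Store.set_apply, Nat.reduceEqDiff, false_and, if_false]
      rcases a6 with ⟨h1, h2⟩ | h
      · rw [h1, h2, lAN, lAW]
        exact inv1.alpha_eq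
      · exact Or.inr ⟨i, j, h⟩
    · simp only [eval_mul, eval_read, eval_const, eval_add, Store.set_apply, Nat.reduceEqDiff,
        OfNat.zero_ne_ofNat, false_and, if_false, m0, mP, eval_two, eval_three, eval_four,
        and_self, if_true, hlenw, hlen]
      push_cast
      ring

end MSKC

namespace MSKC

variable {I : MSKC} {X b : ℕ} {Y Z R : ℤ}

/-- The encodings of pairs have varying lengths, so the position is described by the words that
remain to be read from there on. -/
theorem itemProg_spec (hP : Params I X b Y Z R) {σ : Store} {i : Fin I.n} {rest : List ℤ}
    (h0 : σ 0 = I.words) (hI : σ rI 0 = i) (hp : At I X (σ rP 0) (I.encodeItem i ++ rest))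
    (hinv : ReadInv I Z (i * I.m) σ) :
    Tr X b itemProg σ fun τ => ReadInv I Z ((i + 1) * I.m) τ ∧ At I X (τ rP 0) rest := by
  have hX4 := hP.X_lt
  have hV : At I X (σ rP 0) (encodeRat (I.v i)) := by
    unfold encodeItem at hp
    exact hp.left.left
  have hrest : At I X (σ rP 0 + 2) ((List.finRange I.m).flatMap (I.encodePair i) ++ rest) := by
    unfold encodeItem at hp
    rw [List.append_assoc] at hp
    exact hp.right
  have b1 := hp.nonneg
  have b2 := hrest.le
  refine .seq (.write ?_ (.seq (.write ?_ ?_)))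
  · simp only [eval_read, eval_const]
    rw [abs_of_nonneg b1]
    linarith
  · simp
    rw [abs_of_nonneg (by linarith)]
    linarith
  · refine Tr.for (fun j τ => ReadInv I Z (i * I.m + j) τ ∧
      At I X (τ rP 0) (((List.finRange I.m).drop j).flatMap (I.encodePair i) ++ rest))
      (N := I.m) (hP.m_le i) (by have : (I.m : ℤ) ≤ X := by exact_mod_cast hP.m_le i
                                 linarith)
      (by simp [pairProg, distProg, atomProg, storeProg, alphaProg, Program.for,
        Program.writes]) ?_ ?_ ?_ ?_
    · intro σ' hf
      have g0 := hf 0 (by simp [pairProg, distProg, atomProg, storeProg, alphaProg, Program.for,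
        Program.writes]) (by norm_num)
      simp [g0, h0, I.words_one]
    · intro σ' hf
      refine ⟨hinv.congr ?_ ?_ ?_ ?_ ?_ ?_, ?_⟩
      all_goals rw [hf _ (by norm_num)]
      all_goals simp
      exact hrest
    · intro j hj σ' hf hJ ⟨h1, h2⟩
      have fr : ∀ a, a ∉ pairProg.writes → a ≠ rJ → a ≠ rP → a ≠ rV → σ' a = σ a := by
        intro a ha1 ha2 ha3 ha4
        rw [hf a ha1 ha2, Store.set_of_ne ha3, Store.set_of_ne ha4]
      simp only [pairProg, distProg, atomProg, storeProg, alphaProg, Program.for, Program.writes,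
        List.cons_append, List.nil_append, List.mem_cons, List.not_mem_nil, or_false,
        not_or] at fr
      have g0 : σ' 0 = I.words := by rw [fr 0 (by norm_num) (by norm_num) (by norm_num)
        (by norm_num), h0]
      have gI : σ' rI 0 = i := by rw [fr rI (by norm_num) (by norm_num) (by norm_num)
        (by norm_num), hI]
      have gV : σ' rV 0 = σ rP 0 := by
        rw [hf rV (by simp [pairProg, distProg, atomProg, storeProg, alphaProg, Program.for,
          Program.writes]) (by norm_num)]
        simp
      rw [List.drop_finRange hj, List.flatMap_cons, List.append_assoc] at h2
      refine (pairProg_spec hP (j := ⟨j, hj⟩) (by simp [idx]) g0 gI hJ (gV ▸ hV) h2.left h1).mono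
        fun τ _ _ ⟨i1, i2⟩ τ' hτ' => ⟨i1.congr (hτ' _ (by norm_num)) (hτ' _ (by norm_num))
          (hτ' _ (by norm_num)) (hτ' _ (by norm_num)) (hτ' _ (by norm_num))
          (hτ' _ (by norm_num)), ?_⟩
      rw [hτ' rP (by norm_num), i2]
      exact h2.right
    · intro σ' _ ⟨h1, h2⟩
      rw [List.drop_of_length_le (by simp)] at h2
      rw [add_mul, one_mul]
      exact ⟨h1, h2⟩

theorem readProg_spec (hP : Params I X b Y Z R) :
    Tr X b readProg (initStore I.encode) (ReadInv I Z (I.n * I.m)) := by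
  have hX4 := hP.X_lt
  have hR := hP.R_lt'
  have hR1 := hP.one_le_R
  have hlen := hP.length_le
  rw [encode_eq, List.length_append] at hlen
  simp only [List.length_cons, List.length_nil] at hlen
  refine .seq (.write ?_ (.seq (.write ?_ (.seq (.write ?_ (.seq (.write ?_ ?_)))))))
  · simp; linarith
  · simp; linarith
  · simp; linarith
  · simp; linarith
  · refine Tr.for (fun i τ => ReadInv I Z (i * I.m) τ ∧
      At I X (τ rP 0) (((List.finRange I.n).drop i).flatMap I.encodeItem))
      (N := I.n) hP.n_le (by have : (I.n : ℤ) ≤ X := by exact_mod_cast hP.n_le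
                             linarith)
      (by simp [itemProg, pairProg, distProg, atomProg, storeProg, alphaProg, Program.for,
        Program.writes]) ?_ ?_ ?_ ?_
    · intro σ' hf
      have g0 := hf 0 (by simp [itemProg, pairProg, distProg, atomProg, storeProg, alphaProg,
        Program.for, Program.writes]) (by norm_num)
      simp only [eval_read, eval_zero, g0]
      simp only [Store.set_apply, OfNat.zero_ne_ofNat, false_and, if_false]
      exact I.words_zero
    · intro σ' hf
      have g1 := hf rQ (by norm_num)
      have g2 := hf rAN (by norm_num)
      have g3 := hf rAW (by norm_num)
      have g4 := hf rP (by norm_num)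
      refine ⟨⟨?_, ?_, ?_, ?_, ?_, ?_, ?_, ?_, ?_⟩, ?_⟩
      · intro i j h
        have := I.idx_nonneg i j
        simp at h
        omega
      · simp [g1]
      · simp [g1]
      · intro i j h
        have := I.idx_nonneg i j
        simp at h
        omega
      · simp [g3]
      · simp [g2, g3]
      · simpa [g2] using hP.one_le_Z
      · intro i j h
        have := I.idx_nonneg i j
        simp at h
        omega
      · simp [g2, g3]
      · simp only [g4, List.drop_zero]
        simp
        exact ⟨I.holds_words, by norm_num, by omega⟩
    · intro i hi σ' hf hI ⟨h1, h2⟩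
      have g0 : σ' 0 = I.words := by
        rw [hf 0 (by simp [itemProg, pairProg, distProg, atomProg, storeProg, alphaProg,
          Program.for, Program.writes]) (by norm_num)]
        simp [words]
      rw [List.drop_finRange hi, List.flatMap_cons] at h2
      refine (itemProg_spec hP (i := ⟨i, hi⟩) g0 hI h2 h1).mono
        fun τ _ _ ⟨i1, i2⟩ τ' hτ' => ⟨i1.congr (hτ' _ (by norm_num)) (hτ' _ (by norm_num))
          (hτ' _ (by norm_num)) (hτ' _ (by norm_num)) (hτ' _ (by norm_num))
          (hτ' _ (by norm_num)), ?_⟩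
      rw [hτ' rP (by norm_num)]
      exact i2
    · intro σ' _ ⟨h1, _⟩
      exact h1

/-! ### Passing to the common denominator. -/

/-- What holds after the pairs with an address below `c` have been scaled. -/
structure ScaleInv (I : MSKC) (R : ℤ) (c : ℕ) (σ : Store) : Prop where
  profit : ∀ i j, I.idx i j < c → (σ rW (I.idx i j) : ℚ) = σ rQ 0 * I.netProfit i j
  profit_le : ∀ i j, I.idx i j < c → |σ rW (I.idx i j)| ≤ R
  size : ∀ i j, I.idx i j < c → (σ rU (I.idx i j) : ℚ) = σ rQ 0 * I.truncMean i j
  size_le : ∀ i j, I.idx i j < c → |σ rU (I.idx i j)| ≤ R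
  best_nonneg : 0 ≤ σ rBest 0
  best_le : σ rBest 0 ≤ R
  le_best : ∀ i j, I.idx i j < c → σ rW (I.idx i j) ≤ σ rBest 0
  best_eq : σ rBest 0 = 0 ∨ ∃ i j, I.idx i j < c ∧ σ rBK 0 = I.idx i j ∧
    σ rW (I.idx i j) = σ rBest 0

theorem ScaleInv.congr {c : ℕ} {σ τ : Store} (h : ScaleInv I R c σ) (hW : τ rW = σ rW)
    (hU : τ rU = σ rU) (hQ : τ rQ = σ rQ) (hB : τ rBest = σ rBest) (hK : τ rBK = σ rBK) :
    ScaleInv I R c τ := by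
  obtain ⟨h1, h2, h3, h4, h5, h6, h7, h8⟩ := h
  constructor <;> simp only [hW, hU, hQ, hB, hK] <;> assumption

/-- Each stored denominator divides `Q`, so the integer quotient `q` is exact and scaling does not
change the fractions. The new numerators are at most `Z * Q`, hence at most `R`. -/
theorem scaleProg_spec (hP : Params I X b Y Z R) {σ : Store} (h0 : σ 0 = I.words)
    (hinv : ReadInv I Z (I.n * I.m) σ) (hB : σ rBest 0 = 0) :
    Tr X b scaleProg σ fun τ => ScaleInv I R (I.n * I.m) τ := by
  have hX4 := hP.X_lt
  have hR := hP.R_lt'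
  have hR1 := hP.one_le_R
  have hnm : ((I.n * I.m : ℕ) : ℤ) ≤ X := by exact_mod_cast hP.nm_le
  refine Tr.for (ScaleInv I R) (N := I.n * I.m) hP.nm_le (by linarith)
    (by simp [Program.writes]) ?_ ?_ ?_ ?_
  · intro σ' hf
    have g0 := hf 0 (by simp [Program.writes]) (by norm_num)
    simp [g0, h0, I.words_one, I.words_zero]
  · intro σ' hf
    have hneg : ∀ i j, ¬ I.idx i j < (0 : ℕ) := fun i j h => by
      have := I.idx_nonneg i j
      simp at h
      omega
    have g1 := hf rBest (by norm_num)
    refine ⟨fun i j h => absurd h (hneg i j), fun i j h => absurd h (hneg i j),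
      fun i j h => absurd h (hneg i j), fun i j h => absurd h (hneg i j), ?_, ?_,
      fun i j h => absurd h (hneg i j), ?_⟩
    · rw [g1, hB]
    · rw [g1, hB]
      linarith
    · rw [g1, hB]
      exact Or.inl rfl
  · intro k hk σ' hf hK inv
    obtain ⟨i, j, hij⟩ := exists_idx_eq hk
    have gWn : σ' rWn = σ rWn := hf _ (by simp [Program.writes]) (by norm_num)
    have gUn : σ' rUn = σ rUn := hf _ (by simp [Program.writes]) (by norm_num)
    have gDn : σ' rDn = σ rDn := hf _ (by simp [Program.writes]) (by norm_num)
    have gQ : σ' rQ = σ rQ := hf _ (by simp [Program.writes]) (by norm_num)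
    have hlt : I.idx i j < (I.n * I.m : ℕ) := by rw [hij]; exact_mod_cast hk
    have pr := hinv.pair i j hlt
    obtain ⟨q, hq⟩ := hinv.dvd i j hlt
    have hQ := hinv.Q_pos
    rw [hq] at hQ
    have hq0 : 0 < q := pos_of_mul_pos_right hQ pr.pos.le
    have hdiv : σ rQ 0 / σ rDn (I.idx i j) = q := by
      rw [hq, Int.mul_ediv_cancel_left _ pr.pos.ne']
    have hqQ : q ≤ σ rQ 0 := by rw [hq]; nlinarith [pr.pos]
    have hZ := hP.one_le_Z
    have qR : Z * q ≤ R :=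
      (mul_le_mul_of_nonneg_left (hqQ.trans hinv.Q_le) (by linarith)).trans hP.le_R
    have bd : ∀ x : ℤ, |x| ≤ Z → |x * q| ≤ R := fun x hx => by
      rw [abs_mul, abs_of_pos hq0]
      exact (mul_le_mul_of_nonneg_right hx hq0.le).trans qR
    have eW : ((σ rWn (I.idx i j) * q : ℤ) : ℚ) = σ rQ 0 * I.netProfit i j := by
      rw [hq]
      push_cast
      rw [pr.profit]
      ring
    have eU : ((σ rUn (I.idx i j) * q : ℤ) : ℚ) = σ rQ 0 * I.truncMean i j := by
      rw [hq]
      push_cast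
      rw [pr.size]
      ring
    have bW := bd _ pr.num_le
    have bU := bd _ pr.size_le
    have split : ∀ i' j', I.idx i' j' < (k + 1 : ℕ) →
        (I.idx i' j' < k ∧ I.idx i' j' ≠ I.idx i j) ∨ (i' = i ∧ j' = j) := by
      intro i' j' h
      push_cast at h
      rcases lt_or_eq_of_le (Int.lt_add_one_iff.mp h) with h | h
      · exact Or.inl ⟨h, by rw [hij]; exact h.ne⟩
      · exact Or.inr (idx_inj (h.trans hij.symm))
    rw [← hij] at hK
    set w := σ rWn (I.idx i j) * q with hw
    set u := σ rUn (I.idx i j) * q with hu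
    have lift : ∀ i' j', I.idx i' j' < k → I.idx i' j' < (k + 1 : ℕ) := fun i' j' h => by
      push_cast; linarith
    have hself : I.idx i j < (k + 1 : ℕ) := by rw [hij]; push_cast; linarith
    refine .seq (.write ?_ (.seq (.write ?_ (.ite (fun hc => ?_) fun hc => ?_))))
    · simp only [eval_mul, eval_div, eval_read, eval_const, hK, gWn, gQ, gDn, hdiv]
      linarith
    · simp only [eval_mul, eval_div, eval_read, eval_const, Store.set_apply, Nat.reduceEqDiff,
        false_and, if_false, hK, gUn, gQ, gDn, hdiv]
      linarith
    · have hc' : 0 < w - σ' rBest 0 := by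
        simpa [hK, gWn, gUn, gQ, gDn, hdiv] using hc
      have e1 : |w| = w := abs_of_pos (by linarith [inv.best_nonneg])
      refine .seq (.write ?_ (.write ?_ fun τ' hτ' => ?_))
      · simpa [hK, gWn, gUn, gQ, gDn, hdiv, ← hw] using by linarith
      · simp only [eval_read, eval_const, Store.set_apply, Nat.reduceEqDiff, false_and, if_false,
          hK]
        rw [hij, Nat.abs_cast]
        have : (k : ℤ) < (I.n * I.m : ℕ) := by exact_mod_cast hk
        linarith
      · refine ScaleInv.congr (σ := _) ?_ (hτ' _ (by norm_num)) (hτ' _ (by norm_num))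
          (hτ' _ (by norm_num)) (hτ' _ (by norm_num)) (hτ' _ (by norm_num))
        refine ⟨?_, ?_, ?_, ?_, ?_, ?_, ?_, ?_⟩
        · intro i' j' h
          rcases split i' j' h with ⟨h, hne⟩ | ⟨rfl, rfl⟩
          · simpa [hne, hK, gWn, gUn, gQ, gDn, hdiv] using inv.profit i' j' h
          · simpa [hK, gWn, gUn, gQ, gDn, hdiv, hw] using eW
        · intro i' j' h
          rcases split i' j' h with ⟨h, hne⟩ | ⟨rfl, rfl⟩
          · simpa [hne, hK, gWn, gUn, gQ, gDn, hdiv] using inv.profit_le i' j' h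
          · simpa [hK, gWn, gUn, gQ, gDn, hdiv, hw] using bW
        · intro i' j' h
          rcases split i' j' h with ⟨h, hne⟩ | ⟨rfl, rfl⟩
          · simpa [hne, hK, gWn, gUn, gQ, gDn, hdiv] using inv.size i' j' h
          · simpa [hK, gWn, gUn, gQ, gDn, hdiv, hu] using eU
        · intro i' j' h
          rcases split i' j' h with ⟨h, hne⟩ | ⟨rfl, rfl⟩
          · simpa [hne, hK, gWn, gUn, gQ, gDn, hdiv] using inv.size_le i' j' h
          · simpa [hK, gWn, gUn, gQ, gDn, hdiv, hu] using bU
        · simpa [hK, gWn, gUn, gQ, gDn, hdiv, ← hw] using by linarith [inv.best_nonneg]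
        · simpa [hK, gWn, gUn, gQ, gDn, hdiv, ← hw] using by linarith
        · intro i' j' h
          rcases split i' j' h with ⟨h, hne⟩ | ⟨rfl, rfl⟩
          · simpa [hne, hK, gWn, gUn, gQ, gDn, hdiv, ← hw] using by
              linarith [inv.le_best i' j' h]
          · simp [hK, gWn, gUn, gQ, gDn, hdiv]
        · refine Or.inr ⟨i, j, hself, ?_, ?_⟩ <;> simp [hK, gWn, gUn, gQ, gDn, hdiv]
    · have hc' : ¬ 0 < w - σ' rBest 0 := by
        simpa [hK, gWn, gUn, gQ, gDn, hdiv] using hc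
      refine .skip fun τ' hτ' => ?_
      · refine ScaleInv.congr (σ := _) ?_ (hτ' _ (by norm_num)) (hτ' _ (by norm_num))
          (hτ' _ (by norm_num)) (hτ' _ (by norm_num)) (hτ' _ (by norm_num))
        refine ⟨?_, ?_, ?_, ?_, ?_, ?_, ?_, ?_⟩
        · intro i' j' h
          rcases split i' j' h with ⟨h, hne⟩ | ⟨rfl, rfl⟩
          · simpa [hne, hK, gWn, gUn, gQ, gDn, hdiv] using inv.profit i' j' h
          · simpa [hK, gWn, gUn, gQ, gDn, hdiv, hw] using eW
        · intro i' j' h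
          rcases split i' j' h with ⟨h, hne⟩ | ⟨rfl, rfl⟩
          · simpa [hne, hK, gWn, gUn, gQ, gDn, hdiv] using inv.profit_le i' j' h
          · simpa [hK, gWn, gUn, gQ, gDn, hdiv, hw] using bW
        · intro i' j' h
          rcases split i' j' h with ⟨h, hne⟩ | ⟨rfl, rfl⟩
          · simpa [hne, hK, gWn, gUn, gQ, gDn, hdiv] using inv.size i' j' h
          · simpa [hK, gWn, gUn, gQ, gDn, hdiv, hu] using eU
        · intro i' j' h
          rcases split i' j' h with ⟨h, hne⟩ | ⟨rfl, rfl⟩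
          · simpa [hne, hK, gWn, gUn, gQ, gDn, hdiv] using inv.size_le i' j' h
          · simpa [hK, gWn, gUn, gQ, gDn, hdiv, hu] using bU
        · simpa using inv.best_nonneg
        · simpa using inv.best_le
        · intro i' j' h
          rcases split i' j' h with ⟨h, hne⟩ | ⟨rfl, rfl⟩
          · simpa [hne, hK, gWn, gUn, gQ, gDn, hdiv] using inv.le_best i' j' h
          · simpa [hK, gWn, gUn, gQ, gDn, hdiv] using hc'
        · rcases inv.best_eq with h | ⟨i', j', h, h1, h2⟩
          · exact Or.inl (by simpa using h)
          · have hne : I.idx i' j' ≠ I.idx i j := by rw [hij]; exact h.ne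
            refine Or.inr ⟨i', j', lift i' j' h, ?_, ?_⟩
            · simpa using h1
            · simpa [hK, hne] using h2
  · exact fun σ' _ h => h

end MSKC

/-! ### One greedy improvement: hull property, search and update. -/

namespace MSKC

variable {I : MSKC} {X b : ℕ} {Y Z R : ℤ} {A : ℚ} {sel : Fin I.n → Option (Fin I.m)}

/-- The number of pairs that are more profitable than the pair selected for their item. -/
def potential (I : MSKC) (sel : Fin I.n → Option (Fin I.m)) : ℕ :=
  (Finset.univ.filter fun x : Fin I.n × Fin I.m =>
    I.selProfit sel x.1 < I.netProfit x.1 x.2).card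

theorem potential_le : I.potential sel ≤ I.n * I.m := by
  refine (Finset.card_filter_le _ _).trans ?_
  simp

/-- The pair `(i, j)` has the largest ratio of gain and load among the improvements. -/
structure IsBestUpgrade (I : MSKC) (sel : Fin I.n → Option (Fin I.m)) (c : ℕ) (i : Fin I.n)
    (j : Fin I.m) : Prop where
  gain_pos : I.selProfit sel i < I.netProfit i j
  max : ∀ i' j', I.idx i' j' < c → I.selProfit sel i' < I.netProfit i' j' →
    (I.netProfit i' j' - I.selProfit sel i') * (I.truncMean i j - I.selSize sel i) ≤
      (I.netProfit i j - I.selProfit sel i) * (I.truncMean i' j' - I.selSize sel i')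

/-- Transitivity of `y / x ≤ b / a ≤ b' / a'`, cross-multiplied because `x` and `a'` may be 0. -/
theorem ratio_trans {a b a' b' x y : ℚ} (ha : 0 < a) (ha' : 0 ≤ a') (hx : 0 ≤ x)
    (h : a * y ≤ b * x) (h' : b * a' ≤ a * b') : a' * y ≤ b' * x := by
  refine le_of_mul_le_mul_left ?_ ha
  have h1 := mul_le_mul_of_nonneg_left h ha'
  have h2 := mul_le_mul_of_nonneg_right h' hx
  linarith

/-- At a multiplier `a / b`, possibly infinite, a more profitable choice that is also smaller would
beat the selected one. -/
theorem IsHull.load_nonneg {a b : ℚ} (h : I.IsHull sel a b) (ha : 0 < a) (hb : 0 ≤ b)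
    {i : Fin I.n} {j : Fin I.m} (hij : I.selProfit sel i < I.netProfit i j) :
    0 ≤ I.truncMean i j - I.selSize sel i := by
  have h1 := h.1 i j
  have h2 := mul_nonneg hb (sub_pos.mpr hij).le
  exact nonneg_of_mul_nonneg_right (h2.trans h1) ha

/-- The multiplier is lowered to the best improvement ratio. Improvements respect it by maximality.
A choice with no larger profit, or no choice at all, saves at most `b / a` of size per unit of lost
profit by the old hull property, and `b / a` is at most the new load per gain, as the best
improvement obeys the old multiplier too. -/
theorem IsBestUpgrade.isHull {i : Fin I.n} {j : Fin I.m} (h : IsBestUpgrade I sel (I.n * I.m) i j)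
    (hsel : ∀ i j, sel i = some j → 0 < I.netProfit i j)
    {a b : ℚ} (hh : I.IsHull sel a b) (ha : 0 < a) :
    I.IsHull sel (I.netProfit i j - I.selProfit sel i) (I.truncMean i j - I.selSize sel i) := by
  have h0 := hh.1 i j
  have ha' := (sub_pos.mpr h.gain_pos).le
  constructor
  · intro i' j'
    rcases lt_or_ge (I.selProfit sel i') (I.netProfit i' j') with h1 | h1
    · have := h.max i' j' (by exact_mod_cast idx_lt i' j') h1
      linarith
    · have h2 := hh.1 i' j'
      have := ratio_trans (x := I.selProfit sel i' - I.netProfit i' j')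
        (y := I.selSize sel i' - I.truncMean i' j') ha ha' (by linarith) (by linarith) h0
      linarith
  · intro i'
    refine ratio_trans ha ha' ?_ (hh.2 i') h0
    unfold selProfit
    cases hs : sel i' with
    | none => exact le_rfl
    | some j' => exact (hsel i' j' hs).le

theorem selProfit_update (i i' : Fin I.n) (j : Fin I.m) :
    I.selProfit (Function.update sel i (some j)) i' =
      if i' = i then I.netProfit i j else I.selProfit sel i' := by
  unfold selProfit Function.update
  by_cases h : i' = i
  · subst h; simp
  · simp [h]

theorem selSize_update (i i' : Fin I.n) (j : Fin I.m) :
    I.selSize (Function.update sel i (some j)) i' =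
      if i' = i then I.truncMean i j else I.selSize sel i' := by
  unfold selSize Function.update
  by_cases h : i' = i
  · subst h; simp
  · simp [h]

theorem sum_selSize_update (i : Fin I.n) (j : Fin I.m) :
    ∑ i', I.selSize (Function.update sel i (some j)) i' =
      ∑ i', I.selSize sel i' + (I.truncMean i j - I.selSize sel i) := by
  rw [← Finset.add_sum_erase _ _ (Finset.mem_univ i),
    ← Finset.add_sum_erase (a := i) _ (I.selSize sel) (Finset.mem_univ i), selSize_update,
    if_pos rfl, Finset.sum_congr rfl fun x hx => by
      rw [selSize_update, if_neg (Finset.ne_of_mem_erase hx)]]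
  ring

/-- At the multiplier `gain / load`, the old and the new choice have the same Lagrangian value. -/
theorem IsHull.update {i : Fin I.n} {j : Fin I.m}
    (h : I.IsHull sel (I.netProfit i j - I.selProfit sel i) (I.truncMean i j - I.selSize sel i)) :
    I.IsHull (Function.update sel i (some j)) (I.netProfit i j - I.selProfit sel i)
      (I.truncMean i j - I.selSize sel i) := by
  constructor
  · intro i' j'
    have := h.1 i' j'
    rw [selProfit_update, selSize_update]
    split_ifs with hi
    · subst hi
      linarith
    · exact this
  · intro i'
    have := h.2 i'
    rw [selProfit_update, selSize_update]
    split_ifs with hi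
    · subst hi
      linarith
    · exact this

/-- The selected profit of item `i` rises, so no pair enters the set of improvements, and the pair
just selected leaves it. -/
theorem potential_update {i : Fin I.n} {j : Fin I.m} (h : I.selProfit sel i < I.netProfit i j) :
    I.potential (Function.update sel i (some j)) < I.potential sel := by
  refine Finset.card_lt_card (Finset.ssubset_iff_of_subset ?_ |>.mpr ⟨(i, j), ?_, ?_⟩)
  · intro x hx
    simp only [Finset.mem_filter, Finset.mem_univ, true_and, selProfit_update] at hx ⊢
    split_ifs at hx with hi
    · rw [hi] at hx ⊢
      exact h.trans hx
    · exact hx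
  · simpa using h
  · simp [selProfit_update]

theorem potential_eq_zero (h : I.potential sel = 0) (i : Fin I.n) (j : Fin I.m) :
    I.netProfit i j ≤ I.selProfit sel i := by
  rw [potential, Finset.card_eq_zero, Finset.filter_eq_empty_iff] at h
  exact not_lt.mp (h (Finset.mem_univ (i, j)))

/-- What holds after the input has been read and scaled. -/
structure Env (I : MSKC) (R : ℤ) (A : ℚ) (σ : Store) : Prop where
  words : σ 0 = I.words
  scale : ScaleInv I R (I.n * I.m) σ
  Q_pos : 0 < σ rQ 0
  Q_le : σ rQ 0 ≤ R
  AW_pos : 0 < σ rAW 0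
  one_le : 1 ≤ A
  AN_eq : (σ rAN 0 : ℚ) = A * σ rAW 0

theorem Env.congr {σ τ : Store} (h : Env I R A σ) (h0 : τ 0 = σ 0) (hW : τ rW = σ rW)
    (hU : τ rU = σ rU) (hQ : τ rQ = σ rQ) (hB : τ rBest = σ rBest) (hK : τ rBK = σ rBK)
    (hAN : τ rAN = σ rAN) (hAW : τ rAW = σ rAW) : Env I R A τ := by
  obtain ⟨h1, h2, h3, h4, h5, h6, h7⟩ := h
  refine ⟨by rw [h0, h1], h2.congr hW hU hQ hB hK, ?_, ?_, ?_, h6, ?_⟩ <;>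
    simp only [hQ, hAN, hAW] <;> assumption

/-- The store holds the selection `sel`. -/
structure SelOK (I : MSKC) (R : ℤ) (A : ℚ) (sel : Fin I.n → Option (Fin I.m)) (σ : Store) :
    Prop where
  cw : ∀ i : Fin I.n, (σ rCw i : ℚ) = σ rQ 0 * I.selProfit sel i
  cw_le : ∀ i : Fin I.n, |σ rCw i| ≤ R
  cu : ∀ i : Fin I.n, (σ rCu i : ℚ) = σ rQ 0 * I.selSize sel i
  cu_le : ∀ i : Fin I.n, |σ rCu i| ≤ R
  ch : ∀ i : Fin I.n, σ rCh i = (sel i).elim 0 fun j => I.idx i j + 1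
  M : (σ rM 0 : ℚ) = σ rQ 0 * ∑ i, I.selSize sel i
  pos : ∀ i j, sel i = some j → 0 < I.netProfit i j
  fits : A * ∑ i, I.selSize sel i ≤ 1

theorem SelOK.congr {σ τ : Store} (h : SelOK I R A sel σ) (hQ : τ rQ = σ rQ)
    (hCw : τ rCw = σ rCw) (hCu : τ rCu = σ rCu) (hCh : τ rCh = σ rCh) (hM : τ rM = σ rM) :
    SelOK I R A sel τ := by
  obtain ⟨h1, h2, h3, h4, h5, h6, h7, h8⟩ := h
  constructor <;> (try simp only [hQ, hCw, hCu, hCh, hM]) <;> assumption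

/-- The result of the search among the pairs with an address below `c`. -/
def SearchInv (I : MSKC) (sel : Fin I.n → Option (Fin I.m)) (c : ℕ) (σ : Store) : Prop :=
  (σ rGa 0 = 0 ∧ σ rGb 0 = 1 ∧
    ∀ i j, I.idx i j < c → I.netProfit i j ≤ I.selProfit sel i) ∨
  ∃ i j, σ rGk 0 = I.idx i j ∧
    (σ rGa 0 : ℚ) = σ rQ 0 * (I.netProfit i j - I.selProfit sel i) ∧
    (σ rGb 0 : ℚ) = σ rQ 0 * (I.truncMean i j - I.selSize sel i) ∧
    IsBestUpgrade I sel c i j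

/-- Ratios are compared by cross multiplication. This is legitimate because the hull property makes
the loads of all improvements nonnegative; a load 0 counts as an infinite ratio. -/
theorem searchProg_spec (hP : Params I X b Y Z R) {σ : Store} (henv : Env I R A σ)
    (hsel : SelOK I R A sel σ) {a₀ b₀ : ℚ} (ha₀ : 0 < a₀) (hb₀ : 0 ≤ b₀)
    (hh : I.IsHull sel a₀ b₀) :
    Tr X b searchProg σ (SearchInv I sel (I.n * I.m)) := by
  have hX4 := hP.X_lt
  have hR := hP.R_lt'
  have hR1 := hP.one_le_R
  have hnm : ((I.n * I.m : ℕ) : ℤ) ≤ X := by exact_mod_cast hP.nm_le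
  have h0 := henv.words
  have wm := I.words_one
  -- The initial ratio `0 / 1` loses against every positive gain, and a gain of 0 signals afterwards
  -- that nothing was found.
  refine .seq (.write (by simp) (.seq (.write (by simpa using by linarith) ?_)))
  refine Tr.for (SearchInv I sel) (N := I.n * I.m) hP.nm_le (by linarith)
    (by simp [Program.writes]) ?_ ?_ ?_ (fun _ _ h => h)
  · intro σ' hf
    have g0 := hf 0 (by simp [Program.writes]) (by norm_num)
    simp only [eval_mul, eval_read, eval_zero, eval_one, g0]
    simp [h0, I.words_one, I.words_zero]
  · intro σ' hf
    have g1 := hf rGa (by norm_num)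
    have g2 := hf rGb (by norm_num)
    refine Or.inl ⟨by simp [g1], by simp [g2], fun i j h => ?_⟩
    have := I.idx_nonneg i j
    simp at h
    omega
  · intro k hk σ' hf hK inv
    obtain ⟨i, j, hij⟩ := exists_idx_eq hk
    have fr : ∀ a, a ∉ [rGa, rGb, rGk, rK] → σ' a = σ a := by
      intro a ha
      simp only [List.mem_cons, List.not_mem_nil, or_false, not_or] at ha
      rw [hf a (by simp [Program.writes, ha]) ha.2.2.2, Store.set_of_ne ha.2.1,
        Store.set_of_ne ha.1]
    have g0 : σ' 0 = I.words := by rw [fr 0 (by norm_num), h0]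
    have gQ : σ' rQ = σ rQ := fr _ (by norm_num)
    have gW : σ' rW = σ rW := fr _ (by norm_num)
    have gU : σ' rU = σ rU := fr _ (by norm_num)
    have gCw : σ' rCw = σ rCw := fr _ (by norm_num)
    have gCu : σ' rCu = σ rCu := fr _ (by norm_num)
    rw [← hij] at hK
    have hdiv := idx_div i j
    have hlt : I.idx i j < (I.n * I.m : ℕ) := by rw [hij]; exact_mod_cast hk
    have hQ : (0 : ℚ) < σ rQ 0 := by exact_mod_cast henv.Q_pos
    have split : ∀ i' j', I.idx i' j' < (k + 1 : ℕ) → I.idx i' j' < k ∨ (i' = i ∧ j' = j) := by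
      intro i' j' h
      push_cast at h
      rcases lt_or_eq_of_le (Int.lt_add_one_iff.mp h) with h | h
      · exact Or.inl h
      · exact Or.inr (idx_inj (h.trans hij.symm))
    set g := σ rW (I.idx i j) - σ rCw i with hg
    set l := σ rU (I.idx i j) - σ rCu i with hl
    have eg : ∀ τ : Store, τ 0 = I.words → τ rK 0 = I.idx i j → τ rW = σ rW → τ rCw = σ rCw →
        gain.eval τ = g := fun τ t0 tK tW tC => by
      simp [t0, tK, tW, tC, wm, hdiv, hg]
    have el : ∀ τ : Store, τ 0 = I.words → τ rK 0 = I.idx i j → τ rU = σ rU → τ rCu = σ rCu →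
        load.eval τ = l := fun τ t0 tK tW tC => by
      simp [t0, tK, tW, tC, wm, hdiv, hl]
    have qg : (g : ℚ) = σ rQ 0 * (I.netProfit i j - I.selProfit sel i) := by
      rw [hg, mul_sub, ← hsel.cw i, ← henv.scale.profit i j hlt]
      push_cast
      rfl
    have ql : (l : ℚ) = σ rQ 0 * (I.truncMean i j - I.selSize sel i) := by
      rw [hl, mul_sub, ← hsel.cu i, ← henv.scale.size i j hlt]
      push_cast
      rfl
    have gpos : 0 < g ↔ I.selProfit sel i < I.netProfit i j := by
      rw [← Int.cast_pos (R := ℚ), qg, mul_pos_iff_of_pos_left hQ, sub_pos]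
    have bg : |g| ≤ 2 * R := by
      refine (abs_sub _ _).trans ?_
      linarith [henv.scale.profit_le i j hlt, hsel.cw_le i]
    have bl : |l| ≤ 2 * R := by
      refine (abs_sub _ _).trans ?_
      linarith [henv.scale.size_le i j hlt, hsel.cu_le i]
    have final : ∀ τ : Store, SearchInv I sel (k + 1) τ →
        ∀ τ' : Store, (∀ a ≠ rK, τ' a = τ a) → SearchInv I sel (k + 1) τ' := by
      intro τ h τ' hτ'
      unfold SearchInv at h ⊢
      rw [hτ' rGa (by norm_num), hτ' rGb (by norm_num), hτ' rGk (by norm_num),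
        hτ' rQ (by norm_num)]
      exact h
    refine .ite (fun hc => .ite (fun hc2 => ?_) fun hc2 => ?_) fun hc => ?_
    · rw [eg _ g0 hK gW gCw] at hc
      have hc2' : 0 < g * σ' rGb 0 - σ' rGa 0 * l := by
        rw [← eg _ g0 hK gW gCw, ← el _ g0 hK gU gCu]
        exact hc2
      have hsel1 := gpos.mp hc
      refine .seq (.write ?_ (.seq (.write ?_ (.write ?_ (final _ ?_)))))
      · rw [eg _ g0 hK gW gCw]
        linarith
      · rw [el _ (by simp [g0]) (by simp [hK]) (by simp [gU]) (by simp [gCu])]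
        linarith
      · simp [hK, abs_of_nonneg (idx_nonneg i j)]
        push_cast at hlt hnm
        linarith
      · rw [eg _ g0 hK gW gCw, el _ (by simp [g0]) (by simp [hK]) (by simp [gU]) (by simp [gCu])]
        refine Or.inr ⟨i, j, by simp [hK], by simpa [gQ] using qg, by simpa [gQ] using ql,
          hsel1, ?_⟩
        intro i' j' h hpos
        rcases split i' j' h with h | ⟨rfl, rfl⟩
        · rcases inv with ⟨_, _, h3⟩ | ⟨i₁, j₁, h1, h2, h3, h4⟩
          · exact absurd hpos (not_lt.mpr (h3 i' j' h))
          · have h5 := h4.max i' j' h hpos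
            have hc3 : (0 : ℚ) < g * σ' rGb 0 - σ' rGa 0 * l := by exact_mod_cast hc2'
            rw [h2, h3, gQ, qg, ql] at hc3
            set Q : ℚ := (σ rQ 0 : ℚ)
            have hl1 := hh.load_nonneg ha₀ hb₀ hpos
            have hb1 := hh.load_nonneg ha₀ hb₀ h4.gain_pos
            have hl0 := hh.load_nonneg ha₀ hb₀ hsel1
            set dw := I.netProfit i' j' - I.selProfit sel i'
            set du := I.truncMean i' j' - I.selSize sel i'
            set a1 := I.netProfit i₁ j₁ - I.selProfit sel i₁ with ha1
            set b1 := I.truncMean i₁ j₁ - I.selSize sel i₁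
            set a2 := I.netProfit i j - I.selProfit sel i with ha2
            set b2 := I.truncMean i j - I.selSize sel i
            have hc4 : a1 * b2 < a2 * b1 := by
              have : 0 < Q * Q * (a2 * b1 - a1 * b2) := by linarith
              have := pos_of_mul_pos_right this (mul_pos hQ hQ).le
              linarith
            have ha1p : 0 < a1 := sub_pos.mpr h4.gain_pos
            have ha2p : 0 < a2 := sub_pos.mpr hsel1
            -- A stored load 0 is never replaced, as the strict comparison fails against it.
            have hb1p : 0 < b1 := by
              refine lt_of_le_of_ne hb1 fun h => ?_
              rw [← h, mul_zero] at hc4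
              exact absurd hc4 (not_lt.mpr (mul_nonneg ha1p.le hl0))
            refine le_of_mul_le_mul_left ?_ hb1p
            have h6 := mul_le_mul_of_nonneg_right h5 hl0
            have h7 := mul_le_mul_of_nonneg_right hc4.le hl1
            linarith
        · exact le_of_eq (by ring)
    · rw [eg _ g0 hK gW gCw] at hc
      have hc2' : ¬ 0 < g * σ' rGb 0 - σ' rGa 0 * l := by
        rw [← eg _ g0 hK gW gCw, ← el _ g0 hK gU gCu]
        exact hc2
      refine .skip (final _ ?_)
      rcases inv with ⟨h1, h2, _⟩ | ⟨i₁, j₁, h1, h2, h3, h4⟩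
      · rw [h1, h2] at hc2'
        omega
      · refine Or.inr ⟨i₁, j₁, h1, h2, h3, h4.gain_pos, fun i' j' h hpos => ?_⟩
        rcases split i' j' h with h | ⟨rfl, rfl⟩
        · exact h4.max i' j' h hpos
        · have hc3 : (g : ℚ) * σ' rGb 0 ≤ σ' rGa 0 * l := by
            have : g * σ' rGb 0 ≤ σ' rGa 0 * l := by linarith
            exact_mod_cast this
          rw [h2, h3, gQ, qg, ql] at hc3
          refine le_of_mul_le_mul_left ?_ (mul_pos hQ hQ)
          linarith
    · rw [eg _ g0 hK gW gCw, gpos, not_lt] at hc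
      refine .skip (final _ ?_)
      rcases inv with ⟨h1, h2, h3⟩ | ⟨i₁, j₁, h1, h2, h3, h4⟩
      · refine Or.inl ⟨h1, h2, fun i' j' h => ?_⟩
        rcases split i' j' h with h | ⟨rfl, rfl⟩
        · exact h3 i' j' h
        · exact hc
      · refine Or.inr ⟨i₁, j₁, h1, h2, h3, h4.gain_pos, fun i' j' h hpos => ?_⟩
        rcases split i' j' h with h | ⟨rfl, rfl⟩
        · exact h4.max i' j' h hpos
        · exact absurd hpos (not_lt.mpr hc)

/-- Either nothing can be improved, or the best improvement does not fit. -/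
def IsStuck (I : MSKC) (A : ℚ) (sel : Fin I.n → Option (Fin I.m)) : Prop :=
  (∀ i j, I.netProfit i j ≤ I.selProfit sel i) ∨
    ∃ i j, I.selProfit sel i < I.netProfit i j ∧
      I.IsHull sel (I.netProfit i j - I.selProfit sel i) (I.truncMean i j - I.selSize sel i) ∧
      1 < A * (∑ i, I.selSize sel i + (I.truncMean i j - I.selSize sel i))

/-- The invariant of the greedy algorithm. -/
def GreedyInv (I : MSKC) (R : ℤ) (A : ℚ) (r : ℕ) (σ : Store) : Prop :=
  ∃ sel, SelOK I R A sel σ ∧ ((σ rStop 0 = 1 ∧ IsStuck I A sel) ∨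
    (σ rStop 0 = 0 ∧ (∃ a b : ℚ, 0 < a ∧ 0 ≤ b ∧ I.IsHull sel a b) ∧
      I.potential sel + r ≤ I.n * I.m))

theorem GreedyInv.congr {r : ℕ} {σ τ : Store} (h : GreedyInv I R A r σ) (hQ : τ rQ = σ rQ)
    (hCw : τ rCw = σ rCw) (hCu : τ rCu = σ rCu) (hCh : τ rCh = σ rCh) (hM : τ rM = σ rM)
    (hS : τ rStop = σ rStop) : GreedyInv I R A r τ := by
  obtain ⟨sel, h1, h2⟩ := h
  exact ⟨sel, h1.congr hQ hCw hCu hCh hM, by rwa [hS]⟩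

/-- If nothing was found, the potential is 0. If the improvement fits, the potential drops and the
hull property holds at its ratio. If it does not fit, it is the witness that the selection is stuck.
-/
theorem upgradeProg_spec (hP : Params I X b Y Z R) {σ : Store} (henv : Env I R A σ)
    (hsel : SelOK I R A sel σ) {a₀ b₀ : ℚ} (ha₀ : 0 < a₀) (hb₀ : 0 ≤ b₀)
    (hh : I.IsHull sel a₀ b₀) (hs : SearchInv I sel (I.n * I.m) σ) (hst : σ rStop 0 = 0) {r : ℕ}
    (hr : r < I.n * I.m) (hpot : I.potential sel + r ≤ I.n * I.m) :
    Tr X b upgradeProg σ (GreedyInv I R A (r + 1)) := by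
  have hX4 := hP.X_lt
  have hR := hP.R_lt'
  have hR1 := hP.one_le_R
  have h0 := henv.words
  have wm := I.words_one
  have hQ : (0 : ℚ) < σ rQ 0 := by exact_mod_cast henv.Q_pos
  have hAW : (0 : ℚ) < σ rAW 0 := by exact_mod_cast henv.AW_pos
  have hnm : ((I.n * I.m : ℕ) : ℤ) ≤ X := by exact_mod_cast hP.nm_le
  rcases hs with ⟨h1, h2, h3⟩ | ⟨i, j, h1, h2, h3, h4⟩
  · refine .ite (fun hc => ?_) fun _ => .skip ?_
    · simp [h1] at hc
    · refine ⟨sel, hsel, Or.inr ⟨hst, ⟨a₀, b₀, ha₀, hb₀, hh⟩, ?_⟩⟩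
      have : I.potential sel = 0 := by
        rw [potential, Finset.card_eq_zero, Finset.filter_eq_empty_iff]
        intro x _
        exact not_lt.mpr (h3 x.1 x.2 (by exact_mod_cast idx_lt x.1 x.2))
      omega
  · have hull := h4.isHull hsel.pos hh ha₀
    have hload := hh.load_nonneg ha₀ hb₀ h4.gain_pos
    have hgain := sub_pos.mpr h4.gain_pos
    have hGa : 0 < σ rGa 0 := by
      have : (0 : ℚ) < σ rGa 0 := h2 ▸ mul_pos hQ hgain
      exact_mod_cast this
    have hM0 : 0 ≤ ∑ i, I.selSize sel i := Finset.sum_nonneg fun i _ => selSize_nonneg i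
    have hMG : ((σ rM 0 + σ rGb 0 : ℤ) : ℚ) =
        σ rQ 0 * (∑ i, I.selSize sel i + (I.truncMean i j - I.selSize sel i)) := by
      push_cast
      rw [hsel.M, h3]
      ring
    have hlt : I.idx i j < (I.n * I.m : ℕ) := by exact_mod_cast idx_lt i j
    -- Both sides of the capacity test are multiplied by `Q * AW` to make them integers.
    have htest : (σ rM 0 + σ rGb 0) * σ rAN 0 ≤ σ rQ 0 * σ rAW 0 ↔
        A * (∑ i, I.selSize sel i + (I.truncMean i j - I.selSize sel i)) ≤ 1 := by
      rw [← Int.cast_le (R := ℚ), Int.cast_mul, hMG, henv.AN_eq, Int.cast_mul]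
      set s := ∑ i, I.selSize sel i + (I.truncMean i j - I.selSize sel i)
      have e : (σ rQ 0 : ℚ) * s * (A * σ rAW 0) = σ rQ 0 * σ rAW 0 * (A * s) := by ring
      have e' : (σ rQ 0 : ℚ) * σ rAW 0 = σ rQ 0 * σ rAW 0 * 1 := by ring
      rw [e]
      conv_lhs => rhs; rw [e']
      exact mul_le_mul_iff_right₀ (mul_pos hQ hAW)
    have hdiv := idx_div i j
    refine .ite (fun _ => .ite (fun hc => ?_) fun hc => ?_) fun hc => ?_
    · have hfit : A * (∑ i, I.selSize sel i + (I.truncMean i j - I.selSize sel i)) ≤ 1 := by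
        rw [← htest]
        simp at hc
        linarith
      have hMG0 : 0 ≤ σ rM 0 + σ rGb 0 := by
        have : (0 : ℚ) ≤ ((σ rM 0 + σ rGb 0 : ℤ) : ℚ) := by
          rw [hMG]
          exact mul_nonneg hQ.le (by linarith)
        exact_mod_cast this
      -- Since `A ≥ 1`, a total size that fits is at most 1, so its numerator stays below `Q`.
      have hMGQ : σ rM 0 + σ rGb 0 ≤ σ rQ 0 := by
        have : ((σ rM 0 + σ rGb 0 : ℤ) : ℚ) ≤ σ rQ 0 := by
          rw [hMG]
          refine mul_le_of_le_one_right hQ.le ?_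
          nlinarith [henv.one_le]
        exact_mod_cast this
      have bW := henv.scale.profit_le i j hlt
      have bU := henv.scale.size_le i j hlt
      have key : ∀ i' : Fin I.n, (i' : ℤ) = i ↔ i' = i := fun i' => by
        rw [Fin.ext_iff]
        exact_mod_cast Iff.rfl
      refine .seq (.write ?_ (.seq (.write ?_ (.seq (.write ?_ (.write ?_
        ⟨Function.update sel i (some j), ⟨?_, ?_, ?_, ?_, ?_, ?_, ?_, ?_⟩,
          Or.inr ⟨?_, ⟨_, _, hgain, hload, hull.update⟩, ?_⟩⟩))))))
      · simp only [eval_add, eval_read, eval_const]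
        rw [abs_of_nonneg hMG0]
        linarith [henv.Q_le]
      · simp [h1]
        rw [abs_of_nonneg (by linarith [idx_nonneg i j])]
        linarith
      · simpa [h1] using by linarith
      · simpa [h1] using by linarith
      · intro i'
        by_cases hi : i' = i
        · subst hi
          simpa [h0, h1, wm, hdiv, selProfit_update] using henv.scale.profit i' j hlt
        · simpa [h0, h1, wm, hdiv, selProfit_update, key, hi] using hsel.cw i'
      · intro i'
        by_cases hi : i' = i
        · subst hi
          simpa [h0, h1, wm, hdiv] using bW
        · simpa [h0, h1, wm, hdiv, key, hi] using hsel.cw_le i'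
      · intro i'
        by_cases hi : i' = i
        · subst hi
          simpa [h0, h1, wm, hdiv, selSize_update] using henv.scale.size i' j hlt
        · simpa [h0, h1, wm, hdiv, selSize_update, key, hi] using hsel.cu i'
      · intro i'
        by_cases hi : i' = i
        · subst hi
          simpa [h0, h1, wm, hdiv] using bU
        · simpa [h0, h1, wm, hdiv, key, hi] using hsel.cu_le i'
      · intro i'
        by_cases hi : i' = i
        · subst hi
          simp [h0, h1, wm, hdiv]
        · simpa [h0, h1, wm, hdiv, key, hi] using hsel.ch i'
      · rw [sum_selSize_update]
        simpa using hMG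
      · intro i' j' h
        by_cases hi : i' = i
        · subst hi
          simp at h
          subst h
          linarith [(show 0 ≤ I.selProfit sel i' by
            unfold selProfit
            cases hs : sel i' with
            | none => exact le_rfl
            | some j' => exact (hsel.pos i' j' hs).le), h4.gain_pos]
        · rw [Function.update_of_ne hi] at h
          exact hsel.pos i' j' h
      · rw [sum_selSize_update]
        exact hfit
      · simpa using hst
      · have := potential_update (sel := sel) h4.gain_pos
        omega
    · have hfit : 1 < A * (∑ i, I.selSize sel i + (I.truncMean i j - I.selSize sel i)) := by
        rw [← not_le, ← htest]
        simp at hc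
        linarith
      refine .write (by simpa using by linarith) ⟨sel, hsel.congr ?_ ?_ ?_ ?_ ?_, Or.inl ⟨?_, Or.inr
        ⟨i, j, h4.gain_pos, hull, hfit⟩⟩⟩
      all_goals simp
    · simp at hc
      omega

end MSKC

/-! ### The greedy loop and the sums over its result. -/

namespace MSKC

variable {I : MSKC} {X b : ℕ} {Y Z R : ℤ} {A : ℚ} {sel : Fin I.n → Option (Fin I.m)}

/-- Unless the algorithm has stopped, the potential plus the number of rounds is at most `n * m`.
After `n * m` rounds the potential is 0, and nothing can be improved. -/
theorem greedyProg_spec (hP : Params I X b Y Z R) {σ : Store} (henv : Env I R A σ)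
    (hCw : ∀ k, σ rCw k = 0) (hCu : ∀ k, σ rCu k = 0) (hCh : ∀ k, σ rCh k = 0)
    (hM : σ rM 0 = 0) (hS : σ rStop 0 = 0) :
    Tr X b greedyProg σ fun τ => ∃ sel, SelOK I R A sel τ ∧ I.IsGreedyEnd A sel := by
  have hX4 := hP.X_lt
  have hR1 := hP.one_le_R
  have hnm : ((I.n * I.m : ℕ) : ℤ) ≤ X := by exact_mod_cast hP.nm_le
  have h0 := henv.words
  have wr : ∀ a, a ∉ [rGa, rGb, rGk, rK, rM, rCh, rCw, rCu, rStop] →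
      a ∉ (Program.ite (1 - Expr.var rStop) (.seq searchProg upgradeProg) .skip).writes := by
    intro a ha
    simp only [List.mem_cons, List.not_mem_nil, or_false, not_or] at ha
    simp [Program.writes, searchProg, upgradeProg, Program.for, ha]
  have frame : ∀ σ' : Store, (∀ a ∉ (Program.ite (1 - Expr.var rStop)
      (.seq searchProg upgradeProg) .skip).writes, a ≠ rR → σ' a = σ a) → Env I R A σ' := by
    intro σ' hf
    refine henv.congr ?_ ?_ ?_ ?_ ?_ ?_ ?_ ?_
    all_goals exact hf _ (wr _ (by norm_num)) (by norm_num)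
  refine Tr.for (GreedyInv I R A) (N := I.n * I.m) hP.nm_le (by linarith)
    (wr _ (by norm_num)) ?_ ?_ ?_ ?_
  · intro σ' hf
    have g0 := hf 0 (wr _ (by norm_num)) (by norm_num)
    simp [g0, h0, I.words_one, I.words_zero]
  · intro σ' hf
    have gCw := hf rCw (by norm_num)
    have gCu := hf rCu (by norm_num)
    have gCh := hf rCh (by norm_num)
    have gM := hf rM (by norm_num)
    have gS := hf rStop (by norm_num)
    -- The empty selection is optimal at the infinite multiplier `1 / 0`, because sizes are
    -- nonnegative.
    refine ⟨fun _ => none, ⟨?_, ?_, ?_, ?_, ?_, ?_, ?_, ?_⟩, Or.inr ⟨by rw [gS, hS],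
      ⟨1, 0, one_pos, le_rfl, ?_, ?_⟩, by simpa using potential_le⟩⟩
    · simp [gCw, hCw, selProfit]
    · simpa [gCw, hCw] using fun _ => (by linarith : 0 ≤ R)
    · simp [gCu, hCu, selSize]
    · simpa [gCu, hCu] using fun _ => (by linarith : 0 ≤ R)
    · simp [gCh, hCh]
    · simp [gM, hM, selSize]
    · simp
    · simp [selSize]
    · intro i j
      simpa [selSize] using I.truncMean_nonneg i j
    · simp [selSize]
  · intro k hk σ' hf hK inv
    have henv' := frame σ' hf
    have final : ∀ τ : Store, GreedyInv I R A (k + 1) τ →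
        ∀ τ' : Store, (∀ a ≠ rR, τ' a = τ a) → GreedyInv I R A (k + 1) τ' := fun τ h τ' hτ' =>
      h.congr (hτ' _ (by norm_num)) (hτ' _ (by norm_num)) (hτ' _ (by norm_num))
        (hτ' _ (by norm_num)) (hτ' _ (by norm_num)) (hτ' _ (by norm_num))
    obtain ⟨sel, h1, ⟨h2, h3⟩ | ⟨h2, ⟨a, b', ha, hb, hh⟩, h3⟩⟩ := inv
    · refine .ite (fun hc => ?_) fun _ => .skip (final _ ⟨sel, h1, Or.inl ⟨h2, h3⟩⟩)
      simp [h2] at hc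
    · refine .ite (fun _ => ?_) fun hc => ?_
      · refine .seq ((searchProg_spec hP henv' h1 ha hb hh).mono fun τ _ g1 hs => ?_)
        have fr : ∀ a, a ∉ [rGa, rGb, rGk, rK] → τ a = σ' a := by
          intro a ha
          simp only [List.mem_cons, List.not_mem_nil, or_false, not_or] at ha
          exact g1 a (by simp [searchProg, Program.for, Program.writes, ha])
        have henv2 : Env I R A τ := henv'.congr (fr _ (by norm_num)) (fr _ (by norm_num))
          (fr _ (by norm_num)) (fr _ (by norm_num)) (fr _ (by norm_num)) (fr _ (by norm_num))
          (fr _ (by norm_num)) (fr _ (by norm_num))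
        have hsel2 : SelOK I R A sel τ := h1.congr (fr _ (by norm_num)) (fr _ (by norm_num))
          (fr _ (by norm_num)) (fr _ (by norm_num)) (fr _ (by norm_num))
        exact (upgradeProg_spec hP henv2 hsel2 ha hb hh hs (by rw [fr _ (by norm_num), h2]) hk
          h3).mono fun τ' _ _ h => final τ' h
      · simp [h2] at hc
  · rintro σ' _ ⟨sel, h1, h2⟩
    refine ⟨sel, h1, h1.pos, h1.fits, ?_⟩
    rcases h2 with ⟨_, h2⟩ | ⟨_, _, h3⟩
    · exact h2
    · exact Or.inl (potential_eq_zero (by omega))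

/-- Appending an item adds the earlier sizes times its profit to the cross sum. Hence the prefix sum
of the sizes is updated only after the cross sum. -/
theorem sumProg_spec (hP : Params I X b Y Z R) {σ : Store} (h0 : σ 0 = I.words)
    (hsel : SelOK I R A sel σ) (hC : σ rCross 0 = 0) (hD : σ rDiag 0 = 0) (hW : σ rWT 0 = 0)
    (hM : σ rPm 0 = 0) :
    Tr X b sumProg σ fun τ =>
      (τ rCross 0 : ℚ) = (σ rQ 0 : ℚ) * σ rQ 0 *
        (List.finRange I.n).crossSum (I.selSize sel) (I.selProfit sel) ∧
      (τ rDiag 0 : ℚ) = (σ rQ 0 : ℚ) * σ rQ 0 *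
        ((List.finRange I.n).map fun i => I.selProfit sel i * I.selSize sel i).sum ∧
      (τ rWT 0 : ℚ) = σ rQ 0 * ((List.finRange I.n).map (I.selProfit sel)).sum ∧
      (τ rPm 0 : ℚ) = σ rQ 0 * ((List.finRange I.n).map (I.selSize sel)).sum := by
  have hX4 := hP.X_lt
  have hR1 := hP.one_le_R
  have hn : (I.n : ℤ) ≤ X := by exact_mod_cast hP.n_le
  have b1 := hP.four_mul_R_lt
  have b2 := hP.X_sq_mul_lt
  set o := List.finRange I.n with ho
  refine Tr.for (fun k τ =>
      ((τ rCross 0 : ℚ) = (σ rQ 0 : ℚ) * σ rQ 0 *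
        (o.take k).crossSum (I.selSize sel) (I.selProfit sel) ∧
      (τ rDiag 0 : ℚ) = (σ rQ 0 : ℚ) * σ rQ 0 *
        ((o.take k).map fun i => I.selProfit sel i * I.selSize sel i).sum ∧
      (τ rWT 0 : ℚ) = σ rQ 0 * ((o.take k).map (I.selProfit sel)).sum ∧
      (τ rPm 0 : ℚ) = σ rQ 0 * ((o.take k).map (I.selSize sel)).sum) ∧
      |τ rCross 0| ≤ k * (X * R * R) ∧ |τ rDiag 0| ≤ k * (R * R) ∧ |τ rWT 0| ≤ k * R ∧
      |τ rPm 0| ≤ k * R)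
    (N := I.n) hP.n_le (by linarith) (by simp [Program.writes]) ?_ ?_ ?_ ?_
  · intro σ' hf
    have g0 := hf 0 (by simp [Program.writes]) (by norm_num)
    simp [g0, h0, I.words_zero]
  · intro σ' hf
    simp [hf rCross, hf rDiag, hf rWT, hf rPm, hC, hD, hW, hM, List.crossSum]
  · rintro k hk σ' hf hK ⟨⟨i1, i2, i3, i4⟩, j1, j2, j3, j4⟩
    have gCw : σ' rCw = σ rCw := hf _ (by simp [Program.writes]) (by norm_num)
    have gCu : σ' rCu = σ rCu := hf _ (by simp [Program.writes]) (by norm_num)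
    have cw := hsel.cw ⟨k, hk⟩
    have cu := hsel.cu ⟨k, hk⟩
    have cwb := hsel.cw_le ⟨k, hk⟩
    have cub := hsel.cu_le ⟨k, hk⟩
    simp only at cw cu cwb cub
    have tk : o.take (k + 1) = o.take k ++ [⟨k, hk⟩] := List.take_succ_finRange hk
    have kX : ((k + 1 : ℕ) : ℤ) ≤ X := by
      have : ((k + 1 : ℕ) : ℤ) ≤ I.n := by exact_mod_cast hk
      linarith
    push_cast at kX
    have k0 : (0 : ℤ) ≤ k := by positivity
    have RR : 1 ≤ R * R := by nlinarith
    have c4 : |σ' rPm 0 + σ rCu k| ≤ (k + 1 : ℤ) * R := (abs_add_le _ _).trans (by linarith)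
    have c3 : |σ' rWT 0 + σ rCw k| ≤ (k + 1 : ℤ) * R := (abs_add_le _ _).trans (by linarith)
    have c2 : |σ' rDiag 0 + σ rCw k * σ rCu k| ≤ (k + 1 : ℤ) * (R * R) := by
      refine (abs_add_le _ _).trans ?_
      rw [abs_mul]
      have := mul_le_mul cwb cub (abs_nonneg _) (by linarith)
      linarith
    have c1 : |σ' rCross 0 + σ' rPm 0 * σ rCw k| ≤ (k + 1 : ℤ) * (X * R * R) := by
      refine (abs_add_le _ _).trans ?_
      rw [abs_mul]
      have h1 : |σ' rPm 0| ≤ X * R := j4.trans (mul_le_mul_of_nonneg_right (by linarith)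
        (by linarith))
      have := mul_le_mul h1 cwb (abs_nonneg _) (by nlinarith)
      linarith
    have d1 : (k + 1 : ℤ) * R ≤ X * R := mul_le_mul_of_nonneg_right kX (by linarith)
    have XR : 1 ≤ (X : ℤ) * R := by nlinarith
    have d2 : (k + 1 : ℤ) * (R * R) ≤ X * R * (X * R) := by nlinarith
    have d3 : (k + 1 : ℤ) * (X * R * R) ≤ X * R * (X * R) := by nlinarith
    refine .seq (.write ?_ (.seq (.write ?_ (.seq (.write ?_ (.write ?_ fun τ' hτ' => ?_))))))
    · simp only [eval_add, eval_mul, eval_read, eval_const, hK, gCw]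
      linarith
    · simp [hK, gCw, gCu]
      linarith
    · simp [hK, gCw, gCu]
      linarith
    · simp [hK, gCw, gCu]
      linarith
    · rw [hτ' rCross (by norm_num), hτ' rDiag (by norm_num), hτ' rWT (by norm_num),
        hτ' rPm (by norm_num), tk]
      simp only [List.crossSum_append, List.map_append, List.sum_append, List.map_cons,
        List.map_nil, List.sum_singleton, List.crossSum, List.sum_nil, mul_zero, add_zero,
        eval_add, eval_mul, eval_read, eval_const, Store.set_apply, Nat.reduceEqDiff, false_and,
        if_false, and_self, if_true, hK, gCw, gCu, Int.cast_add, Int.cast_mul, i1, i2, i3, i4,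
        cw, cu, Nat.cast_add, Nat.cast_one]
      refine ⟨⟨by ring, by ring, by ring, by ring⟩, c1, c2, c3, c4⟩
  · rintro σ' _ ⟨h, _⟩
    rw [List.take_of_length_le (by simp [ho])] at h
    exact h

/-! ### Writing the policy to the output. -/

/-- The output consists of the pairs of `l`, followed by zeros. -/
structure OutIs (I : MSKC) (l : List (Fin I.n × Fin I.m)) (σ : Store) : Prop where
  holds : Holds (σ 1) 0 ((l.map some).flatMap encodeSelection)
  zero : ∀ z, 2 * (l.length : ℤ) ≤ z → σ 1 z = 0

theorem length_flatMap_encodeSelection {n m : ℕ} (l : List (Option (Fin n × Fin m))) :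
    (l.flatMap encodeSelection).length = 2 * l.length := by
  induction l with
  | nil => rfl
  | cons x l ih =>
    rw [List.flatMap_cons, List.length_append, ih, List.length_cons]
    rcases x with _ | ⟨i, j⟩ <;> simp [encodeSelection] <;> ring

/-- The symbol `⊥` is encoded by zeros, which is what unwritten memory contains, so the program need
not write it. -/
theorem OutIs.holds_encode {l : List (Fin I.n × Fin I.m)} {σ : Store} (h : OutIs I l σ)
    (hl : (l.map Prod.fst).Nodup) :
    Holds (σ 1) 0 (NonAdaptivePolicy.ofList I l hl).encode := by
  rw [NonAdaptivePolicy.encode, NonAdaptivePolicy.ofFn_ofList, List.flatMap_append, holds_append]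
  refine ⟨h.holds, fun k hk => ?_⟩
  rw [length_flatMap_encodeSelection, List.length_map, h.zero _ (by push_cast; omega)]
  have : ∀ z ∈ (List.replicate (I.n - l.length) (none : Option (Fin I.n × Fin I.m))).flatMap
      encodeSelection, z = 0 := by
    intro z hz
    simp only [List.mem_flatMap, List.mem_replicate] at hz
    obtain ⟨x, ⟨_, rfl⟩, hz⟩ := hz
    simpa [encodeSelection] using hz
  exact (this _ (List.getElem_mem hk)).symm

theorem listProg_spec (hP : Params I X b Y Z R) {σ : Store} (h0 : σ 0 = I.words)
    (hch : ∀ i : Fin I.n, σ rCh i = (sel i).elim 0 fun j => I.idx i j + 1)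
    (hO : σ rO 0 = 0) (h1 : ∀ z, σ 1 z = 0) :
    Tr X b listProg σ (OutIs I (I.selPairs sel
      (if 2 * σ rCross 0 ≤ σ rWT 0 * σ rPm 0 - σ rDiag 0 then List.finRange I.n
        else (List.finRange I.n).reverse))) := by
  have hX4 := hP.X_lt
  have hX1 : (1 : ℤ) ≤ X := by exact_mod_cast hP.X_pos
  have hn : (I.n : ℤ) ≤ X := by exact_mod_cast hP.n_le
  set o := if 2 * σ rCross 0 ≤ σ rWT 0 * σ rPm 0 - σ rDiag 0 then List.finRange I.n
        else (List.finRange I.n).reverse with ho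
  have holen : o.length = I.n := by
    rw [ho]
    split_ifs <;> simp
  refine Tr.for (fun k τ => OutIs I (I.selPairs sel (o.take k)) τ ∧
      τ rO 0 = 2 * (I.selPairs sel (o.take k)).length)
    (N := I.n) hP.n_le (by linarith) (by simp [Program.writes]) ?_ ?_ ?_ ?_
  · intro σ' hf
    have g0 := hf 0 (by simp [Program.writes]) (by norm_num)
    simp [g0, h0, I.words_zero]
  · intro σ' hf
    refine ⟨⟨?_, fun z _ => ?_⟩, ?_⟩
    · simpa [selPairs] using holds_nil _ _
    · simp [hf 1, h1]
    · simp [hf rO, hO, selPairs]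
  · rintro k hk σ' hf hK ⟨out, hlen⟩
    have fr : ∀ a, a ∉ [rX, 1, rO, rI] → σ' a = σ a := by
      intro a ha
      simp only [List.mem_cons, List.not_mem_nil, or_false, not_or] at ha
      exact hf a (by simp [Program.writes, ha]) ha.2.2.2
    have g0 : σ' 0 = I.words := by rw [fr 0 (by norm_num), h0]
    have gC : σ' rCross = σ rCross := fr _ (by norm_num)
    have gD : σ' rDiag = σ rDiag := fr _ (by norm_num)
    have gW : σ' rWT = σ rWT := fr _ (by norm_num)
    have gM : σ' rPm = σ rPm := fr _ (by norm_num)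
    have gCh : σ' rCh = σ rCh := fr _ (by norm_num)
    have hk' : k < o.length := by rwa [holen]
    have wn := I.words_zero
    have wm := I.words_one
    set l := I.selPairs sel (o.take k) with hl
    have hlk : l.length ≤ k := (List.length_filterMap_le _ _).trans (by simp)
    have hlX : (l.length : ℤ) + 1 ≤ X := by
      have : (l.length : ℤ) + 1 ≤ I.n := by exact_mod_cast hlk.trans_lt hk
      linarith
    set i := o[k] with hi
    have tk : I.selPairs sel (o.take (k + 1)) = l ++ I.selPairs sel [i] := by
      rw [hl, List.take_succ_eq_append_getElem hk', selPairs, List.filterMap_append]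
      rfl
    -- The two orders differ only in the choice of `rX`; what follows is treated once.
    have step : ∀ τ : Store, (∀ a ≠ rX, τ a = σ' a) → τ rX 0 = i →
        Tr X b (.ite (.read rCh (.var rX))
          (.seq (.write 1 (.var rO) (.var rX + 1))
            (.seq (.write 1 (.var rO + 1) (.read rCh (.var rX) - .var rX * .read 0 1))
              (.assign rO (.var rO + 2)))) .skip) τ fun τ => ∀ τ' : Store, (∀ a ≠ rI, τ' a = τ a) →
          OutIs I (I.selPairs sel (o.take (k + 1))) τ' ∧
            τ' rO 0 = 2 * (I.selPairs sel (o.take (k + 1))).length := by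
      intro τ hτ hX
      have k0 : τ 0 = I.words := by rw [hτ 0 (by norm_num), g0]
      have k1 : τ 1 = σ' 1 := hτ _ (by norm_num)
      have kO : τ rO = σ' rO := hτ _ (by norm_num)
      have kCh : τ rCh = σ rCh := by rw [hτ _ (by norm_num), gCh]
      have hiX : (i : ℤ) + 1 ≤ X := by
        have : (i : ℤ) + 1 ≤ I.n := by exact_mod_cast i.2
        linarith
      cases hs : sel i with
      | none =>
        refine .ite (fun hc => ?_) fun _ => .skip fun τ' hτ' => ?_
        · simp [hX, kCh, hch, hs] at hc
        · have : I.selPairs sel [i] = [] := by simp [selPairs, hs]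
          rw [tk, this, List.append_nil, hτ' rO (by norm_num), kO]
          refine ⟨⟨?_, ?_⟩, hlen⟩
          · rw [hτ' 1 (by norm_num), k1]
            exact out.holds
          · rw [hτ' 1 (by norm_num), k1]
            exact out.zero
      | some j =>
        -- The stored address is shifted by 1, so that 0 can mean no choice. The shift also yields
        -- the choice number counted from 1.
        have e2 : σ rCh i - i * I.m = j + 1 := by
          rw [hch, hs]
          simp [idx]
          ring
        have hj : (j : ℤ) + 1 ≤ X := by
          have h1 : (j : ℤ) + 1 ≤ I.m := by exact_mod_cast j.2
          have h2 : (I.m : ℤ) ≤ X := by exact_mod_cast hP.m_le i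
          linarith
        refine .ite (fun _ => ?_) fun hc => ?_
        · refine .seq (.write ?_ (.seq (.write ?_ (.write ?_ fun τ' hτ' => ?_))))
          · simp [hX]
            rw [abs_of_nonneg (by positivity)]
            linarith
          · simp [hX, k0, wm, kCh, e2]
            rw [abs_of_nonneg (by positivity)]
            linarith
          · simp [kO, hlen]
            rw [abs_of_nonneg (by positivity)]
            linarith
          · have hsp : I.selPairs sel [i] = [(i, j)] := by simp [selPairs, hs]
            have ev : ∀ z, τ' 1 z = if z = 2 * (l.length : ℤ) + 1 then (j : ℤ) + 1 else
                if z = 2 * (l.length : ℤ) then (i : ℤ) + 1 else σ' 1 z := fun z => by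
              rw [hτ' 1 (by norm_num)]
              simp [kO, hlen, hX, k0, wm, kCh, e2, k1]
            rw [tk, hsp]
            refine ⟨⟨?_, fun z hz => ?_⟩, ?_⟩
            · rw [List.map_append, List.flatMap_append, holds_append]
              constructor
              · intro t ht
                rw [← out.holds t ht]
                rw [length_flatMap_encodeSelection, List.length_map] at ht
                rw [ev, if_neg (by omega), if_neg (by omega)]
              · rw [length_flatMap_encodeSelection, List.length_map]
                simp only [List.map_cons, List.map_nil, List.flatMap_cons, List.flatMap_nil,
                  List.append_nil, encodeSelection, holds_cons, holds_nil, and_true, ev]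
                push_cast
                simp
            · rw [List.length_append] at hz
              push_cast at hz
              simp at hz
              rw [ev, if_neg (by omega), if_neg (by omega)]
              exact out.zero z (by omega)
            · rw [hτ' rO (by norm_num)]
              simp [kO, hlen]
              ring
        · have := idx_nonneg i j
          simp [hX, kCh, hch, hs] at hc
          omega
    refine .seq (.ite (fun hc => .write ?_ ?_) fun hc => .write ?_ ?_)
    · simp [hK]
      linarith
    · have hc' : 2 * σ rCross 0 ≤ σ rWT 0 * σ rPm 0 - σ rDiag 0 := by
        simp [gC, gD, gW, gM] at hc
        linarith
      refine step _ (fun a ha => Store.set_of_ne ha) ?_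
      have : (i : ℕ) = k := by
        simp [hi, ho, hc']
      simp [hK, this]
    · simp [hK, g0, wn]
      rw [abs_of_nonneg (by omega)]
      linarith
    · have hc' : ¬ 2 * σ rCross 0 ≤ σ rWT 0 * σ rPm 0 - σ rDiag 0 := by
        simp [gC, gD, gW, gM] at hc
        linarith
      refine step _ (fun a ha => Store.set_of_ne ha) ?_
      have : (i : ℕ) = I.n - 1 - k := by
        simp [hi, ho, hc']
      simp [hK, g0, wn, this]
      omega
  · rintro σ' _ ⟨h, _⟩
    rwa [List.take_of_length_le holen.le] at h

theorem singleProg_spec (hP : Params I X b Y Z R) {σ : Store} {i : Fin I.n} {j : Fin I.m}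
    (h0 : σ 0 = I.words) (hK : σ rBK 0 = I.idx i j) (h1 : ∀ z, σ 1 z = 0) :
    Tr X b singleProg σ (OutIs I [(i, j)]) := by
  have hX4 := hP.X_lt
  have hX1 : (1 : ℤ) ≤ X := by exact_mod_cast hP.X_pos
  have hn : (I.n : ℤ) ≤ X := by exact_mod_cast hP.n_le
  have wm := I.words_one
  have hdiv := idx_div i j
  have hmod : I.idx i j - i * I.m = j := by simp [idx]
  have hi : (i : ℤ) + 1 ≤ I.n := by exact_mod_cast i.2
  have hj : (j : ℤ) + 1 ≤ I.m := by exact_mod_cast j.2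
  have hm : (I.m : ℤ) ≤ X := by exact_mod_cast hP.m_le i
  refine .seq (.write ?_ (.write ?_ ⟨?_, fun z hz => ?_⟩))
  · simp [h0, wm, hK, hdiv]
    rw [abs_of_nonneg (by positivity)]
    linarith
  · simp [h0, wm, hK, hdiv, hmod]
    rw [abs_of_nonneg (by positivity)]
    linarith
  · simp only [List.map_cons, List.map_nil, List.flatMap_cons, List.flatMap_nil,
      List.append_nil, encodeSelection, holds_cons, holds_nil, and_true]
    simp [h0, wm, hK, hdiv, hmod]
  · simp at hz
    have e0 : z ≠ 0 := by omega
    have e1 : z ≠ 1 := by omega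
    simp [h1, e0, e1]

end MSKC

/-! ### Assembly of the algorithm and the polynomial bounds. -/

namespace MSKC

variable {I : MSKC} {X b : ℕ} {Y Z R : ℤ}

theorem sum_finRange {n : ℕ} (g : Fin n → ℚ) : ((List.finRange n).map g).sum = ∑ i, g i := by
  rw [← List.sum_ofFn, List.ofFn_eq_map]

theorem ReadInv.env {σ τ : Store} (hP : Params I X b Y Z R)
    (h : ReadInv I Z (I.n * I.m) σ) (h0 : τ 0 = I.words) (hQ : τ rQ = σ rQ)
    (hAN : τ rAN = σ rAN) (hAW : τ rAW = σ rAW) (hs : ScaleInv I R (I.n * I.m) τ) :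
    Env I R ((σ rAN 0 : ℚ) / σ rAW 0) τ := by
  have hAWp : (0 : ℚ) < σ rAW 0 := by exact_mod_cast h.AW_pos
  refine ⟨h0, hs, hQ ▸ h.Q_pos, hQ ▸ h.Q_le.trans (hP.pow_le_R le_rfl), hAW ▸ h.AW_pos, ?_, ?_⟩
  · rw [le_div_iff₀ hAWp, one_mul]
    exact_mod_cast h.AW_le
  · rw [hAN, hAW, div_mul_cancel₀ _ hAWp.ne']

/-- The algorithm computes a policy with the claimed guarantee. -/
theorem algorithm_spec (hP : Params I X b Y Z R) :
    Tr X b algorithm (initStore I.encode) fun τ => ∃ π : I.NonAdaptivePolicy,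
      Holds (τ 1) 0 π.encode ∧ I.ADAPT ≤ 8 * (1 + I.alpha) * (π.expectedProfit : ℝ) := by
  refine .seq ((readProg_spec hP).mono fun σ₁ _ f1 hr => ?_)
  -- Later stages rely on their arrays still being 0, so the untouched arrays are tracked from stage
  -- to stage.
  have z1 : ∀ a, a ∉ readProg.writes → a ≠ 0 → ∀ k, σ₁ a k = 0 := fun a ha h0 k => by
    rw [f1 a ha]
    simp [initStore, h0]
  simp only [readProg, itemProg, pairProg, distProg, atomProg, storeProg, alphaProg, Program.for,
    Program.writes, List.cons_append, List.nil_append, List.mem_cons, List.not_mem_nil, or_false,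
    not_or] at z1
  have w1 : σ₁ 0 = I.words := f1 0 (by simp [readProg, itemProg, pairProg, distProg, atomProg,
    storeProg, alphaProg, Program.for, Program.writes])
  refine .seq ((scaleProg_spec hP w1 hr (z1 _ (by norm_num) (by norm_num) _)).mono
    fun σ₂ _ f2 hs => ?_)
  simp only [scaleProg, Program.for, Program.writes, List.cons_append, List.nil_append,
    List.mem_cons, List.not_mem_nil, or_false, not_or] at f2
  have w2 : σ₂ 0 = I.words := by rw [f2 _ (by norm_num), w1]
  set A : ℚ := (σ₁ rAN 0 : ℚ) / σ₁ rAW 0 with hA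
  have env2 : Env I R A σ₂ := hr.env hP w2 (f2 _ (by norm_num)) (f2 _ (by norm_num))
    (f2 _ (by norm_num)) hs
  have z2 : ∀ a, a ∉ [rI, rJ, rT, rP, rV, rD, rA, rC, rWn, rUn, rDn, rQ, rAN, rAW, rW, rU, rK,
      rBest, rBK, 0] → ∀ k, σ₂ a k = 0 := fun a ha k => by
    simp only [List.mem_cons, List.not_mem_nil, or_false, not_or] at ha
    rw [f2 a (by simp [ha])]
    exact z1 a (by simp [ha]) (by simp [ha]) k
  refine .seq ((greedyProg_spec hP env2 (z2 _ (by norm_num)) (z2 _ (by norm_num))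
    (z2 _ (by norm_num)) (z2 _ (by norm_num) 0) (z2 _ (by norm_num) 0)).mono
    fun σ₃ _ f3 ⟨sel, hsel, hend⟩ => ?_)
  simp only [greedyProg, searchProg, upgradeProg, Program.for, Program.writes, List.cons_append,
    List.nil_append, List.mem_cons, List.not_mem_nil, or_false, not_or] at f3
  have w3 : σ₃ 0 = I.words := by rw [f3 _ (by norm_num), w2]
  have z3 : ∀ a, a ∉ [rI, rJ, rT, rP, rV, rD, rA, rC, rWn, rUn, rDn, rQ, rAN, rAW, rW, rU, rK,
      rBest, rBK, 0, rR, rGa, rGb, rGk, rM, rCh, rCw, rCu, rStop] → ∀ k, σ₃ a k = 0 :=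
    fun a ha k => by
      simp only [List.mem_cons, List.not_mem_nil, or_false, not_or] at ha
      rw [f3 a (by simp [ha])]
      exact z2 a (by simp [ha]) k
  have env3 : Env I R A σ₃ := env2.congr (f3 _ (by norm_num)) (f3 _ (by norm_num))
    (f3 _ (by norm_num)) (f3 _ (by norm_num)) (f3 _ (by norm_num)) (f3 _ (by norm_num))
    (f3 _ (by norm_num)) (f3 _ (by norm_num))
  refine .seq ((sumProg_spec hP w3 hsel (z3 _ (by norm_num) 0) (z3 _ (by norm_num) 0)
    (z3 _ (by norm_num) 0) (z3 _ (by norm_num) 0)).mono fun σ₄ _ f4 ⟨s1, s2, s3, s4⟩ => ?_)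
  simp only [sumProg, Program.for, Program.writes, List.cons_append, List.nil_append,
    List.mem_cons, List.not_mem_nil, or_false, not_or] at f4
  have w4 : σ₄ 0 = I.words := by rw [f4 _ (by norm_num), w3]
  have out4 : ∀ k, σ₄ 1 k = 0 := fun k => by
    rw [f4 _ (by norm_num)]
    exact z3 _ (by norm_num) k
  have O4 : σ₄ rO 0 = 0 := by
    rw [f4 _ (by norm_num)]
    exact z3 _ (by norm_num) 0
  have B4 : σ₄ rBest = σ₃ rBest := f4 _ (by norm_num)
  have K4 : σ₄ rBK = σ₃ rBK := f4 _ (by norm_num)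
  have Ch4 : σ₄ rCh = σ₃ rCh := f4 _ (by norm_num)
  have hQ : (0 : ℚ) < σ₃ rQ 0 := by exact_mod_cast env3.Q_pos
  have hAWp : (0 : ℚ) < σ₁ rAW 0 := by exact_mod_cast hr.AW_pos
  have hidx : ∀ i j, I.idx i j < (I.n * I.m : ℕ) := fun i j => by exact_mod_cast idx_lt i j
  set best : ℚ := (σ₃ rBest 0 : ℚ) / σ₃ rQ 0 with hbest
  have hbQ : (σ₃ rBest 0 : ℚ) = σ₃ rQ 0 * best := by
    rw [hbest, mul_div_cancel₀ _ hQ.ne']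
  have hb0 : 0 ≤ best :=
    div_nonneg (by exact_mod_cast env3.scale.best_nonneg) hQ.le
  have hb : ∀ i j, I.netProfit i j ≤ best := fun i j => by
    rw [hbest, le_div_iff₀ hQ, mul_comm, ← env3.scale.profit i j (hidx i j)]
    exact_mod_cast env3.scale.le_best i j (hidx i j)
  have hA1 := env3.one_le
  have hp : ∀ i j, 0 < I.netProfit i j → I.netProfit i j + I.p i j ≤ A * I.netProfit i j :=
    fun i j h => by
      rw [hA, div_mul_eq_mul_div, le_div_iff₀ hAWp]
      exact hr.alpha_le i j (hidx i j) h
  have hA' : A = 1 ∨ ∃ i j, 0 < I.netProfit i j ∧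
      I.netProfit i j + I.p i j = A * I.netProfit i j := by
    rcases hr.alpha_eq with h | ⟨i, j, h, h'⟩
    · left
      rw [hA, h, div_self hAWp.ne']
    · refine Or.inr ⟨i, j, h, ?_⟩
      rw [hA, div_mul_eq_mul_div, eq_div_iff hAWp.ne']
      exact h'
  rw [sum_finRange] at s2 s3 s4
  set W := ∑ i, I.selProfit sel i with hW
  set M := ∑ i, I.selSize sel i with hM
  set D := ∑ i, I.selProfit sel i * I.selSize sel i with hD
  -- The threshold 3 is where `(W - best) / 2 ≥ (W + best) / 4` begins to hold; below it, `best ≥ (W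
  -- + best) / 4`.
  have htest : 3 * σ₄ rBest 0 ≤ σ₄ rWT 0 ↔ 3 * best ≤ W := by
    rw [B4, ← Int.cast_le (R := ℚ)]
    push_cast
    rw [s3, hbQ, mul_left_comm, mul_le_mul_iff_right₀ hQ]
  refine .ite (fun hc => ?_) fun hc => ?_
  · have hc' : 3 * best ≤ W := by
      rw [← htest]
      simp at hc
      linarith
    refine (listProg_spec hP w4 (sel := sel) (by rw [Ch4]; exact hsel.ch) O4 out4).mono
      fun τ _ _ hout => ?_
    have hflag : 2 * σ₄ rCross 0 ≤ σ₄ rWT 0 * σ₄ rPm 0 - σ₄ rDiag 0 ↔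
        2 * (List.finRange I.n).crossSum (I.selSize sel) (I.selProfit sel) ≤ W * M - D := by
      rw [← Int.cast_le (R := ℚ)]
      push_cast
      rw [s1, s2, s3, s4, ← mul_le_mul_iff_right₀ (mul_pos hQ hQ)
        (b := 2 * (List.finRange I.n).crossSum (I.selSize sel) (I.selProfit sel))]
      constructor <;> intro h <;> linarith
    set o := if 2 * σ₄ rCross 0 ≤ σ₄ rWT 0 * σ₄ rPm 0 - σ₄ rDiag 0 then List.finRange I.n
      else (List.finRange I.n).reverse with ho
    have hperm : o.Perm (List.finRange I.n) := by
      rw [ho]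
      split_ifs
      · exact List.Perm.refl _
      · exact List.reverse_perm _
    have hcross : 2 * o.crossSum (I.selSize sel) (I.selProfit sel) ≤ W * M - D := by
      rw [ho]
      split_ifs with h
      · exact hflag.mp h
      -- The first order has more than half of `W * M - D`, so its reverse has less than half.
      · rw [hflag, not_le] at h
        have := List.crossSum_add_crossSum_reverse (I.selSize sel) (I.selProfit sel)
          (List.finRange I.n)
        rw [sum_finRange, sum_finRange, sum_finRange] at this
        linarith
    have hnd : ((I.selPairs sel o).map Prod.fst).Nodup :=
      nodup_selPairs (hperm.nodup_iff.mpr (List.nodup_finRange _))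
    refine ⟨_, hout.holds_encode hnd, hend.approximation hA1 hb hb0 hp hA' _ ?_⟩
    have := hend.le_expectedProfit hA1 hb hb0 hp hperm hcross hnd
    linarith
  · have hc' : W < 3 * best := by
      rw [← not_le, ← htest]
      simp at hc
      linarith
    have hW0 : 0 ≤ W := Finset.sum_nonneg fun i _ => hend.selProfit_nonneg i
    -- `best = 0` would make `W` negative. Otherwise `rBK` is the address of a pair of net profit
    -- `best`.
    rcases env3.scale.best_eq with h | ⟨i, j, hij, hk, hw⟩
    · rw [hbest, h, Int.cast_zero, zero_div] at hc'
      linarith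
    · refine (singleProg_spec hP w4 (by rw [K4]; exact hk) out4).mono fun τ _ _ hout => ?_
      refine ⟨_, hout.holds_encode (by simp), hend.approximation hA1 hb hb0 hp hA' _ ?_⟩
      rw [NonAdaptivePolicy.expectedProfit_ofList_singleton]
      have e : I.pairProfit (i, j) = best := by
        have := env3.scale.profit i j hij
        rw [hw, hbQ] at this
        exact (mul_left_cancel₀ hQ.ne' this).symm
      rw [e]
      linarith

/-- A bound on the bit length of the numbers that the algorithm handles, as a polynomial in the input
length. -/
noncomputable def bitBound : Polynomial ℕ :=
  2 + 2 * Polynomial.X +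
    2 * ((1 + 2 * Polynomial.X + 2 * Polynomial.X * Polynomial.X) * (Polynomial.X + 1))

theorem eval_bitBound (L : ℕ) :
    bitBound.eval L = 2 + 2 * L + 2 * ((1 + 2 * L + 2 * L * L) * (L + 1)) := by
  simp [bitBound]

/-- With input length `L`, the values are `X = L`, `Y = 2 ^ L`, `Z = 2 * Y ^ 2 * Y ^ (2 * L)` and `R
= Z ^ (L + 1)`, as there are at most `L` pairs. The bit bound is chosen so that `2 ^ b = 4 * (2 ^ L)
^ 2 * R ^ 2`, and `L < 2 ^ L` gives the last inequality. -/
theorem params (I : MSKC) :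
    Params I I.inputLength (bitBound.eval I.inputLength) (2 ^ I.inputLength)
      (2 ^ (1 + 2 * I.inputLength + 2 * I.inputLength * I.inputLength))
      (2 ^ ((1 + 2 * I.inputLength + 2 * I.inputLength * I.inputLength) *
        (I.inputLength + 1))) where
  words_le := I.abs_words_le
  two_le := by
    have := I.two_le_inputLength
    calc (2 : ℤ) = 2 ^ 1 := by norm_num
      _ ≤ _ := pow_le_pow_right₀ (by norm_num) (by omega)
  n_le := I.n_le
  nm_le := I.nm_le
  length_le := I.length_encode_le
  m_le := I.m_le
  len_le := I.atoms_length_le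
  X_pos := by have := I.two_le_inputLength; omega
  le_Z := by
    rw [pow_add, pow_add, ← pow_mul, ← pow_mul]
    apply le_of_eq
    ring
  le_R := by
    rw [← pow_succ', ← pow_mul]
    exact pow_le_pow_right₀ (by norm_num) (Nat.mul_le_mul_left _ (Nat.succ_le_succ I.nm_le))
  R_lt := by
    set L := I.inputLength
    set e := (1 + 2 * L + 2 * L * L) * (L + 1) with he
    have hL : (L : ℤ) < 2 ^ L := by exact_mod_cast Nat.lt_two_pow_self
    have h2 : (L : ℤ) ^ 2 < (2 ^ L) ^ 2 := pow_lt_pow_left₀ hL (by positivity) two_ne_zero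
    have h3 : (0 : ℤ) < (2 ^ e) ^ 2 := by positivity
    have h4 : (2 : ℤ) ^ bitBound.eval L = 4 * (2 ^ L) ^ 2 * (2 ^ e) ^ 2 := by
      rw [eval_bitBound, ← he, pow_add, pow_add, ← pow_mul, ← pow_mul, mul_comm L, mul_comm e]
      norm_num
    rw [h4]
    have := mul_lt_mul_of_pos_right h2 h3
    linarith

end MSKC

/-- A polynomial-time algorithm for the multi-choice stochastic knapsack problem with costs that
computes a non-adaptive policy within a factor `8 * (1 + α)` of the adaptive optimum. -/
theorem mainTheorem1 :
    ∃ (algorithm : RAM.Program) (T : Polynomial ℕ), ∀ I : MSKC,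
      ∃ π : I.NonAdaptivePolicy,
        RAM.HaltsWith algorithm I.encode π.encode (T.eval I.inputLength) ∧
        I.ADAPT ≤ 8 * (1 + I.alpha) * (π.expectedProfit : ℝ) := by
  -- The input length bounds the rounds of every loop, so `steps` is evaluated there; the other
  -- factor is `b + 1` from the time bound in `Tr`.
  refine ⟨MSKC.algorithm, MSKC.algorithm.steps * (MSKC.bitBound + 1), fun I => ?_⟩
  have hb : Bdd (MSKC.bitBound.eval I.inputLength) (initStore I.encode) :=
    initStore_bdd fun z hz => (I.abs_lt_of_mem_encode hz).trans_le
      (pow_le_pow_right₀ (by norm_num) (by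
        rw [MSKC.eval_bitBound]
        exact le_trans (by omega) (Nat.le_add_right _ _)))
  obtain ⟨σ, t, h1, h2, _, _, π, h3, h4⟩ := MSKC.algorithm_spec I.params hb
  refine ⟨π, ⟨σ, t, h1, ?_, fun k hk => ?_⟩, h4⟩
  · simpa using h2
  · have := h3 k hk
    rwa [zero_add] at this
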